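/- Let $\ell>0$ and let $(x_1,w_1),\dots,(x_n,w_n)$ be a stream of elements with keys $x_i\in\mathcal X$ and weights $w_i>0$. Let $w_x=\sum_{i:\,x_i=x}w_i$ be the weight of the key $x$. Each key $x$ has a base hash $\mathrm{KeyBase}(x)=\mathrm{Hash}(x)/\ell$, where $\mathrm{Hash}(x)$ is uniform on $[0,1]$ and fixed for the whole computation. Each call of $\mathrm{rand}()$ returns a fresh uniform number in $[0,1]$. All hashes and all calls are independent. *Fixed-$\tau$ continuous $\mathrm{SH}_\ell$* ($0<\tau<\infty$). Start with an empty cache and process the elements $(x,w)$ in order. If $x$ is cached, increase its counter by $w$. Otherwise let $\Delta=-\ln(1-\mathrm{rand}())/\max\{\tau,1/\ell\}$; if $\mathrm{KeyBase}(x)<\min\{\tau,1/\ell\}$ and $\Delta<w$, insert $x$ with counter $w-\Delta$. *Fixed-$k$ continuous $\mathrm{SH}_\ell$* ($k\ge 1$). Start with an empty cache and $\tau=\infty$, and process the elements $(x,w)$ in order. If $x$ is cached, increase its counter by $w$. Otherwise let $\Delta=-\ln(1-\mathrm{rand}())/\max\{1/\ell,\tau\}$ (so $\Delta=0$ when $\tau=\infty$).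 If $\Delta<w$, and either $\tau\ell>1$, or $\tau\ell\le1$ and $\mathrm{KeyBase}(x)<\tau$, insert $x$ with counter $w-\Delta$. If the cache then holds $k+1$ keys, evict one as follows. - If $\tau\ell>1$: for each cached key $y$ with counter $C_y$ draw $u_y=\mathrm{rand}()$ and $r_y=\mathrm{rand}()$. Put $z_y=\min\{\tau u_y,\,-\ln(1-r_y)/C_y\}$, and if $z_y\le1/\ell$ replace $z_y$ by $\mathrm{KeyBase}(y)$. Delete a key $y$ with maximum $z_y$ and let $\tau^*=z_y$ for this key. For each remaining cached key $v$ with $u_v>\max\{\tau^*,1/\ell\}/\tau$, decrease $C_v$ by $-\ln(1-r_v)/\max\{1/\ell,\tau^*\}$. Set $\tau\leftarrow\tau^*$. - If $\tau\ell\le1$: delete a cached key $y$ with maximum $\mathrm{KeyBase}(y)$, and set $\tau\leftarrow\mathrm{KeyBase}(y)$. Let $c_x$ be the final counter of $x$ if $x$ is in the final cache $S$, and $c_x=0$ otherwise. For $0<\tau<\infty$ let $\phi_\tau\ge0$ be a random variable that has density $\tau\exp(-y\max\{1/\ell,\tau\})$ on $[0,w_x]$ and whose remaining mass lies beyond $w_x$.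 In the limit case $\tau=\infty$ let $\phi_\infty=0$. The randomization of the keys $z\ne x$ consists of their hashes and of independent variables $v_i\sim\mathrm{Exp}[w_i]$ (exponential with rate $w_i$), one for each element $i$ with key $x_i\neq x$. The score of element $i$ is $\mathrm{KeyBase}(x_i)$ if $v_i\le1/\ell$, and $v_i$ otherwise. The seed of a key $z$ is the minimum score of its elements ($\infty$ if it has none). Let $\tau^{-x}$ be the $k$-th smallest seed among the keys $z\ne x$ that occur in the stream ($\infty$ if there are fewer than $k$ such keys). **Theorem.** Let $x$ be any key. 1. For fixed-$\tau$ $\mathrm{SH}_\ell$, $c_x\sim\max\{0,w_x-\phi_\tau\}$. 2. For fixed-$k$ $\mathrm{SH}_\ell$, conditioned on the randomization of the other keys, $c_x\sim\max\{0,w_x-\phi_{\tau^{-x}}\}$, and this randomization determines the threshold and the other members of the sample when $x\in S$. Precisely: there is a Markov kernel $R$ from realizations $\omega'$ of the randomization of the keys $z\ne x$ to triples $(\tau,S,c_x)$, such that averaging $R(\omega',\cdot)$ over $\omega'$ gives the law of the output $(\tau,S,c_x)$ of the algorithm, and such that for almost every $\omega'$ the following holds under $R(\omega',\cdot)$: -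 almost surely, if $x\in S$, then $\tau=\tau^{-x}(\omega')$; - for each key $z\ne x$, almost surely, if $x\in S$, then $z\in S$ if and only if $\mathrm{seed}(z)(\omega')<\tau^{-x}(\omega')$; - $c_x\sim\max\{0,w_x-\phi_{\tau^{-x}(\omega')}\}$. -/

import Mathlib

open MeasureTheory ProbabilityTheory
open scoped ENNReal

/-- The random draws of the two streaming algorithms. -/
inductive Draw (X : Type*) where
  /-- the hash of a key, fixed for the whole computation -/
  | hash : X → Draw X
  /-- the call of `rand` that determines `Δ` when the `i`-th element is processed -/
  | entry : ℕ → Draw X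
  /-- the call of `rand` for `u_y` in the eviction step at the `i`-th element -/
  | evictU : ℕ → X → Draw X
  /-- the call of `rand` for `r_y` in the eviction step at the `i`-th element -/
  | evictR : ℕ → X → Draw X

/-- All draws are independent and uniform on `[0,1]`. -/
structure IsUniformTape {X Ω : Type*} [MeasurableSpace Ω]
    (rnd : Draw X → Ω → ℝ) (P : Measure Ω) : Prop where
  measurable : ∀ d, Measurable (rnd d)
  indep : iIndepFun rnd P
  law : ∀ d, P.map (rnd d) = volume.restrict (Set.Icc (0 : ℝ) 1)

/-- The cache: the set of cached keys, with a counter for each of them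
(the entries of `val` at keys that are not cached carry no meaning). -/
structure Counters (X : Type*) where
  keys : Finset X
  val : X → ℝ

namespace Counters

variable {X : Type*} [DecidableEq X]

def empty : Counters X := ⟨∅, fun _ => 0⟩

/-- `Counters{x} ← v`. -/
def set (C : Counters X) (x : X) (v : ℝ) : Counters X :=
  ⟨insert x C.keys, Function.update C.val x v⟩

/-- The count `c_x`: the counter of a cached key, and `0` for a key that is not cached. -/
def count (C : Counters X) (x : X) : ℝ := if x ∈ C.keys then C.val x else 0

end Counters

/-- `-ln(1-r)`, a standard exponential if `r` is uniform. -/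
noncomputable def expOf (r : ℝ) : ℝ := -Real.log (1 - r)

/-- The base hash of a key, `Hash(x)/ℓ`, uniform on `[0,1/ℓ]`. -/
noncomputable def keyBase {X : Type*} (ℓ : ℝ) (t : Draw X → ℝ) (x : X) : ℝ := t (.hash x) / ℓ

section FixedThreshold

variable {X : Type*} [DecidableEq X]

/-- Fixed `τ`: processing of the `i`-th element, which is `(x,w)`. -/
noncomputable def fixedTauStep (ℓ τ : ℝ) (t : Draw X → ℝ) (i : ℕ) (x : X) (w : ℝ)
    (C : Counters X) : Counters X :=
  if x ∈ C.keys then C.set x (C.val x + w)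
  else
    let Δ : ℝ := expOf (t (.entry i)) / max τ (1 / ℓ)
    if keyBase ℓ t x < min τ (1 / ℓ) ∧ Δ < w then C.set x (w - Δ) else C

/-- Fixed `τ`: the cache after the first `n` elements of the stream `(key i, wt i)`. -/
noncomputable def fixedTauRun (ℓ τ : ℝ) (key : ℕ → X) (wt : ℕ → ℝ) (t : Draw X → ℝ) :
    ℕ → Counters X
  | 0 => Counters.empty
  | i + 1 => fixedTauStep ℓ τ t i (key i) (wt i) (fixedTauRun ℓ τ key wt t i)

end FixedThreshold

section FixedSize

variable {X : Type*} [DecidableEq X]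

/-- `max{1/ℓ, τ}` for a threshold `τ ∈ [0,∞]`. -/
noncomputable def rate (ℓ : ℝ) (τ : ℝ≥0∞) : ℝ≥0∞ := max (ENNReal.ofReal (1 / ℓ)) τ

/-- `e / max{1/ℓ, τ}`, which is `0` if `τ = ∞`. -/
noncomputable def scaled (ℓ : ℝ) (τ : ℝ≥0∞) (e : ℝ) : ℝ := e * (rate ℓ τ)⁻¹.toReal

/-- The eviction threshold `z` of a cached key with counter `c`, base hash `b` and eviction draws
`u`, `r`, when the current threshold is `τ`. -/
noncomputable def evictThreshold (ℓ : ℝ) (τ : ℝ≥0∞) (c b u r : ℝ) : ℝ≥0∞ :=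
  let z := min (τ * ENNReal.ofReal u) (ENNReal.ofReal (expOf r / c))
  if z ≤ ENNReal.ofReal (1 / ℓ) then ENNReal.ofReal b else z

/-- A key of the finite set `S` that maximizes `f` (`none` only if `S` is empty); ties are broken
by a fixed enumeration of `S`. -/
noncomputable def argmaxKey (S : Finset X) (f : X → ℝ≥0∞) : Option X := S.toList.argmax f

/-- The eviction step at the `i`-th element. -/
noncomputable def evict (ℓ : ℝ) (t : Draw X → ℝ) (i : ℕ) (s : ℝ≥0∞ × Counters X) :
    ℝ≥0∞ × Counters X :=
  let τ := s.1
  let C := s.2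
  if 1 < τ * ENNReal.ofReal ℓ then
    let z : X → ℝ≥0∞ := fun y =>
      evictThreshold ℓ τ (C.val y) (keyBase ℓ t y) (t (.evictU i y)) (t (.evictR i y))
    match argmaxKey C.keys z with
    | none => s
    | some y =>
      let τ' := z y
      (τ',
        { keys := C.keys.erase y
          val := fun v =>
            if rate ℓ τ' / τ < ENNReal.ofReal (t (.evictU i v)) then
              C.val v - scaled ℓ τ' (expOf (t (.evictR i v)))
            else C.val v })
  else
    let b : X → ℝ≥0∞ := fun y => ENNReal.ofReal (keyBase ℓ t y)
    match argmaxKey C.keys b with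
    | none => s
    | some y => (b y, { keys := C.keys.erase y, val := C.val })

/-- Fixed `k`: processing of the `i`-th element, which is `(x,w)`. The state is the current
threshold and the cache. -/
noncomputable def fixedSizeStep (k : ℕ) (ℓ : ℝ) (t : Draw X → ℝ) (i : ℕ) (x : X) (w : ℝ)
    (s : ℝ≥0∞ × Counters X) : ℝ≥0∞ × Counters X :=
  let τ := s.1
  let C := s.2
  if x ∈ C.keys then (τ, C.set x (C.val x + w))
  else
    let Δ : ℝ := scaled ℓ τ (expOf (t (.entry i)))
    if Δ < w ∧ (1 < τ * ENNReal.ofReal ℓ ∨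
        (τ * ENNReal.ofReal ℓ ≤ 1 ∧ ENNReal.ofReal (keyBase ℓ t x) < τ)) then
      let C' := C.set x (w - Δ)
      if C'.keys.card = k + 1 then evict ℓ t i (τ, C') else (τ, C')
    else (τ, C)

/-- Fixed `k`: the threshold and the cache after the first `n` elements of the stream
`(key i, wt i)`. -/
noncomputable def fixedSizeRun (k : ℕ) (ℓ : ℝ) (key : ℕ → X) (wt : ℕ → ℝ) (t : Draw X → ℝ) :
    ℕ → ℝ≥0∞ × Counters X
  | 0 => (⊤, Counters.empty)
  | i + 1 => fixedSizeStep k ℓ t i (key i) (wt i) (fixedSizeRun k ℓ key wt t i)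

/-- The part of the output of the fixed-`k` algorithm that concerns `x`: the threshold `τ`, the
set of cached keys, and the count `c_x`. -/
noncomputable def fixedSizeOutput (k : ℕ) (ℓ : ℝ) (key : ℕ → X) (wt : ℕ → ℝ) (n : ℕ) (x : X)
    (t : Draw X → ℝ) : ℝ≥0∞ × Set X × ℝ :=
  ((fixedSizeRun k ℓ key wt t n).1,
    {z | z ∈ (fixedSizeRun k ℓ key wt t n).2.keys},
    (fixedSizeRun k ℓ key wt t n).2.count x)

end FixedSize

section Scores

variable {X : Type*} [DecidableEq X]

/-- The random variables behind the element scores: a hash for each key, and an exponential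
variable for each element. -/
inductive ScoreDraw (X : Type*) where
  | hash : X → ScoreDraw X
  | exp : ℕ → ScoreDraw X

/-- The key to whose randomization a draw belongs. -/
def ScoreDraw.owner (key : ℕ → X) : ScoreDraw X → X
  | .hash z => z
  | .exp i => key i

/-- `s` is the randomization of all keys other than `x`: independent hashes, uniform on `[0,1]`,
of the keys `z ≠ x`, and independent variables `Exp[wt i]`, one for each element `i` whose key
is not `x`. -/
structure IsScoreRandomizationOff {Ω' : Type*} [MeasurableSpace Ω'] (x : X)
    (key : ℕ → X) (wt : ℕ → ℝ) (s : ScoreDraw X → Ω' → ℝ) (P' : Measure Ω') : Prop where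
  measurable : ∀ d, d.owner key ≠ x → Measurable (s d)
  indep : iIndepFun (fun d : {d : ScoreDraw X // d.owner key ≠ x} => s d) P'
  law_hash : ∀ z, z ≠ x → P'.map (s (.hash z)) = volume.restrict (Set.Icc (0 : ℝ) 1)
  law_exp : ∀ i, key i ≠ x → P'.map (s (.exp i)) = expMeasure (wt i)

/-- The score of the `i`-th element, whose key has base hash `Hash/ℓ`. -/
noncomputable def elementScore (ℓ : ℝ) (key : ℕ → X) (s : ScoreDraw X → ℝ) (i : ℕ) : ℝ :=
  if s (.exp i) ≤ 1 / ℓ then s (.hash (key i)) / ℓ else s (.exp i)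

/-- The seed of a key: the minimum score of its elements among the first `n`
(`∞` if there are none). -/
noncomputable def seed (ℓ : ℝ) (key : ℕ → X) (n : ℕ) (s : ScoreDraw X → ℝ) (z : X) : ℝ≥0∞ :=
  ((Finset.range n).filter (fun i => key i = z)).inf
    (fun i => ENNReal.ofReal (elementScore ℓ key s i))

/-- The `k`-th smallest seed among the active keys other than `x`
(`∞` if there are fewer than `k` such keys). -/
noncomputable def thresholdOff (k : ℕ) (ℓ : ℝ) (key : ℕ → X) (n : ℕ) (x : X)
    (s : ScoreDraw X → ℝ) : ℝ≥0∞ :=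
  sInf {a | k ≤ ((((Finset.range n).image key).erase x).filter
    (fun z => seed ℓ key n s z ≤ a)).card}

end Scores

/-- The weight `w_x`: total weight of the elements with key `x` among the first `n`. -/
def keyWeight {X : Type*} [DecidableEq X] (key : ℕ → X) (wt : ℕ → ℝ) (n : ℕ) (x : X) : ℝ :=
  ∑ i ∈ (Finset.range n).filter (fun i => key i = x), wt i

/-- `ν` is a law of `φ ≥ 0` that has density `y ↦ τ exp(-y max{1/ℓ, τ})` on `[0,w]` (its remaining
mass lies beyond `w`). For `τ = ∞`, the limit case, `φ = 0`. -/
def IsLossLaw (ℓ : ℝ) (τ : ℝ≥0∞) (w : ℝ) (ν : Measure ℝ) : Prop :=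
  if τ = ⊤ then ν = Measure.dirac 0
  else IsProbabilityMeasure ν ∧ ν (Set.Iio 0) = 0 ∧
    ν.restrict (Set.Icc 0 w) = (volume.restrict (Set.Icc 0 w)).withDensity
      (fun y => ENNReal.ofReal (τ.toReal * Real.exp (-y * max (1 / ℓ) τ.toReal)))

/-! Give each key `z` of current weight `W z` an independent uniform hash and an independent
standard exponential `e_z`. The arrival value `e_z / W z` has the law of the minimum of the
variables `v_i` of its elements, and `seedOf` turns it into a seed: the base hash if the arrival
value is at most `1/ℓ`, the arrival value itself otherwise. `idealState` is the bottom-`k` sample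
for these seeds: the threshold `τ` is the `(k+1)`-st smallest seed, the cache holds the keys with
smaller seeds, and a cached key has counter `W z - e_z / max{1/ℓ, τ}`. The heart of the proof is an
invariant: after each element, the joint law of threshold, cache, counts and hashes in the fixed-`k`
algorithm is that of `idealState` for the weights seen so far (`lintegral_fixedSizeRun`).

The inductive step for an element `(y, w)` passes through `mixedState`, which keeps the old
exponential of `y` next to a new one for the element and lets the old elements take precedence in
the counter. Unless a key is evicted at a threshold above `1/ℓ`, the algorithm produces `mixedState`
pathwise, almost surely (`stepState_eq_mixedState`); at thresholds up to `1/ℓ` the cached seeds are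
base hashes and the rate does not change.

In an eviction at a threshold `t > 1/ℓ` the algorithm draws new arrival values from the counters `ω
- e/t`. For `0 < L ≤ t` and `p = L/t`, thinning says that `p e + 1{p < u} E` is again standard
exponential (`map_thinning`). Up to null sets, the redrawn value `min{t u, E/(ω - e/t)}` is below
`L` exactly when the counter `ω - (p e + 1{p < u} E)/L`, lowered to rate `L`, is positive. This is
the condition `e/ω < L` for the original value, with `e` replaced by the thinned variable. Hence the
redraw changes neither the law of the evicted seed (`lintegral_redraw`) nor that of the surviving
counters (`lintegral_lowering`), and by independence across keys the whole outcome keeps its law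
(`lintegral_evictState`).

Finally, `mixedState` has the law of `idealState` for the increased weight (`lintegral_mixedState`).
With the other keys fixed, memorylessness (`map_memoryless`) handles the counter when `y` is
sampled, and the law of a minimum of exponentials (`map_min_arrival`) handles its seed when it is
not.

For the conditional statement, the hashes and minima of the keys other than `x` are kept and the
pair of `x` alone is drawn afresh; this is the kernel `R`. If `x` is sampled, removing it from the
ranking turns the `(k+1)`-st smallest seed into the `k`-th smallest seed of the others
(`kthSmallest_erase_of_lt`), which settles the threshold and the other members. The key `x` is
sampled when its base hash is below the threshold `τ` and `e/r < w_x` for `r = max{1/ℓ, τ}`; the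
identity `P(base hash < τ) * r = τ` gives the density of the loss (`exists_isLossLaw`). The
fixed-`τ` claim is a direct induction along the stream by memorylessness (`lintegral_fixedTauRun`).
-/

/-! ### Uniform and exponential laws, memorylessness, thinning -/

/-- The uniform law on `[0,1]`. -/
noncomputable def unifLaw : Measure ℝ := volume.restrict (Set.Icc (0 : ℝ) 1)

/-- The standard exponential law. -/
noncomputable def stdExp : Measure ℝ := expMeasure 1

instance : IsProbabilityMeasure unifLaw := ⟨by simp [unifLaw]⟩

instance : IsProbabilityMeasure stdExp := isProbabilityMeasure_expMeasure one_pos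

theorem expMeasure_Ioi {r s : ℝ} (hr : 0 < r) (hs : 0 ≤ s) :
    expMeasure r (Set.Ioi s) = ENNReal.ofReal (Real.exp (-(r * s))) := by
  have := isProbabilityMeasure_expMeasure hr
  have h := cdf_expMeasure_eq hr s
  rw [cdf_eq_real, if_pos hs] at h
  have h2 : (expMeasure r).real (Set.Ioi s) = Real.exp (-(r * s)) := by
    rw [← Set.compl_Iic, probReal_compl_eq_one_sub measurableSet_Iic, h]; ring
  rw [← h2, ofReal_measureReal]

theorem eq_expMeasure {r : ℝ} (hr : 0 < r) (μ : Measure ℝ) [IsProbabilityMeasure μ]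
    (h : ∀ s, 0 ≤ s → μ (Set.Ioi s) = ENNReal.ofReal (Real.exp (-(r * s)))) :
    μ = expMeasure r := by
  have := isProbabilityMeasure_expMeasure hr
  apply Measure.eq_of_cdf
  ext s
  have key : ∀ s, 0 ≤ s → cdf μ s = 1 - Real.exp (-(r * s)) := by
    intro s hs
    have h2 : μ.real (Set.Ioi s) = Real.exp (-(r * s)) := by
      rw [measureReal_def, h s hs, ENNReal.toReal_ofReal (Real.exp_pos _).le]
    rw [cdf_eq_real, ← Set.compl_Ioi, probReal_compl_eq_one_sub measurableSet_Ioi, h2]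
  rw [cdf_expMeasure_eq hr]
  split_ifs with hs
  · exact key s hs
  -- For `s < 0` the cdf vanishes by monotonicity, because it already vanishes at `0`.
  · have h0 := key 0 le_rfl
    have h1 := monotone_cdf μ (not_le.1 hs).le
    have h2 := cdf_nonneg μ s
    simp at h0
    linarith

theorem stdExp_Ioi {s : ℝ} (hs : 0 ≤ s) :
    stdExp (Set.Ioi s) = ENNReal.ofReal (Real.exp (-s)) := by
  rw [stdExp, expMeasure_Ioi one_pos hs, one_mul]

theorem eq_stdExp (μ : Measure ℝ) [IsProbabilityMeasure μ]
    (h : ∀ s, 0 ≤ s → μ (Set.Ioi s) = ENNReal.ofReal (Real.exp (-s))) : μ = stdExp :=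
  eq_expMeasure one_pos μ (by simpa using h)

instance : NullSingletonClass unifLaw := by unfold unifLaw; infer_instance

instance : NullSingletonClass stdExp := by
  unfold stdExp expMeasure gammaMeasure
  exact nullSingletonClass_withDensity _

theorem ae_stdExp_pos : ∀ᵐ e ∂stdExp, 0 < e := by
  have h : stdExp (Set.Ioi 0) = 1 := by simpa using stdExp_Ioi le_rfl
  exact (prob_compl_eq_zero_iff measurableSet_Ioi).2 h

theorem ae_unifLaw_mem : ∀ᵐ h ∂unifLaw, 0 < h ∧ h < 1 := by
  have h1 : ∀ᵐ h ∂unifLaw, h ∈ Set.Icc (0 : ℝ) 1 := ae_restrict_mem measurableSet_Icc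
  have h2 : ∀ᵐ h ∂unifLaw, h ≠ 0 := by simp [ae_iff, measure_singleton]
  have h3 : ∀ᵐ h ∂unifLaw, h ≠ 1 := by simp [ae_iff, measure_singleton]
  filter_upwards [h1, h2, h3] with h a b c
  exact ⟨lt_of_le_of_ne a.1 (Ne.symm b), lt_of_le_of_ne a.2 c⟩

theorem unifLaw_Iio {s : ℝ} (h1 : s ≤ 1) : unifLaw (Set.Iio s) = ENNReal.ofReal s := by
  rw [unifLaw, Measure.restrict_apply measurableSet_Iio,
    show Set.Iio s ∩ Set.Icc (0 : ℝ) 1 = Set.Ico 0 s by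
      ext y; simp only [Set.mem_inter_iff, Set.mem_Iio, Set.mem_Icc, Set.mem_Ico]
      constructor
      · rintro ⟨a, b, c⟩; exact ⟨b, a⟩
      · rintro ⟨a, b⟩; exact ⟨b, a, by linarith⟩]
  simp

theorem unifLaw_Ioi {s : ℝ} (h0 : 0 ≤ s) : unifLaw (Set.Ioi s) = ENNReal.ofReal (1 - s) := by
  rw [unifLaw, Measure.restrict_apply measurableSet_Ioi,
    show Set.Ioi s ∩ Set.Icc (0 : ℝ) 1 = Set.Ioc s 1 by
      ext y; simp only [Set.mem_inter_iff, Set.mem_Ioi, Set.mem_Icc, Set.mem_Ioc]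
      constructor
      · rintro ⟨a, b, c⟩; exact ⟨a, c⟩
      · rintro ⟨a, b⟩; exact ⟨a, by linarith, b⟩]
  simp

theorem measurable_expOf : Measurable expOf := by unfold expOf; fun_prop

theorem map_expOf : unifLaw.map expOf = stdExp := by
  have : IsProbabilityMeasure (unifLaw.map expOf) :=
    Measure.isProbabilityMeasure_map measurable_expOf.aemeasurable
  apply eq_stdExp
  intro s hs
  rw [Measure.map_apply measurable_expOf measurableSet_Ioi]
  have : unifLaw (expOf ⁻¹' Set.Ioi s) = unifLaw (Set.Ioi (1 - Real.exp (-s))) := by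
    apply measure_congr
    filter_upwards [ae_unifLaw_mem] with h hh
    apply propext
    change s < expOf h ↔ 1 - Real.exp (-s) < h
    rw [expOf, lt_neg, Real.log_lt_iff_lt_exp (by linarith)]
    constructor <;> intro <;> linarith
  rw [this, unifLaw_Ioi (by simpa using hs)]
  congr 1; ring

theorem map_stdExp_div {w : ℝ} (hw : 0 < w) : stdExp.map (fun e => e / w) = expMeasure w := by
  have : IsProbabilityMeasure (stdExp.map (fun e => e / w)) :=
    Measure.isProbabilityMeasure_map (by fun_prop)
  apply eq_expMeasure hw
  intro s hs
  rw [Measure.map_apply (by fun_prop) measurableSet_Ioi,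
    show (fun e => e / w) ⁻¹' Set.Ioi s = Set.Ioi (w * s) by
      ext e; simp [lt_div_iff₀ hw, mul_comm], stdExp_Ioi (by positivity)]

/-- Memorylessness. -/
theorem map_memoryless {a : ℝ} (ha : 0 ≤ a) :
    (stdExp.prod stdExp).map (fun p => if p.1 < a then p.1 else a + p.2) = stdExp := by
  have hm : Measurable (fun p : ℝ × ℝ => if p.1 < a then p.1 else a + p.2) :=
    Measurable.ite (measurableSet_lt (by fun_prop) (by fun_prop)) (by fun_prop) (by fun_prop)
  have := Measure.isProbabilityMeasure_map (μ := stdExp.prod stdExp) hm.aemeasurable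
  apply eq_stdExp
  intro s hs
  rw [Measure.map_apply hm measurableSet_Ioi, Measure.prod_apply (hm measurableSet_Ioi)]
  -- Below `a` the event is `s < e`, up to a null set. From `a` on it requires `e ≥ a` and a fresh
  -- exponential above `s - a`, so its probability is `exp(-a) * exp(-(s - a))`.
  rcases lt_or_ge s a with h | h
  · have : ∀ e, stdExp (Prod.mk e ⁻¹' ((fun p : ℝ × ℝ => if p.1 < a then p.1 else a + p.2) ⁻¹'
        Set.Ioi s)) = Set.indicator (Set.Ioi s) 1 e := by
      intro e
      by_cases he : e < a
      · by_cases hes : s < e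
        · rw [Set.indicator_of_mem (show e ∈ Set.Ioi s from hes)]
          convert! measure_univ (μ := stdExp)
          · ext b; simp [he, hes]
        · rw [Set.indicator_of_notMem (show e ∉ Set.Ioi s from hes)]
          convert! measure_empty (μ := stdExp)
          ext b; simp [he, hes]
      · rw [Set.indicator_of_mem (show e ∈ Set.Ioi s from (by linarith : s < e))]
        have : stdExp (Set.Ioi (0 : ℝ)) ≤ 1 := prob_le_one
        have h0 : stdExp (Set.Ioi (0 : ℝ)) = 1 := by simpa using stdExp_Ioi le_rfl
        refine le_antisymm prob_le_one ?_
        rw [Pi.one_apply, ← h0]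
        apply measure_mono
        intro b hb
        have hb : 0 < b := hb
        simp only [Set.mem_preimage, he, if_false, Set.mem_Ioi]; linarith
    simp_rw [this]
    rw [lintegral_indicator_one measurableSet_Ioi, stdExp_Ioi hs]
  · have : ∀ e, stdExp (Prod.mk e ⁻¹' ((fun p : ℝ × ℝ => if p.1 < a then p.1 else a + p.2) ⁻¹'
        Set.Ioi s)) = Set.indicator (Set.Ici a) (fun _ => ENNReal.ofReal (Real.exp (-(s - a)))) e := by
      intro e
      by_cases he : e < a
      · rw [Set.indicator_of_notMem (by simpa using he)]
        convert! measure_empty (μ := stdExp)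
        ext b; simp only [Set.mem_preimage, he, if_true, Set.mem_Ioi]; simp; linarith
      · rw [Set.indicator_of_mem (by simpa using he), ← stdExp_Ioi (by linarith)]
        congr 1
        ext b; simp only [Set.mem_preimage, he, if_false, Set.mem_Ioi]
        constructor <;> intro <;> linarith
    simp_rw [this]
    rw [lintegral_indicator_const measurableSet_Ici, measure_congr Ioi_ae_eq_Ici.symm, stdExp_Ioi ha,
      ← ENNReal.ofReal_mul (Real.exp_pos _).le, ← Real.exp_add]
    congr 2; ring

/-- The density `exp(-e)` combines with the integrand to `exp(-s) * exp(-b e)`. With `b = 1 - p` and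
`a = s / p` this is the part of the tail in `map_thinning` where `p e ≤ s`. -/
theorem setLIntegral_stdExp_Iic {a b s : ℝ} (hb : 0 < b) (ha : 0 ≤ a) :
    ∫⁻ e in Set.Iic a, ENNReal.ofReal (Real.exp (-(s - (1 - b) * e))) ∂stdExp =
      ENNReal.ofReal (Real.exp (-s) / b * (1 - Real.exp (-(b * a)))) := by
  have h1 := lintegral_exponentialPDF_eq_antiDeriv hb a
  rw [if_pos ha] at h1
  have hd : stdExp = volume.withDensity (exponentialPDF 1) := rfl
  have hm : Measurable (exponentialPDF 1) := by unfold exponentialPDF; fun_prop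
  rw [hd, setLIntegral_withDensity_eq_setLIntegral_mul _ hm (by fun_prop) measurableSet_Iic,
    ENNReal.ofReal_mul (by positivity), ← h1, ← lintegral_const_mul _ (by unfold exponentialPDF; fun_prop)]
  apply setLIntegral_congr_fun measurableSet_Iic
  intro e _
  simp only [Pi.mul_apply, exponentialPDF_eq]
  split_ifs with he
  · rw [← ENNReal.ofReal_mul (by positivity), ← ENNReal.ofReal_mul (by positivity)]
    congr 1
    rw [show Real.exp (-s) / b * (b * Real.exp (-(b * e))) = Real.exp (-s) * Real.exp (-(b * e)) by
      field_simp, one_mul, ← Real.exp_add, ← Real.exp_add]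
    congr 1; ring
  · simp

/-- Thinning: for independent standard exponential `e`, `E` and a uniform `u`, the variable
`p e + 1{p < u} E` is standard exponential. -/
theorem map_thinning {p : ℝ} (h0 : 0 ≤ p) (h1 : p ≤ 1) :
    (stdExp.prod (unifLaw.prod stdExp)).map
      (fun v => p * v.1 + if p < v.2.1 then v.2.2 else 0) = stdExp := by
  have hm : Measurable (fun v : ℝ × ℝ × ℝ => p * v.1 + if p < v.2.1 then v.2.2 else 0) :=
    (by fun_prop : Measurable fun v : ℝ × ℝ × ℝ => p * v.1).add
      (Measurable.ite (measurableSet_lt (by fun_prop) (by fun_prop)) (by fun_prop) (by fun_prop))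
  have := Measure.isProbabilityMeasure_map
    (μ := stdExp.prod (unifLaw.prod stdExp)) hm.aemeasurable
  -- For `p > 0`, `p e` is the first point of a Poisson process of rate `1/p`. Keeping each point
  -- with probability `p` leaves a process of rate `1`, whose first point is `p e` if that one is
  -- kept (`u ≤ p`) and otherwise comes after a further independent exponential time `E`. The
  -- computation below checks this on tails, conditionally on `e`.
  apply eq_stdExp
  intro s hs
  rw [Measure.map_apply hm measurableSet_Ioi, Measure.prod_apply (hm measurableSet_Ioi)]
  have key : ∀ e, (unifLaw.prod stdExp) (Prod.mk e ⁻¹'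
      ((fun v : ℝ × ℝ × ℝ => p * v.1 + if p < v.2.1 then v.2.2 else 0) ⁻¹' Set.Ioi s)) =
      ENNReal.ofReal p * (if s < p * e then 1 else 0) +
      ENNReal.ofReal (1 - p) * stdExp (Set.Ioi (s - p * e)) := by
    intro e
    have hset : Prod.mk e ⁻¹'
      ((fun v : ℝ × ℝ × ℝ => p * v.1 + if p < v.2.1 then v.2.2 else 0) ⁻¹' Set.Ioi s) =
      (Set.Iic p ×ˢ (if s < p * e then Set.univ else ∅)) ∪ (Set.Ioi p ×ˢ Set.Ioi (s - p * e)) := by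
      ext ⟨u, E⟩
      by_cases hu : p < u
      · simp [hu, not_le.2 hu, sub_lt_iff_lt_add']
      · by_cases hs : s < p * e <;> simp [hu, hs, not_lt.1 hu]
    have hIic : unifLaw (Set.Iic p) = ENNReal.ofReal p := by
      rw [measure_congr Iio_ae_eq_Iic.symm, unifLaw_Iio h1]
    rw [hset, measure_union _ (measurableSet_Ioi.prod measurableSet_Ioi), Measure.prod_prod,
      Measure.prod_prod, hIic, unifLaw_Ioi h0]
    · congr 2
      split_ifs <;> simp
    · rw [Set.disjoint_left]
      rintro ⟨u, E⟩ ⟨h1, _⟩ ⟨h2, _⟩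
      exact absurd (show p < u from h2) (not_lt.2 h1)
  simp_rw [key]
  have hanti : Measurable fun e => stdExp (Set.Ioi (s - p * e)) := by
    apply Monotone.measurable
    intro a b hab
    apply measure_mono
    apply Set.Ioi_subset_Ioi
    nlinarith
  -- The general computation divides by `p` and by `1 - p`, so the values `0` and `1` are settled
  -- first.
  rcases eq_or_lt_of_le h0 with rfl | hp0
  · simp [stdExp_Ioi hs]
  rcases eq_or_lt_of_le h1 with rfl | hp1
  · simp only [ENNReal.ofReal_one, one_mul, sub_self, ENNReal.ofReal_zero, zero_mul, add_zero]
    rw [show (fun a : ℝ => if s < a then (1 : ℝ≥0∞) else 0) = Set.indicator (Set.Ioi s) 1 by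
      ext a; simp [Set.indicator_apply],
      lintegral_indicator_one measurableSet_Ioi, stdExp_Ioi hs]
  rw [lintegral_add_right _ (hanti.const_mul _), lintegral_const_mul' _ _ ENNReal.ofReal_ne_top,
    lintegral_const_mul' _ _ ENNReal.ofReal_ne_top]
  have hsp : 0 ≤ s / p := by positivity
  have e1 : ∫⁻ a, (if s < p * a then (1 : ℝ≥0∞) else 0) ∂stdExp
      = ENNReal.ofReal (Real.exp (-(s / p))) := by
    rw [show (fun a : ℝ => if s < p * a then (1 : ℝ≥0∞) else 0) =
        Set.indicator (Set.Ioi (s / p)) 1 by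
      ext a; simp [Set.indicator_apply, div_lt_iff₀ hp0, mul_comm],
      lintegral_indicator_one measurableSet_Ioi, stdExp_Ioi hsp]
  -- The integral is split at `e = s / p`, where `s - p e` changes sign; beyond that point the tail
  -- probability is `1`.
  have e2 : ∫⁻ a, stdExp (Set.Ioi (s - p * a)) ∂stdExp =
      ENNReal.ofReal (Real.exp (-s) / (1 - p) * (1 - Real.exp (-((1 - p) * (s / p))))) +
      ENNReal.ofReal (Real.exp (-(s / p))) := by
    rw [← lintegral_add_compl _ (measurableSet_Iic (a := s / p)), Set.compl_Iic]
    congr 1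
    · rw [← setLIntegral_stdExp_Iic (by linarith) hsp]
      apply setLIntegral_congr_fun measurableSet_Iic
      intro e he
      have he : e ≤ s / p := he
      rw [le_div_iff₀ hp0] at he
      simp only
      rw [stdExp_Ioi (by nlinarith)]
      congr 3; ring
    · rw [setLIntegral_congr_fun (g := fun _ => 1) measurableSet_Ioi]
      · rw [setLIntegral_one, stdExp_Ioi hsp]
      · intro e he
        have he : s / p < e := he
        rw [div_lt_iff₀ hp0] at he
        refine le_antisymm prob_le_one ?_
        have h0 : stdExp (Set.Ioi (0 : ℝ)) = 1 := by simpa using stdExp_Ioi le_rfl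
        rw [← h0]
        apply measure_mono
        apply Set.Ioi_subset_Ioi
        nlinarith
  have hle : Real.exp (-((1 - p) * (s / p))) ≤ 1 := by
    rw [Real.exp_le_one_iff, neg_nonpos]; exact mul_nonneg (by linarith) hsp
  have hx : 0 ≤ Real.exp (-s) / (1 - p) * (1 - Real.exp (-((1 - p) * (s / p)))) :=
    mul_nonneg (div_nonneg (Real.exp_pos _).le (by linarith)) (by linarith)
  rw [e1, e2, ← ENNReal.ofReal_add hx (Real.exp_pos _).le, ← ENNReal.ofReal_mul h0,
    ← ENNReal.ofReal_mul (by linarith), ← ENNReal.ofReal_add (by positivity)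
      (mul_nonneg (by linarith) (add_nonneg hx (Real.exp_pos _).le))]
  congr 1
  have h2 : Real.exp (-s) * Real.exp (-((1 - p) * (s / p))) = Real.exp (-(s / p)) := by
    rw [← Real.exp_add]; congr 1; field_simp; ring
  have h3 : (1 - p) ≠ 0 := by linarith
  have h4 : (1 - p) * (Real.exp (-s) / (1 - p) * (1 - Real.exp (-((1 - p) * (s / p))))
      + Real.exp (-(s / p))) = Real.exp (-s) - Real.exp (-s) * Real.exp (-((1 - p) * (s / p)))
      + (1 - p) * Real.exp (-(s / p)) := by
    field_simp
  rw [h4, h2]; ring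

/-! ### Resampling and regrouping coordinates of product measures -/

section ProductMeasure

variable {ι E F G : Type*} [MeasurableSpace E] [MeasurableSpace F] [MeasurableSpace G]

theorem measurable_update_pair [DecidableEq ι] (y : ι) :
    Measurable (fun p : (ι → E) × E => Function.update p.1 y p.2) := by
  rw [measurable_pi_iff]
  intro i
  by_cases h : i = y
  · subst h; simpa using measurable_snd
  · simp only [Function.update_of_ne h]; fun_prop

/-- Resampling a coordinate does not change a product measure. -/
theorem infinitePi_map_update [DecidableEq ι] (μ : ι → Measure E) [∀ i, IsProbabilityMeasure (μ i)]
    (y : ι) : ((Measure.infinitePi μ).prod (μ y)).map (fun p => Function.update p.1 y p.2) =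
      Measure.infinitePi μ := by
  apply Measure.eq_infinitePi
  intro s t ht
  rw [Measure.map_apply (measurable_update_pair y)
    (MeasurableSet.pi s.countable_toSet fun _ _ => ht _)]
  by_cases hy : y ∈ s
  · have : (fun p : (ι → E) × E => Function.update p.1 y p.2) ⁻¹' (s : Set ι).pi t =
        ((s.erase y : Finset ι) : Set ι).pi t ×ˢ t y := by
      ext ⟨a, b⟩
      simp only [Set.mem_preimage, Set.mem_pi, Set.mem_prod, Finset.mem_coe, Finset.mem_erase]
      constructor
      · intro h
        refine ⟨fun i hi => by simpa [hi.1] using h i hi.2, by simpa using h y hy⟩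
      · rintro ⟨h1, h2⟩ i hi
        by_cases h : i = y
        · subst h; simpa using h2
        · simpa [h] using h1 i ⟨h, hi⟩
    rw [this, Measure.prod_prod, Measure.infinitePi_pi _ (fun _ _ => ht _), mul_comm,
      Finset.mul_prod_erase s (fun i => μ i (t i)) hy]
  · have : (fun p : (ι → E) × E => Function.update p.1 y p.2) ⁻¹' (s : Set ι).pi t =
        (s : Set ι).pi t ×ˢ Set.univ := by
      ext ⟨a, b⟩
      simp only [Set.mem_preimage, Set.mem_pi, Set.mem_prod, Finset.mem_coe, Set.mem_univ, and_true]
      refine forall₂_congr fun i hi => ?_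
      rw [Function.update_of_ne (by rintro rfl; exact hy hi)]
    rw [this, Measure.prod_prod, Measure.infinitePi_pi _ (fun _ _ => ht _), measure_univ, mul_one]

theorem lintegral_infinitePi_update [DecidableEq ι] (μ : ι → Measure E)
    [∀ i, IsProbabilityMeasure (μ i)] (y : ι) {f : (ι → E) → ℝ≥0∞} (hf : Measurable f) :
    ∫⁻ ξ, f ξ ∂(Measure.infinitePi μ) =
      ∫⁻ ξ, ∫⁻ a, f (Function.update ξ y a) ∂(μ y) ∂(Measure.infinitePi μ) := by
  conv_lhs => rw [← infinitePi_map_update μ y]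
  rw [lintegral_map hf (measurable_update_pair y)]
  exact lintegral_prod _ (hf.comp (measurable_update_pair y)).aemeasurable

open Classical in
theorem measurable_mix (s : Set ι) :
    Measurable (fun p : (ι → E) × (ι → E) => s.piecewise p.2 p.1) := by
  rw [measurable_pi_iff]
  intro i
  by_cases h : i ∈ s
  · simp only [Set.piecewise_eq_of_mem _ _ _ h]; fun_prop
  · simp only [Set.piecewise_eq_of_notMem _ _ _ h]; fun_prop

open Classical in
/-- Resampling a set of coordinates does not change a product measure. -/
theorem infinitePi_map_mix (μ : ι → Measure E) [∀ i, IsProbabilityMeasure (μ i)]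
    (s : Set ι) : ((Measure.infinitePi μ).prod (Measure.infinitePi μ)).map
      (fun p => s.piecewise p.2 p.1) = Measure.infinitePi μ := by
  apply Measure.eq_infinitePi
  intro u t ht
  rw [Measure.map_apply (measurable_mix s) (MeasurableSet.pi u.countable_toSet fun _ _ => ht _)]
  have : (fun p : (ι → E) × (ι → E) => s.piecewise p.2 p.1) ⁻¹' (u : Set ι).pi t =
      ((u.filter (fun i => ¬ i ∈ s) : Finset ι) : Set ι).pi t ×ˢ
        ((u.filter (fun i => i ∈ s) : Finset ι) : Set ι).pi t := by
    ext ⟨a, b⟩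
    simp only [Set.mem_preimage, Set.mem_pi, Set.mem_prod, Finset.mem_coe, Finset.mem_filter]
    constructor
    · intro h
      refine ⟨fun i hi => by simpa [hi.2] using h i hi.1, fun i hi => by simpa [hi.2] using h i hi.1⟩
    · rintro ⟨h1, h2⟩ i hi
      by_cases h : i ∈ s
      · simpa [h] using h2 i ⟨hi, h⟩
      · simpa [h] using h1 i ⟨hi, h⟩
  rw [this, Measure.prod_prod, Measure.infinitePi_pi _ (fun _ _ => ht _),
    Measure.infinitePi_pi _ (fun _ _ => ht _), mul_comm,
    Finset.prod_filter_mul_prod_filter_not]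

open Classical in
theorem lintegral_infinitePi_mix (μ : ι → Measure E) [∀ i, IsProbabilityMeasure (μ i)]
    (s : Set ι) {f : (ι → E) → ℝ≥0∞} (hf : Measurable f) :
    ∫⁻ ξ, f ξ ∂(Measure.infinitePi μ) =
      ∫⁻ ξ, ∫⁻ ζ, f (s.piecewise ζ ξ) ∂(Measure.infinitePi μ) ∂(Measure.infinitePi μ) := by
  conv_lhs => rw [← infinitePi_map_mix μ s]
  rw [lintegral_map hf (measurable_mix s)]
  exact lintegral_prod _ (hf.comp (measurable_mix s)).aemeasurable

/-- Induction on `s`: resampling the coordinate `y` in both families splits off one factor and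
leaves the condition on the remaining coordinates. -/
theorem prod_infinitePi_apply (μ : ι → Measure E) (ν : ι → Measure F)
    [∀ i, IsProbabilityMeasure (μ i)] [∀ i, IsProbabilityMeasure (ν i)]
    (D : ι → Set (E × F)) (hD : ∀ i, MeasurableSet (D i)) (s : Finset ι) :
    ((Measure.infinitePi μ).prod (Measure.infinitePi ν)) {p | ∀ i ∈ s, (p.1 i, p.2 i) ∈ D i} =
      ∏ i ∈ s, (μ i).prod (ν i) (D i) := by
  classical
  have hm : ∀ s : Finset ι, MeasurableSet
      {p : (ι → E) × (ι → F) | ∀ i ∈ s, (p.1 i, p.2 i) ∈ D i} := by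
    intro s
    have : {p : (ι → E) × (ι → F) | ∀ i ∈ s, (p.1 i, p.2 i) ∈ D i} =
        ⋂ i ∈ s, (fun p : (ι → E) × (ι → F) => (p.1 i, p.2 i)) ⁻¹' (D i) := by
      ext; simp
    rw [this]
    exact Finset.measurableSet_biInter s fun i _ => (hD i).preimage (by fun_prop)
  induction s using Finset.induction_on with
  | empty => simp
  | insert y s hy ih =>
    rw [Finset.prod_insert hy, ← ih]
    set f : (ι → E) × (ι → F) → ℝ≥0∞ :=
      Set.indicator {p | ∀ i ∈ insert y s, (p.1 i, p.2 i) ∈ D i} 1 with hf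
    have hfm : Measurable f := measurable_one.indicator (hm _)
    have key : ∀ ξ η a b, f (Function.update ξ y a, Function.update η y b) =
        Set.indicator (D y) 1 (a, b) * Set.indicator {p | ∀ i ∈ s, (p.1 i, p.2 i) ∈ D i} 1 (ξ, η) := by
      intro ξ η a b
      have hiff : (∀ i ∈ insert y s, (Function.update ξ y a i, Function.update η y b i) ∈ D i) ↔
          (a, b) ∈ D y ∧ ∀ i ∈ s, (ξ i, η i) ∈ D i := by
        rw [Finset.forall_mem_insert]
        simp only [Function.update_self]
        refine and_congr_right fun _ => forall₂_congr fun i hi => ?_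
        have : i ≠ y := by rintro rfl; exact hy hi
        rw [Function.update_of_ne this, Function.update_of_ne this]
      simp only [hf, Set.indicator_apply, Set.mem_ofPred_eq, hiff, Pi.one_apply]
      split_ifs <;> simp_all
    have e1 : ((Measure.infinitePi μ).prod (Measure.infinitePi ν))
        {p | ∀ i ∈ insert y s, (p.1 i, p.2 i) ∈ D i} =
        ∫⁻ p, f p ∂((Measure.infinitePi μ).prod (Measure.infinitePi ν)) := by
      rw [hf, lintegral_indicator_one (hm _)]
    have hsm : Measurable (Set.indicator {p : (ι → E) × (ι → F) | ∀ i ∈ s, (p.1 i, p.2 i) ∈ D i}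
        (1 : (ι → E) × (ι → F) → ℝ≥0∞)) := measurable_one.indicator (hm _)
    have hDm : Measurable (Set.indicator (D y) (1 : E × F → ℝ≥0∞)) :=
      measurable_one.indicator (hD y)
    rw [e1, lintegral_prod _ hfm.aemeasurable,
      lintegral_infinitePi_update μ y (hfm.lintegral_prod_right')]
    have e2 : ∀ ξ a, ∫⁻ η, f (Function.update ξ y a, η) ∂(Measure.infinitePi ν) =
        (∫⁻ b, Set.indicator (D y) 1 (a, b) ∂(ν y)) *
        ∫⁻ η, Set.indicator {p : (ι → E) × (ι → F) | ∀ i ∈ s, (p.1 i, p.2 i) ∈ D i} 1 (ξ, η)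
          ∂(Measure.infinitePi ν) := by
      intro ξ a
      rw [lintegral_infinitePi_update ν y
        (f := fun η => f (Function.update ξ y a, η)) (by fun_prop)]
      simp_rw [key]
      rw [← lintegral_const_mul _ (by fun_prop)]
      congr 1; ext η
      rw [lintegral_mul_const _ (by fun_prop)]
    simp_rw [e2]
    have e3 : ∀ ξ, ∫⁻ a, (∫⁻ b, Set.indicator (D y) 1 (a, b) ∂(ν y)) *
        (∫⁻ η, Set.indicator {p : (ι → E) × (ι → F) | ∀ i ∈ s, (p.1 i, p.2 i) ∈ D i} 1 (ξ, η)
          ∂(Measure.infinitePi ν)) ∂(μ y) = (μ y).prod (ν y) (D y) *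
        ∫⁻ η, Set.indicator {p : (ι → E) × (ι → F) | ∀ i ∈ s, (p.1 i, p.2 i) ∈ D i} 1 (ξ, η)
          ∂(Measure.infinitePi ν) := by
      intro ξ
      rw [lintegral_mul_const _ hDm.lintegral_prod_right', ← lintegral_prod _ hDm.aemeasurable,
        lintegral_indicator_one (hD y)]
    simp_rw [e3]
    rw [lintegral_const_mul _ hsm.lintegral_prod_right', ← lintegral_prod _ hsm.aemeasurable,
      lintegral_indicator_one (hm s)]

/-- Two independent families with independent entries are one independent family of pairs. This
permits laws to be compared key by key. -/
theorem prod_infinitePi_map_pi (μ : ι → Measure E) (ν : ι → Measure F)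
    [∀ i, IsProbabilityMeasure (μ i)] [∀ i, IsProbabilityMeasure (ν i)]
    (Φ : ι → E × F → G) (hΦ : ∀ i, Measurable (Φ i)) :
    ((Measure.infinitePi μ).prod (Measure.infinitePi ν)).map (fun p i => Φ i (p.1 i, p.2 i)) =
      Measure.infinitePi (fun i => ((μ i).prod (ν i)).map (Φ i)) := by
  have : ∀ i, IsProbabilityMeasure (((μ i).prod (ν i)).map (Φ i)) := fun i =>
    Measure.isProbabilityMeasure_map (hΦ i).aemeasurable
  apply Measure.eq_infinitePi
  intro s t ht
  rw [Measure.map_apply (by fun_prop) (MeasurableSet.pi s.countable_toSet fun _ _ => ht _)]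
  have := prod_infinitePi_apply μ ν (fun i => Φ i ⁻¹' t i) (fun i => (ht i).preimage (hΦ i)) s
  simp_rw [Measure.map_apply (hΦ _) (ht _)]
  rw [← this]
  rfl

end ProductMeasure

/-! ### Seeds, arrival values and the eviction redraw of a single key -/

theorem measurableSet_and {α : Type*} [MeasurableSpace α] {p q : α → Prop}
    (hp : MeasurableSet {a | p a}) (hq : MeasurableSet {a | q a}) :
    MeasurableSet {a | p a ∧ q a} := hp.inter hq

/-- The reciprocal of `max{1/ℓ, τ}`. -/
noncomputable def invRate (ℓ : ℝ) (τ : ℝ≥0∞) : ℝ := (rate ℓ τ)⁻¹.toReal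

/-- The seed of a key with smallest arrival value `m` and hash `h`. -/
noncomputable def seedOf (ℓ : ℝ) (m : ℝ≥0∞) (h : ℝ) : ℝ≥0∞ :=
  if m ≤ ENNReal.ofReal (1 / ℓ) then ENNReal.ofReal (h / ℓ) else m

/-- The law of a hash together with an independent standard exponential variable; also the law of
the two eviction draws of a key. -/
noncomputable def pairLaw : Measure (ℝ × ℝ) := unifLaw.prod stdExp

instance : IsProbabilityMeasure pairLaw := by unfold pairLaw; infer_instance

/-- The smallest arrival value of a key of weight `W`, as a function of a standard exponential. -/
noncomputable def arrival (W e : ℝ) : ℝ≥0∞ := ENNReal.ofReal e / ENNReal.ofReal W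

/-- The smallest arrival value that the eviction step draws for a key with counter `c`. -/
noncomputable def redraw (τ : ℝ≥0∞) (c u E : ℝ) : ℝ≥0∞ :=
  min (τ * ENNReal.ofReal u) (ENNReal.ofReal (E / c))

theorem measurable_arrival (W : ℝ) : Measurable (arrival W) := by unfold arrival; fun_prop

theorem measurable_seedOf (ℓ : ℝ) : Measurable fun p : ℝ≥0∞ × ℝ => seedOf ℓ p.1 p.2 := by
  unfold seedOf
  exact Measurable.ite (measurableSet_le (by fun_prop) (by fun_prop)) (by fun_prop) (by fun_prop)

theorem measurable_invRate (ℓ : ℝ) : Measurable (invRate ℓ) := by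
  unfold invRate rate; fun_prop

theorem arrival_of_pos {W : ℝ} (hW : 0 < W) (e : ℝ) : arrival W e = ENNReal.ofReal (e / W) := by
  rw [arrival, ENNReal.ofReal_div_of_pos hW]

theorem arrival_zero {e : ℝ} (he : 0 < e) : arrival 0 e = ⊤ := by
  rw [arrival, ENNReal.ofReal_zero, ENNReal.div_zero]; simpa using he

/-- The minimum of independent exponential variables is exponential. -/
theorem map_min_arrival {W w : ℝ} (hW : 0 ≤ W) (hw : 0 < w) :
    (stdExp.prod stdExp).map (fun p => min (arrival W p.1) (arrival w p.2)) =
      stdExp.map (arrival (W + w)) := by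
  -- A key of weight `0` has arrival value `⊤` almost surely, so the new element alone determines
  -- the minimum.
  rcases eq_or_lt_of_le hW with rfl | hW
  · have h1 : ((stdExp.prod stdExp).map (fun p => min (arrival 0 p.1) (arrival w p.2))) =
        (stdExp.prod stdExp).map (fun p => arrival w p.2) := by
      apply Measure.map_congr
      have : ∀ᵐ p ∂(stdExp.prod stdExp), 0 < p.1 :=
        Measure.quasiMeasurePreserving_fst.ae ae_stdExp_pos
      filter_upwards [this] with p hp
      rw [arrival_zero hp, top_inf_eq]
    have h2 := Measure.map_map (μ := stdExp.prod stdExp) (measurable_arrival w) measurable_snd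
    rw [Measure.map_snd_prod, measure_univ, one_smul] at h2
    rw [h1, zero_add, h2]; rfl
  · have h1 : (stdExp.prod stdExp).map (fun p => min (p.1 / W) (p.2 / w)) = expMeasure (W + w) := by
      have hm : Measurable fun p : ℝ × ℝ => min (p.1 / W) (p.2 / w) := by fun_prop
      have := Measure.isProbabilityMeasure_map (μ := stdExp.prod stdExp) hm.aemeasurable
      apply eq_expMeasure (by positivity)
      intro s hs
      rw [Measure.map_apply hm measurableSet_Ioi,
        show (fun p : ℝ × ℝ => min (p.1 / W) (p.2 / w)) ⁻¹' Set.Ioi s =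
          Set.Ioi (s * W) ×ˢ Set.Ioi (s * w) by
          ext p; simp [lt_div_iff₀ hW, lt_div_iff₀ hw],
        Measure.prod_prod, stdExp_Ioi (by positivity), stdExp_Ioi (by positivity),
        ← ENNReal.ofReal_mul (Real.exp_pos _).le, ← Real.exp_add]
      congr 2; ring
    have h2 := map_stdExp_div (show 0 < W + w by positivity)
    rw [← h1] at h2
    have e1 : (fun p : ℝ × ℝ => min (arrival W p.1) (arrival w p.2)) =
        ENNReal.ofReal ∘ (fun p : ℝ × ℝ => min (p.1 / W) (p.2 / w)) := by
      ext p
      simp only [Function.comp, arrival_of_pos hW, arrival_of_pos hw]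
      exact (Monotone.map_min (fun a b h => ENNReal.ofReal_le_ofReal h)).symm
    have e2 : arrival (W + w) = ENNReal.ofReal ∘ (fun e => e / (W + w)) := by
      ext e
      rw [arrival_of_pos (by positivity)]; rfl
    rw [e1, e2, ← Measure.map_map (by fun_prop) (by fun_prop),
      ← Measure.map_map (by fun_prop) (by fun_prop), h2]

theorem rate_of_lt {ℓ : ℝ} {t : ℝ≥0∞} (h : ENNReal.ofReal (1 / ℓ) < t) : rate ℓ t = t :=
  max_eq_right h.le

theorem rate_pos {ℓ : ℝ} (hℓ : 0 < ℓ) (τ : ℝ≥0∞) : 0 < rate ℓ τ :=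
  lt_of_lt_of_le (by simpa using hℓ) (le_max_left _ _)

theorem rate_ne_top {ℓ : ℝ} {τ : ℝ≥0∞} (h : τ ≠ ⊤) : rate ℓ τ ≠ ⊤ := by
  simp [rate, h]

/-- If `m` exceeds `1/ℓ`, the bound by the maximum `rate ℓ τ` can only come from `τ`; otherwise the
seed is the base hash. -/
theorem seedOf_lt {ℓ : ℝ} {m τ : ℝ≥0∞} {h : ℝ} (hh : ENNReal.ofReal (h / ℓ) < τ)
    (hm : m < rate ℓ τ) : seedOf ℓ m h < τ := by
  unfold seedOf
  split_ifs with h1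
  · exact hh
  · rcases lt_max_iff.1 hm with h2 | h2
    · exact absurd h2.le h1
    · exact h2

theorem ofReal_div_le {ℓ h : ℝ} (hℓ : 0 < ℓ) (h1 : h ≤ 1) :
    ENNReal.ofReal (h / ℓ) ≤ ENNReal.ofReal (1 / ℓ) :=
  ENNReal.ofReal_le_ofReal (by gcongr)

/-- Converse of `seedOf_lt` with a weak inequality: at `m = 1/ℓ` the seed is still the base hash,
while the rate may equal `1/ℓ`. The boundary is discarded later as a null event. -/
theorem of_seedOf_lt {ℓ : ℝ} (hℓ : 0 < ℓ) {m τ : ℝ≥0∞} {h : ℝ} (h1 : h ≤ 1)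
    (hs : seedOf ℓ m h < τ) : ENNReal.ofReal (h / ℓ) < τ ∧ m ≤ rate ℓ τ := by
  unfold seedOf at hs
  split_ifs at hs with h2
  · exact ⟨hs, h2.trans (le_max_left _ _)⟩
  · exact ⟨lt_of_le_of_lt (ofReal_div_le hℓ h1) ((not_le.1 h2).trans hs),
      hs.le.trans (le_max_right _ _)⟩

/-- For `p = L / t` this reads `e / t = (p e) / L`, and it covers `t = ⊤`, where both sides vanish.
-/
theorem inv_toReal_eq_mul {t L : ℝ≥0∞} (hL0 : 0 < L) (hL : L ≠ ⊤) : t⁻¹.toReal = (L / t).toReal * L⁻¹.toReal := by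
  rw [← ENNReal.toReal_mul, div_eq_mul_inv, mul_comm L, mul_assoc,
    ENNReal.mul_inv_cancel hL0.ne' hL, mul_one]

theorem div_toReal_le_one {t L : ℝ≥0∞} (hLt : L ≤ t) : (L / t).toReal ≤ 1 := by
  apply ENNReal.toReal_le_of_le_ofReal zero_le_one
  rw [ENNReal.ofReal_one]
  exact ENNReal.div_le_of_le_mul (by simpa using hLt)

theorem ofReal_div_toReal {t L : ℝ≥0∞} (hL0 : 0 < L) (hLt : L ≤ t) (hL : L ≠ ⊤) : ENNReal.ofReal (L / t).toReal = L / t :=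
  ENNReal.ofReal_toReal (ENNReal.div_ne_top hL (hL0.trans_le hLt).ne')

/-- If `u < p = L / t`, then already `t u < L`. If `p < u`, the hypothesis says `e/t + E/L < ω`,
that is `E/(ω - e/t) < L`. So a positive lowered counter forces a redrawn value below `L`. -/
theorem redraw_lt {t L : ℝ≥0∞} (hL0 : 0 < L) (hLt : L ≤ t) (hL : L ≠ ⊤)
    {ω e u E : ℝ} (hE : 0 < E) (hu : 0 < u)
    (hup : u ≠ (L / t).toReal)
    (h : L⁻¹.toReal * ((L / t).toReal * e + if (L / t).toReal < u then E else 0) < ω) :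
    e * t⁻¹.toReal < ω ∧ redraw t (ω - e * t⁻¹.toReal) u E < L := by
  have hq := inv_toReal_eq_mul (t := t) hL0 hL
  have hl : 0 < L.toReal := ENNReal.toReal_pos hL0.ne' hL
  rcases lt_or_gt_of_ne hup with h1 | h1
  · rw [if_neg h1.not_gt, add_zero] at h
    refine ⟨by rw [hq]; linarith, ?_⟩
    apply lt_of_le_of_lt (min_le_left _ _)
    apply ENNReal.mul_lt_of_lt_div'
    rw [← ofReal_div_toReal hL0 hLt hL]
    exact (ENNReal.ofReal_lt_ofReal_iff_of_nonneg hu.le).2 h1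
  · rw [if_pos h1] at h
    have hq' : L⁻¹.toReal = (L.toReal)⁻¹ := ENNReal.toReal_inv L
    have h3 : 0 < L⁻¹.toReal * E := by rw [hq']; positivity
    have h4 : e * t⁻¹.toReal + E / L.toReal < ω := by
      rw [hq, div_eq_inv_mul, ← hq']; linarith
    have h5 : 0 < E / L.toReal := by positivity
    refine ⟨by linarith, ?_⟩
    apply lt_of_le_of_lt (min_le_right _ _)
    rw [ENNReal.ofReal_lt_iff_lt_toReal (by apply div_nonneg hE.le; linarith) hL,
      div_lt_iff₀ (by linarith)]
    have : E / L.toReal < ω - e * t⁻¹.toReal := by linarith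
    rw [div_lt_iff₀ hl] at this
    linarith

/-- The two cases of `redraw_lt` read backwards: for `p < u` the term `t u` exceeds `L`, hence the
bound must come from `E/(ω - e/t)`. Strictness is lost on the boundary only. -/
theorem of_redraw_le {t L : ℝ≥0∞} (hL0 : 0 < L) (hLt : L ≤ t) (hL : L ≠ ⊤)
    {ω e u E : ℝ} (hE : 0 < E) (hu : 0 < u)
    (h1 : e * t⁻¹.toReal < ω) (h2 : redraw t (ω - e * t⁻¹.toReal) u E ≤ L) :
    L⁻¹.toReal * ((L / t).toReal * e + if (L / t).toReal < u then E else 0) ≤ ω := by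
  have hq := inv_toReal_eq_mul (t := t) hL0 hL
  have hl : 0 < L.toReal := ENNReal.toReal_pos hL0.ne' hL
  have hq' : L⁻¹.toReal = (L.toReal)⁻¹ := ENNReal.toReal_inv L
  split_ifs with h3
  · rcases min_le_iff.1 h2 with h4 | h4
    · exfalso
      have h5 : L / t < ENNReal.ofReal u := by
        rw [← ofReal_div_toReal hL0 hLt hL]
        exact (ENNReal.ofReal_lt_ofReal_iff hu).2 h3
      by_cases ht : t = ⊤
      · subst ht
        rw [ENNReal.top_mul (by simpa using hu)] at h4
        exact hL (top_le_iff.1 h4)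
      · rw [ENNReal.div_lt_iff (Or.inl (hL0.trans_le hLt).ne') (Or.inl ht), mul_comm] at h5
        exact absurd h4 (not_le.2 h5)
    · have h5 := ENNReal.toReal_mono hL h4
      rw [ENNReal.toReal_ofReal (div_nonneg hE.le (by linarith)), div_le_iff₀ (by linarith)] at h5
      have : E / L.toReal ≤ ω - e * t⁻¹.toReal := by
        rw [div_le_iff₀ hl]; linarith
      rw [div_eq_inv_mul, ← hq'] at this
      rw [hq] at this
      linarith
  · rw [add_zero]; rw [hq] at h1; linarith

/-- For the original value, `e/ω < L` means `e/L < ω`, and then `e/t < ω` because `L ≤ t`. The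
criterion has the form of `redraw_lt` with `e` in place of the thinned variable. -/
theorem arrival_lt_of_lt {t L : ℝ≥0∞} (hL0 : 0 < L) (hLt : L ≤ t) (hL : L ≠ ⊤)
    {ω e : ℝ} (he : 0 < e) (h : L⁻¹.toReal * e < ω) :
    e * t⁻¹.toReal < ω ∧ arrival ω e < L := by
  have hl : 0 < L.toReal := ENNReal.toReal_pos hL0.ne' hL
  have hq' : L⁻¹.toReal = (L.toReal)⁻¹ := ENNReal.toReal_inv L
  have h3 : 0 < L⁻¹.toReal * e := by rw [hq']; positivity
  constructor
  · rw [inv_toReal_eq_mul (t := t) hL0 hL]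
    have := div_toReal_le_one hLt
    nlinarith
  · rw [arrival_of_pos (h3.trans h), ENNReal.ofReal_lt_iff_lt_toReal
      (div_nonneg he.le (h3.trans h).le) hL, div_lt_iff₀ (h3.trans h)]
    rw [hq', inv_mul_lt_iff₀ hl] at h
    exact h

theorem of_arrival_le {L : ℝ≥0∞} (hL0 : 0 < L) (hL : L ≠ ⊤) {ω e : ℝ} (hω : 0 < ω) (he : 0 < e)
    (h : arrival ω e ≤ L) : L⁻¹.toReal * e ≤ ω := by
  have hl : 0 < L.toReal := ENNReal.toReal_pos hL0.ne' hL
  rw [arrival_of_pos hω] at h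
  have h5 := ENNReal.toReal_mono hL h
  rw [ENNReal.toReal_ofReal (by positivity), div_le_iff₀ hω] at h5
  rw [ENNReal.toReal_inv, inv_mul_le_iff₀ hl]
  exact h5

/-- The eviction step subtracts exactly what turns `e/t` into the thinned variable divided by `L`;
this is where the rule for lowering counters meets `map_thinning`. -/
theorem counter_after_lowering {t L : ℝ≥0∞} (hL0 : 0 < L) (hLt : L ≤ t) (hL : L ≠ ⊤)
    {ω e u E : ℝ} (hu : 0 < u) :
    (if L / t < ENNReal.ofReal u then ω - e * t⁻¹.toReal - E * L⁻¹.toReal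
      else ω - e * t⁻¹.toReal) =
    ω - L⁻¹.toReal * ((L / t).toReal * e + if (L / t).toReal < u then E else 0) := by
  have h : L / t < ENNReal.ofReal u ↔ (L / t).toReal < u := by
    rw [← ENNReal.ofReal_lt_ofReal_iff hu, ofReal_div_toReal hL0 hLt hL]
  rw [inv_toReal_eq_mul (t := t) hL0 hL]
  simp only [h]
  split_ifs <;> ring

theorem ae_pairLaw : ∀ᵐ a ∂pairLaw, 0 < a.1 ∧ a.1 < 1 ∧ 0 < a.2 := by
  have h1 : ∀ᵐ a ∂pairLaw, 0 < a.1 ∧ a.1 < 1 :=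
    Measure.quasiMeasurePreserving_fst.ae ae_unifLaw_mem
  have h2 : ∀ᵐ a ∂pairLaw, 0 < a.2 := Measure.quasiMeasurePreserving_snd.ae ae_stdExp_pos
  filter_upwards [h1, h2] with a h1 h2 using ⟨h1.1, h1.2, h2⟩

/-- The law of the hash together with the thinned exponential variable. -/
theorem map_pair_thinning {p : ℝ} (h0 : 0 ≤ p) (h1 : p ≤ 1) :
    (pairLaw.prod pairLaw).map (fun v : (ℝ × ℝ) × ℝ × ℝ =>
      (v.1.1, p * v.1.2 + if p < v.2.1 then v.2.2 else 0)) = pairLaw := by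
  have hm : Measurable (fun v : ℝ × ℝ × ℝ => p * v.1 + if p < v.2.1 then v.2.2 else 0) :=
    (by fun_prop : Measurable fun v : ℝ × ℝ × ℝ => p * v.1).add
      (Measurable.ite (measurableSet_lt (by fun_prop) (by fun_prop)) (by fun_prop) (by fun_prop))
  have hassoc : (pairLaw.prod pairLaw).map MeasurableEquiv.prodAssoc =
      unifLaw.prod (stdExp.prod (unifLaw.prod stdExp)) := by
    unfold pairLaw; exact Measure.prodAssoc_prod
  have h2 := Measure.map_prod_map unifLaw (stdExp.prod (unifLaw.prod stdExp))
    measurable_id hm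
  rw [map_thinning h0 h1, Measure.map_id, ← hassoc,
    Measure.map_map (measurable_id.prodMap hm) MeasurableEquiv.prodAssoc.measurable] at h2
  exact h2.symm

theorem measurable_redraw (t : ℝ≥0∞) (ω q : ℝ) : Measurable fun v : (ℝ × ℝ) × ℝ × ℝ =>
    redraw t (ω - v.1.2 * q) v.2.1 v.2.2 := by
  unfold redraw; fun_prop

theorem ae_ne_of_map_pairLaw {α : Type*} [MeasurableSpace α] {μ : Measure α} {X : α → ℝ × ℝ}
    (hX : Measurable X) (h : μ.map X = pairLaw) {q ω : ℝ} (hq : 0 < q) :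
    ∀ᵐ v ∂μ, q * (X v).2 ≠ ω := by
  have h1 : ∀ᵐ e ∂stdExp, q * e ≠ ω := by
    have : ∀ᵐ e ∂stdExp, e ≠ ω / q := by simp [ae_iff, measure_singleton]
    filter_upwards [this] with e he h
    exact he (by rw [← h]; field_simp)
  have h2 : ∀ᵐ a ∂pairLaw, q * a.2 ≠ ω := Measure.quasiMeasurePreserving_snd.ae h1
  rw [← h] at h2
  exact ae_of_ae_map hX.aemeasurable h2

/-- The law of the hash and of the lowered counter of a key that survives the eviction. -/
theorem lintegral_lowering {ℓ : ℝ} (hℓ : 0 < ℓ) {t : ℝ≥0∞} {ω : ℝ} (hω : 0 < ω)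
    (ht : ENNReal.ofReal (1 / ℓ) < t) {τ : ℝ≥0∞} (hτt : τ ≤ t) (hτ : τ ≠ ⊤)
    {φ : ℝ × ℝ → ℝ≥0∞} (hφ : Measurable φ) :
    ∫⁻ v, (if v.1.2 * invRate ℓ t < ω ∧
        seedOf ℓ (redraw t (ω - v.1.2 * invRate ℓ t) v.2.1 v.2.2) v.1.1 < τ
      then φ (v.1.1, if rate ℓ τ / t < ENNReal.ofReal v.2.1
        then ω - v.1.2 * invRate ℓ t - v.2.2 * invRate ℓ τ else ω - v.1.2 * invRate ℓ t) else 0)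
      ∂(pairLaw.prod pairLaw) =
    ∫⁻ v, (if v.1.2 * invRate ℓ t < ω ∧ seedOf ℓ (arrival ω v.1.2) v.1.1 < τ
      then φ (v.1.1, ω - v.1.2 * invRate ℓ τ) else 0) ∂(pairLaw.prod pairLaw) := by
  have hL0 := rate_pos hℓ τ
  have hLt : rate ℓ τ ≤ t := max_le ht.le hτt
  have hL := rate_ne_top (ℓ := ℓ) hτ
  have hrt : invRate ℓ t = t⁻¹.toReal := by rw [invRate, rate_of_lt ht]
  have hrτ : invRate ℓ τ = (rate ℓ τ)⁻¹.toReal := rfl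
  rw [hrt, hrτ]
  set L := rate ℓ τ with hLdef
  set p := (L / t).toReal with hp
  have hp0 : 0 ≤ p := ENNReal.toReal_nonneg
  have hp1 : p ≤ 1 := div_toReal_le_one hLt
  have hq : 0 < L⁻¹.toReal := by
    rw [ENNReal.toReal_inv]; exact inv_pos.2 (ENNReal.toReal_pos hL0.ne' hL)
  set ψ : ℝ × ℝ → ℝ≥0∞ := fun a => if L⁻¹.toReal * a.2 < ω ∧ ENNReal.ofReal (a.1 / ℓ) < τ then
    φ (a.1, ω - L⁻¹.toReal * a.2) else 0 with hψ
  have hψm : Measurable ψ := by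
    refine Measurable.ite (measurableSet_and (measurableSet_lt (by fun_prop) (by fun_prop))
      (measurableSet_lt (by fun_prop) (by fun_prop))) (by fun_prop) (by fun_prop)
  set X : (ℝ × ℝ) × ℝ × ℝ → ℝ × ℝ := fun v =>
    (v.1.1, p * v.1.2 + if p < v.2.1 then v.2.2 else 0) with hX
  have hXm : Measurable X := Measurable.prodMk (by fun_prop)
    ((by fun_prop : Measurable fun v : (ℝ × ℝ) × ℝ × ℝ => p * v.1.2).add
      (Measurable.ite (measurableSet_lt (by fun_prop) (by fun_prop)) (by fun_prop) (by fun_prop)))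
  have hXl : (pairLaw.prod pairLaw).map X = pairLaw := map_pair_thinning hp0 hp1
  have hYl : (pairLaw.prod pairLaw).map Prod.fst = pairLaw := by simp
  have g1 : ∀ᵐ v ∂(pairLaw.prod pairLaw), 0 < v.1.1 ∧ v.1.1 < 1 ∧ 0 < v.1.2 :=
    Measure.quasiMeasurePreserving_fst.ae ae_pairLaw
  have g2 : ∀ᵐ v ∂(pairLaw.prod pairLaw), 0 < v.2.1 ∧ v.2.1 < 1 ∧ 0 < v.2.2 :=
    Measure.quasiMeasurePreserving_snd.ae ae_pairLaw
  have g3 : ∀ᵐ v ∂(pairLaw.prod pairLaw), v.2.1 ≠ p := by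
    have h1 : ∀ᵐ a ∂pairLaw, a.1 ≠ p :=
      Measure.quasiMeasurePreserving_fst.ae
        (by simp [ae_iff, measure_singleton] : ∀ᵐ u ∂unifLaw, u ≠ p)
    exact Measure.quasiMeasurePreserving_snd.ae h1
  -- Both sides are integrals of the same `ψ` against `pairLaw`: the left one through the thinned
  -- pair `X`, the right one through the original pair. The excluded boundary events are null.
  trans ∫⁻ v, ψ (X v) ∂(pairLaw.prod pairLaw)
  · apply lintegral_congr_ae
    filter_upwards [g1, g2, g3, ae_ne_of_map_pairLaw (ω := ω) hXm hXl hq] with v g1 g2 g3 g4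
    rw [counter_after_lowering hL0 hLt hL g2.1]
    simp only [hψ, hX]
    congr 1
    rw [eq_iff_iff]
    constructor
    · rintro ⟨h1, h2⟩
      have h3 := of_seedOf_lt hℓ g1.2.1.le h2
      exact ⟨lt_of_le_of_ne (of_redraw_le hL0 hLt hL g2.2.2 g2.1 h1 h3.2) g4, h3.1⟩
    · rintro ⟨h1, h2⟩
      have h3 := redraw_lt hL0 hLt hL g2.2.2 g2.1 g3 h1
      exact ⟨h3.1, seedOf_lt h2 h3.2⟩
  · rw [← lintegral_map hψm hXm, hXl]
    conv_lhs => rw [← hYl]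
    rw [lintegral_map hψm measurable_fst]
    apply lintegral_congr_ae
    filter_upwards [g1, ae_ne_of_map_pairLaw (ω := ω) measurable_fst hYl hq] with v g1 g4
    simp only [hψ]
    rw [mul_comm v.1.2 L⁻¹.toReal]
    congr 1
    rw [eq_iff_iff]
    constructor
    · rintro ⟨h1, h2⟩
      have h3 := arrival_lt_of_lt hL0 hLt hL g1.2.2 h1
      exact ⟨h3.1, seedOf_lt h2 h3.2⟩
    · rintro ⟨h1, h2⟩
      have h3 := of_seedOf_lt hℓ g1.2.1.le h2
      exact ⟨lt_of_le_of_ne (of_arrival_le hL0 hL hω g1.2.2 h3.2) g4, h3.1⟩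

/-- The law of the hash and of the redrawn seed agrees with the law before the redraw. -/
theorem lintegral_redraw {ℓ : ℝ} {t : ℝ≥0∞} {ω : ℝ} (hω : 0 < ω)
    (ht : ENNReal.ofReal (1 / ℓ) < t)
    {ψ : ℝ × ℝ≥0∞ → ℝ≥0∞} (hψ : Measurable ψ) :
    ∫⁻ v, (if v.1.2 * invRate ℓ t < ω then
        ψ (v.1.1, seedOf ℓ (redraw t (ω - v.1.2 * invRate ℓ t) v.2.1 v.2.2) v.1.1) else 0)
      ∂(pairLaw.prod pairLaw) =
    ∫⁻ v, (if v.1.2 * invRate ℓ t < ω then ψ (v.1.1, seedOf ℓ (arrival ω v.1.2) v.1.1) else 0)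
      ∂(pairLaw.prod pairLaw) := by
  set q := invRate ℓ t with hqdef
  have hrt : q = t⁻¹.toReal := by rw [hqdef, invRate, rate_of_lt ht]
  set Ma : (ℝ × ℝ) × ℝ × ℝ → ℝ≥0∞ := fun v => redraw t (ω - v.1.2 * q) v.2.1 v.2.2 with hMa
  set Mi : (ℝ × ℝ) × ℝ × ℝ → ℝ≥0∞ := fun v => arrival ω v.1.2 with hMi
  have hMam : Measurable Ma := measurable_redraw t ω q
  have hMim : Measurable Mi := (measurable_arrival ω).comp (by fun_prop)
  set A : Set ((ℝ × ℝ) × ℝ × ℝ) := {v | v.1.2 * q < ω} with hA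
  have hAm : MeasurableSet A := measurableSet_lt (by fun_prop) (by fun_prop)
  set μ := pairLaw.prod pairLaw with hμ
  have g1 : ∀ᵐ v ∂μ, 0 < v.1.1 ∧ v.1.1 < 1 ∧ 0 < v.1.2 :=
    Measure.quasiMeasurePreserving_fst.ae ae_pairLaw
  have g2 : ∀ᵐ v ∂μ, 0 < v.2.1 ∧ v.2.1 < 1 ∧ 0 < v.2.2 :=
    Measure.quasiMeasurePreserving_snd.ae ae_pairLaw
  have hYl : μ.map Prod.fst = pairLaw := by simp [hμ]
  -- Levels `L ≥ t` do not distinguish the two values: `t u ≤ t`, and `e/t < ω` says that the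
  -- original arrival value is below `t`.
  have hct : ∀ L : ℝ≥0∞, t ≤ L → ∀ v : (ℝ × ℝ) × ℝ × ℝ, 0 < v.1.2 → v.2.1 < 1 → v ∈ A →
      Ma v ≤ L ∧ Mi v ≤ L := by
    intro L hL v h1 h2 h3
    constructor
    · refine (min_le_left _ _).trans (le_trans ?_ hL)
      calc t * ENNReal.ofReal v.2.1 ≤ t * 1 := by
            gcongr; rw [ENNReal.ofReal_le_one]; exact h2.le
        _ = t := mul_one t
    · refine le_trans ?_ hL
      by_cases htop : t = ⊤
      · rw [htop]; exact le_top
      · have h4 : 0 < t.toReal := ENNReal.toReal_pos (pos_of_gt ht).ne' htop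
        simp only [hMi]
        rw [arrival_of_pos hω, ENNReal.ofReal_le_iff_le_toReal htop, div_le_iff₀ hω]
        have h5 : v.1.2 * q < ω := h3
        rw [hrt, ENNReal.toReal_inv, ← div_eq_mul_inv, div_lt_iff₀ h4] at h5
        linarith
  -- Comparing distribution functions at every level `L`, with the hash confined to `s`, gives
  -- equality on rectangles and hence of the joint laws.
  have key : ∀ s : Set ℝ, MeasurableSet s →
      (μ.restrict (A ∩ (fun v => v.1.1) ⁻¹' s)).map Ma =
      (μ.restrict (A ∩ (fun v => v.1.1) ⁻¹' s)).map Mi := by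
    intro s hs
    have hAs : MeasurableSet (A ∩ (fun v : (ℝ × ℝ) × ℝ × ℝ => v.1.1) ⁻¹' s) :=
      hAm.inter (hs.preimage (by fun_prop))
    apply Measure.ext_of_Iic
    intro L
    rw [Measure.map_apply hMam measurableSet_Iic, Measure.map_apply hMim measurableSet_Iic,
      Measure.restrict_apply (hMam measurableSet_Iic), Measure.restrict_apply (hMim measurableSet_Iic)]
    rcases le_or_gt t L with htL | hLt
    · apply measure_congr
      filter_upwards [g1, g2] with v g1 g2
      rw [eq_iff_iff]
      exact ⟨fun h => ⟨(hct L htL v g1.2.2 g2.2.1 h.2.1).2, h.2⟩,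
        fun h => ⟨(hct L htL v g1.2.2 g2.2.1 h.2.1).1, h.2⟩⟩
    have hL := hLt.ne_top
    rcases eq_or_ne L 0 with rfl | hL0
    · apply measure_congr
      filter_upwards [g1, g2] with v g1 g2
      rw [eq_iff_iff]
      constructor
      · rintro ⟨h1, h2, h3⟩
        exfalso
        have h2 : v.1.2 * q < ω := h2
        have h1 : Ma v ≤ 0 := h1
        rcases min_le_iff.1 h1 with h4 | h4
        · rw [nonpos_iff_eq_zero, mul_eq_zero] at h4
          rcases h4 with h4 | h4
          · exact (pos_of_gt ht).ne' h4
          · rw [ENNReal.ofReal_eq_zero] at h4; linarith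
        · rw [nonpos_iff_eq_zero, ENNReal.ofReal_eq_zero] at h4
          have : 0 < v.2.2 / (ω - v.1.2 * q) := div_pos g2.2.2 (by linarith)
          linarith
      · rintro ⟨h1, h2, h3⟩
        exfalso
        have h1 : arrival ω v.1.2 ≤ 0 := h1
        rw [arrival_of_pos hω, nonpos_iff_eq_zero, ENNReal.ofReal_eq_zero] at h1
        have : 0 < v.1.2 / ω := div_pos g1.2.2 hω
        linarith
    have hL0 : 0 < L := pos_iff_ne_zero.2 hL0
    set p := (L / t).toReal with hp
    have hp0 : 0 ≤ p := ENNReal.toReal_nonneg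
    have hp1 : p ≤ 1 := div_toReal_le_one hLt.le
    have hq : 0 < L⁻¹.toReal := by
      rw [ENNReal.toReal_inv]; exact inv_pos.2 (ENNReal.toReal_pos hL0.ne' hL)
    set X : (ℝ × ℝ) × ℝ × ℝ → ℝ × ℝ := fun v =>
      (v.1.1, p * v.1.2 + if p < v.2.1 then v.2.2 else 0) with hX
    have hXm : Measurable X := Measurable.prodMk (by fun_prop)
      ((by fun_prop : Measurable fun v : (ℝ × ℝ) × ℝ × ℝ => p * v.1.2).add
        (Measurable.ite (measurableSet_lt (by fun_prop) (by fun_prop)) (by fun_prop) (by fun_prop)))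
    have hXl : μ.map X = pairLaw := map_pair_thinning hp0 hp1
    have g3 : ∀ᵐ v ∂μ, v.2.1 ≠ p := by
      have h1 : ∀ᵐ a ∂pairLaw, a.1 ≠ p :=
        Measure.quasiMeasurePreserving_fst.ae
          (by simp [ae_iff, measure_singleton] : ∀ᵐ u ∂unifLaw, u ≠ p)
      exact Measure.quasiMeasurePreserving_snd.ae h1
    have hB : MeasurableSet {a : ℝ × ℝ | L⁻¹.toReal * a.2 < ω ∧ a.1 ∈ s} :=
      measurableSet_and (measurableSet_lt (by fun_prop) (by fun_prop))
        (hs.preimage measurable_fst)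
    -- For `0 < L < t` both events are `e/L < ω` with the hash in `s`, for the thinned pair and for
    -- the original pair respectively.
    trans pairLaw {a : ℝ × ℝ | L⁻¹.toReal * a.2 < ω ∧ a.1 ∈ s}
    · rw [← hXl, Measure.map_apply hXm hB]
      apply measure_congr
      filter_upwards [g1, g2, g3, ae_ne_of_map_pairLaw (ω := ω) hXm hXl hq] with v g1 g2 g3 g4
      rw [eq_iff_iff]
      constructor
      · rintro ⟨h1, h2, h3⟩
        have h2 : v.1.2 * q < ω := h2
        have h1 : redraw t (ω - v.1.2 * q) v.2.1 v.2.2 ≤ L := h1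
        rw [hrt] at h1 h2
        exact ⟨lt_of_le_of_ne (of_redraw_le hL0 hLt.le hL g2.2.2 g2.1 h2 h1) g4, h3⟩
      · rintro ⟨h1, h3⟩
        have h4 := redraw_lt hL0 hLt.le hL g2.2.2 g2.1 g3 h1
        rw [← hrt] at h4
        exact ⟨h4.2.le, h4.1, h3⟩
    · rw [← hYl, Measure.map_apply measurable_fst hB]
      apply measure_congr
      filter_upwards [g1, ae_ne_of_map_pairLaw (ω := ω) measurable_fst hYl hq] with v g1 g4
      rw [eq_iff_iff]
      constructor
      · rintro ⟨h1, h3⟩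
        have h4 := arrival_lt_of_lt hL0 hLt.le hL g1.2.2 h1
        rw [← hrt] at h4
        exact ⟨h4.2.le, h4.1, h3⟩
      · rintro ⟨h1, h2, h3⟩
        exact ⟨lt_of_le_of_ne (of_arrival_le hL0 hL hω g1.2.2 h1) g4, h3⟩
  have hjoint : (μ.restrict A).map (fun v => (v.1.1, Ma v)) =
      (μ.restrict A).map (fun v => (v.1.1, Mi v)) := by
    apply Measure.ext_prod
    intro s T hs hT
    have h := congrArg (fun ν => ν T) (key s hs)
    beta_reduce at h
    rw [Measure.map_apply hMam hT, Measure.map_apply hMim hT, Measure.restrict_apply (hMam hT),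
      Measure.restrict_apply (hMim hT)] at h
    rw [Measure.map_apply (by fun_prop) (hs.prod hT), Measure.map_apply (by fun_prop) (hs.prod hT),
      Measure.restrict_apply ((hs.prod hT).preimage (by fun_prop)),
      Measure.restrict_apply ((hs.prod hT).preimage (by fun_prop))]
    convert! h using 2 <;> ext v <;> simp <;> tauto
  have hψ' : Measurable fun a : ℝ × ℝ≥0∞ => ψ (a.1, seedOf ℓ a.2 a.1) :=
    hψ.comp (measurable_fst.prodMk ((measurable_seedOf ℓ).comp measurable_swap))
  have hfin := congrArg (fun ν => ∫⁻ a, ψ (a.1, seedOf ℓ a.2 a.1) ∂ν) hjoint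
  beta_reduce at hfin
  rw [lintegral_map hψ' (by fun_prop), lintegral_map hψ' (by fun_prop),
    ← lintegral_indicator hAm, ← lintegral_indicator hAm] at hfin
  convert! hfin using 3 with v v

/-! ### Order statistics and bottom-`k` samples -/

section BottomK

variable {X : Type*}

/-- The `k`-th smallest value of `σ` on `K` (`∞` if there are fewer than `k` values). -/
noncomputable def kthSmallest (k : ℕ) (K : Finset X) (σ : X → ℝ≥0∞) : ℝ≥0∞ :=
  sInf {a | k ≤ (K.filter (fun z => σ z ≤ a)).card}

theorem kthSmallest_eq {k : ℕ} {K : Finset X} {σ : X → ℝ≥0∞} {a : ℝ≥0∞}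
    (h1 : (K.filter (fun z => σ z < a)).card < k)
    (h2 : a = ⊤ ∨ k ≤ (K.filter (fun z => σ z ≤ a)).card) : kthSmallest k K σ = a := by
  apply le_antisymm
  · rcases h2 with rfl | h2
    · exact le_top
    · exact sInf_le h2
  · apply le_sInf
    intro b hb
    have hb : k ≤ (K.filter (fun z => σ z ≤ b)).card := hb
    by_contra hba
    have : K.filter (fun z => σ z ≤ b) ⊆ K.filter (fun z => σ z < a) :=
      Finset.monotone_filter_right _ fun z _ hz => lt_of_le_of_lt hz (not_le.1 hba)
    have := Finset.card_le_card this
    omega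

theorem card_filter_lt_kthSmallest {k : ℕ} (hk : 1 ≤ k) (K : Finset X) (σ : X → ℝ≥0∞) :
    (K.filter (fun z => σ z < kthSmallest k K σ)).card < k := by
  by_contra h
  rw [not_lt] at h
  set G := K.filter (fun z => σ z < kthSmallest k K σ) with hG
  have hne : G.Nonempty := Finset.card_pos.1 (by omega)
  obtain ⟨z, hz, hmax⟩ := Finset.exists_max_image G σ hne
  have hle : kthSmallest k K σ ≤ σ z := by
    apply sInf_le
    refine h.trans (Finset.card_le_card fun a ha => ?_)
    exact Finset.mem_filter.2 ⟨(Finset.mem_filter.1 ha).1, hmax a ha⟩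
  exact absurd (Finset.mem_filter.1 hz).2 (not_lt.2 hle)

/-- The infimum is attained because `K` is finite: any admissible level can be lowered to a value of
`σ` without changing the set of keys below it. -/
theorem kthSmallest_eq_top_or {k : ℕ} (hk : 1 ≤ k) (K : Finset X) (σ : X → ℝ≥0∞) :
    kthSmallest k K σ = ⊤ ∨ k ≤ (K.filter (fun z => σ z ≤ kthSmallest k K σ)).card := by
  by_cases hK : k ≤ K.card
  · right
    set B := K.filter (fun z => k ≤ (K.filter (fun y => σ y ≤ σ z)).card) with hB
    have hex : ∀ a, k ≤ (K.filter (fun y => σ y ≤ a)).card → ∃ z ∈ B, σ z ≤ a := by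
      intro a ha
      have hne : (K.filter (fun y => σ y ≤ a)).Nonempty := Finset.card_pos.1 (by omega)
      obtain ⟨z, hz, hmax⟩ := Finset.exists_max_image _ σ hne
      refine ⟨z, Finset.mem_filter.2 ⟨(Finset.mem_filter.1 hz).1, ha.trans (Finset.card_le_card ?_)⟩,
        (Finset.mem_filter.1 hz).2⟩
      intro y hy
      exact Finset.mem_filter.2 ⟨(Finset.mem_filter.1 hy).1, hmax y hy⟩
    obtain ⟨z0, hz0, -⟩ := hex ⊤ (by simpa using hK)
    obtain ⟨z, hz, hmin⟩ := Finset.exists_min_image B σ ⟨z0, hz0⟩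
    have hz' := (Finset.mem_filter.1 hz).2
    have : kthSmallest k K σ = σ z := by
      have hle : kthSmallest k K σ ≤ σ z := sInf_le hz'
      apply le_antisymm hle
      apply le_sInf
      intro a ha
      obtain ⟨y, hy, hya⟩ := hex a ha
      exact (hmin y hy).trans hya
    rw [this]; exact hz'
  · left
    apply kthSmallest_eq _ (Or.inl rfl)
    exact lt_of_le_of_lt (Finset.card_le_card (Finset.filter_subset _ _)) (not_le.1 hK)

theorem kthSmallest_congr {k : ℕ} {K : Finset X} {σ σ' : X → ℝ≥0∞} (h : ∀ z ∈ K, σ z = σ' z) :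
    kthSmallest k K σ = kthSmallest k K σ' := by
  unfold kthSmallest
  congr 1; ext a
  have : K.filter (fun z => σ z ≤ a) = K.filter (fun z => σ' z ≤ a) :=
    Finset.filter_congr fun z hz => by rw [h z hz]
  rw [Set.mem_ofPred_eq, Set.mem_ofPred_eq, this]

variable [DecidableEq X]

/-- Adding a key strictly below the level raises both counts that characterize it by one, so the
same level has rank `k + 1`. -/
theorem kthSmallest_of_lt {k : ℕ} {K : Finset X} {σ : X → ℝ≥0∞} {y : X} (hk : 1 ≤ k) (hy : y ∈ K)
    (h : σ y < kthSmallest k (K.erase y) σ) :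
    kthSmallest (k + 1) K σ = kthSmallest k (K.erase y) σ := by
  have h1 := card_filter_lt_kthSmallest hk (K.erase y) σ
  have h2 := kthSmallest_eq_top_or hk (K.erase y) σ
  set T := kthSmallest k (K.erase y) σ
  rw [Finset.filter_erase] at h1 h2
  apply kthSmallest_eq
  · have := Finset.card_erase_add_one (s := K.filter (fun z => σ z < T)) (a := y) (by simp [hy, h])
    omega
  · refine h2.imp id fun h2 => ?_
    have := Finset.card_erase_add_one (s := K.filter (fun z => σ z ≤ T)) (a := y)
      (by simp [hy, h.le])
    omega

/-- Counterpart of `kthSmallest_of_lt` with the hypothesis on the full set. For a sampled key it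
identifies the threshold with the `k`-th smallest seed of the other keys. -/
theorem kthSmallest_erase_of_lt {k : ℕ} {K : Finset X} {σ : X → ℝ≥0∞} {y : X} (hy : y ∈ K)
    (h : σ y < kthSmallest (k + 1) K σ) :
    kthSmallest (k + 1) K σ = kthSmallest k (K.erase y) σ := by
  have h1 := card_filter_lt_kthSmallest (by omega : 1 ≤ k + 1) K σ
  have h2 := kthSmallest_eq_top_or (by omega : 1 ≤ k + 1) K σ
  set T := kthSmallest (k + 1) K σ
  symm
  apply kthSmallest_eq
  · rw [Finset.filter_erase]
    have := Finset.card_erase_add_one (s := K.filter (fun z => σ z < T)) (a := y) (by simp [hy, h])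
    omega
  · refine h2.imp id fun h2 => ?_
    rw [Finset.filter_erase]
    have := Finset.card_erase_add_one (s := K.filter (fun z => σ z ≤ T)) (a := y)
      (by simp [hy, h.le])
    omega

theorem lt_kthSmallest_iff {k : ℕ} {K : Finset X} {σ : X → ℝ≥0∞} {y : X} (hk : 1 ≤ k)
    (hy : y ∈ K) : σ y < kthSmallest (k + 1) K σ ↔ σ y < kthSmallest k (K.erase y) σ :=
  ⟨fun h => kthSmallest_erase_of_lt hy h ▸ h, fun h => (kthSmallest_of_lt hk hy h).symm ▸ h⟩

/-- Lowering the value of `y` on one side of the `k`-th smallest value does not change it. -/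
theorem kthSmallest_update_of_same_side {k : ℕ} (hk : 1 ≤ k) {K : Finset X} {σ : X → ℝ≥0∞} {y : X}
    {m : ℝ≥0∞} (hm : m ≤ σ y) (h : σ y < kthSmallest k K σ ∨ kthSmallest k K σ ≤ m) :
    kthSmallest k K (Function.update σ y m) = kthSmallest k K σ ∧
    ∀ z, Function.update σ y m z < kthSmallest k K σ ↔ σ z < kthSmallest k K σ := by
  have h1 := card_filter_lt_kthSmallest hk K σ
  have h2 := kthSmallest_eq_top_or hk K σ
  set T := kthSmallest k K σ
  have h3 : ∀ z, Function.update σ y m z < T ↔ σ z < T := by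
    intro z
    by_cases hz : z = y
    · subst hz
      rw [Function.update_self]
      rcases h with h | h
      · exact ⟨fun _ => h, fun _ => hm.trans_lt h⟩
      · exact ⟨fun h' => absurd h' (not_lt.2 h), fun h' => absurd (hm.trans_lt h') (not_lt.2 h)⟩
    · rw [Function.update_of_ne hz]
  refine ⟨kthSmallest_eq ?_ (h2.imp id fun h2 => h2.trans (Finset.card_le_card ?_)), h3⟩
  · simp only [h3]; exact h1
  · refine Finset.monotone_filter_right _ fun z _ hz => ?_
    refine le_trans ?_ hz
    by_cases hzy : z = y
    · subst hzy; simpa using hm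
    · simp [hzy]

/-- Inserting a key among the `k` keys below the threshold evicts the largest of the `k + 1`. -/
theorem kthSmallest_update_evict {k : ℕ} {K : Finset X} {σ : X → ℝ≥0∞} {y y0 : X} {m : ℝ≥0∞}
    (hy : y ∈ K) (hσy : kthSmallest (k + 1) K σ ≤ σ y) (hm : m < kthSmallest (k + 1) K σ)
    {A : Finset X} (hA : A = insert y (K.filter (fun z => σ z < kthSmallest (k + 1) K σ)))
    (hcard : A.card = k + 1) (hy0 : y0 ∈ A)
    (hmax : ∀ z ∈ A.erase y0, Function.update σ y m z < Function.update σ y m y0) :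
    kthSmallest (k + 1) K (Function.update σ y m) = Function.update σ y m y0 ∧
    K.filter (fun z => Function.update σ y m z < Function.update σ y m y0) = A.erase y0 := by
  set T := kthSmallest (k + 1) K σ
  have hAT : ∀ z, z ∈ A ↔ z ∈ K ∧ Function.update σ y m z < T := by
    intro z
    rw [hA, Finset.mem_insert, Finset.mem_filter]
    by_cases hz : z = y
    · subst hz; simp [hy, hm]
    · simp [hz]
  have h2 : K.filter (fun z => Function.update σ y m z < Function.update σ y m y0) = A.erase y0 := by
    ext z
    rw [Finset.mem_filter, Finset.mem_erase, hAT]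
    constructor
    · rintro ⟨hz, hlt⟩
      exact ⟨fun h => by rw [h] at hlt; exact lt_irrefl _ hlt, hz, hlt.trans ((hAT y0).1 hy0).2⟩
    · rintro ⟨hne, hz, hlt⟩
      exact ⟨hz, hmax z (Finset.mem_erase.2 ⟨hne, (hAT z).2 ⟨hz, hlt⟩⟩)⟩
  refine ⟨kthSmallest_eq ?_ (Or.inr ?_), h2⟩
  · rw [h2, Finset.card_erase_of_mem hy0]; omega
  · rw [← hcard]
    apply Finset.card_le_card
    intro z hz
    refine Finset.mem_filter.2 ⟨((hAT z).1 hz).1, ?_⟩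
    by_cases hzy : z = y0
    · rw [hzy]
    · exact (hmax z (Finset.mem_erase.2 ⟨hzy, hz⟩)).le

/-- Ties at `⊤` must be allowed, since all keys not yet seen have that seed. A finite level is
attained by at most one key, which leaves exactly `k` keys strictly below it. -/
theorem kthSmallest_eq_top_or_card {k : ℕ} {K : Finset X} {σ : X → ℝ≥0∞}
    (hσ : ∀ a ∈ K, ∀ b ∈ K, a ≠ b → σ a = σ b → σ a = ⊤) :
    kthSmallest (k + 1) K σ = ⊤ ∨
      (K.filter (fun z => σ z < kthSmallest (k + 1) K σ)).card = k := by
  have h1 := card_filter_lt_kthSmallest (by omega : 1 ≤ k + 1) K σ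
  rcases kthSmallest_eq_top_or (by omega : 1 ≤ k + 1) K σ with h2 | h2
  · exact Or.inl h2
  by_cases hT : kthSmallest (k + 1) K σ = ⊤
  · exact Or.inl hT
  right
  set T := kthSmallest (k + 1) K σ
  have h3 : K.filter (fun z => σ z ≤ T) =
      K.filter (fun z => σ z < T) ∪ K.filter (fun z => σ z = T) := by
    rw [← Finset.filter_or]
    exact Finset.filter_congr fun z _ => le_iff_lt_or_eq
  have h4 : (K.filter (fun z => σ z = T)).card ≤ 1 := by
    rw [Finset.card_le_one]
    intro a ha b hb
    by_contra hab
    rw [Finset.mem_filter] at ha hb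
    have := hσ a ha.1 b hb.1 hab (ha.2.trans hb.2.symm)
    exact hT (ha.2 ▸ this)
  have h5 := Finset.card_union_le (K.filter (fun z => σ z < T)) (K.filter (fun z => σ z = T))
  rw [← h3] at h5
  omega

/-- The bottom-`k` sample with respect to the seeds `σ`, where a sampled key `z` has counter
`c z τ` at threshold `τ`. -/
noncomputable def bottomSample (k : ℕ) (K : Finset X) (σ : X → ℝ≥0∞) (c : X → ℝ≥0∞ → ℝ) :
    ℝ≥0∞ × Finset X × (X → ℝ) :=
  (kthSmallest (k + 1) K σ, K.filter (fun z => σ z < kthSmallest (k + 1) K σ),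
    fun z => if z ∈ K ∧ σ z < kthSmallest (k + 1) K σ then c z (kthSmallest (k + 1) K σ) else 0)

end BottomK

/-! ### The algorithm as a map of threshold, cache and counts -/

section AbstractStep

variable {X : Type*} [DecidableEq X]

/-- The eviction threshold in terms of a hash `h`, a uniform `u` and a standard exponential `E`. -/
noncomputable def redrawnSeed (ℓ : ℝ) (τ : ℝ≥0∞) (c h u E : ℝ) : ℝ≥0∞ :=
  seedOf ℓ (redraw τ c u E) h

/-- The eviction step on a threshold `τ` and a set `A` of keys with counts `c`. -/
noncomputable def evictState (ℓ : ℝ) (τ : ℝ≥0∞) (A : Finset X) (c h : X → ℝ) (η : X → ℝ × ℝ) :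
    ℝ≥0∞ × Finset X × (X → ℝ) :=
  if 1 < τ * ENNReal.ofReal ℓ then
    match argmaxKey A (fun z => redrawnSeed ℓ τ (c z) (h z) (η z).1 (η z).2) with
    | none => (τ, A, c)
    | some y =>
      (redrawnSeed ℓ τ (c y) (h y) (η y).1 (η y).2, A.erase y, fun z =>
        if z ∈ A.erase y then
          if rate ℓ (redrawnSeed ℓ τ (c y) (h y) (η y).1 (η y).2) / τ < ENNReal.ofReal (η z).1
          then c z - (η z).2 * invRate ℓ (redrawnSeed ℓ τ (c y) (h y) (η y).1 (η y).2) else c z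
        else 0)
  else
    match argmaxKey A (fun z => ENNReal.ofReal (h z / ℓ)) with
    | none => (τ, A, c)
    | some y => (ENNReal.ofReal (h y / ℓ), A.erase y, fun z => if z ∈ A.erase y then c z else 0)

/-- The processing of an element `(y,w)` as a map of the threshold, the set of cached keys and the
counts, given the hashes `h`, the exponential variable `e₀` of the entry test and the eviction
draws `η`. -/
noncomputable def stepState (k : ℕ) (ℓ : ℝ) (y : X) (w : ℝ) (s : ℝ≥0∞ × Finset X × (X → ℝ))
    (h : X → ℝ) (e₀ : ℝ) (η : X → ℝ × ℝ) : ℝ≥0∞ × Finset X × (X → ℝ) :=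
  if y ∈ s.2.1 then (s.1, s.2.1, Function.update s.2.2 y (s.2.2 y + w))
  else if e₀ * invRate ℓ s.1 < w ∧ (1 < s.1 * ENNReal.ofReal ℓ ∨
      (s.1 * ENNReal.ofReal ℓ ≤ 1 ∧ ENNReal.ofReal (h y / ℓ) < s.1)) then
    if (insert y s.2.1).card = k + 1 then
      evictState ℓ s.1 (insert y s.2.1) (Function.update s.2.2 y (w - e₀ * invRate ℓ s.1)) h η
    else (s.1, insert y s.2.1, Function.update s.2.2 y (w - e₀ * invRate ℓ s.1))
  else s

/-- The threshold, the set of cached keys and the counts. -/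
noncomputable def visible (s : ℝ≥0∞ × Counters X) : ℝ≥0∞ × Finset X × (X → ℝ) :=
  (s.1, s.2.keys, s.2.count)

theorem count_set (C : Counters X) (y : X) (v : ℝ) :
    (C.set y v).count = Function.update C.count y v := by
  ext z
  by_cases h : z = y
  · subst h; simp [Counters.set, Counters.count]
  · simp [Counters.set, Counters.count, h]

omit [DecidableEq X] in
theorem argmax_congr {l : List X} {f g : X → ℝ≥0∞} (h : ∀ a ∈ l, f a = g a) :
    l.argmax f = l.argmax g := by
  induction l using List.reverseRecOn with
  | nil => rfl
  | append_singleton l a ih =>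
    rw [List.argmax_concat, List.argmax_concat, ih fun b hb => h b (by simp [hb])]
    cases hc : l.argmax g with
    | none => rfl
    | some c =>
      have hcl : c ∈ l := List.argmax_mem hc
      simp only
      rw [h c (by simp [hcl]), h a (by simp)]

omit [DecidableEq X] in
theorem argmaxKey_congr {S : Finset X} {f g : X → ℝ≥0∞} (h : ∀ a ∈ S, f a = g a) :
    argmaxKey S f = argmaxKey S g :=
  argmax_congr fun a ha => h a (Finset.mem_toList.1 ha)

omit [DecidableEq X] in
theorem argmaxKey_mem {S : Finset X} {f : X → ℝ≥0∞} {y : X} (h : argmaxKey S f = some y) :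
    y ∈ S := Finset.mem_toList.1 (List.argmax_mem h)

/-- Values stored at uncached keys carry no meaning and would spoil an equality of laws. Passing to
`count`, which is zero off the cache, loses nothing, because the step reads counters of cached keys
only. -/
theorem visible_evict (ℓ : ℝ) (t : Draw X → ℝ) (i : ℕ) (s : ℝ≥0∞ × Counters X) :
    visible (evict ℓ t i s) = evictState ℓ s.1 s.2.keys s.2.count (fun z => t (.hash z))
      (fun z => (t (.evictU i z), expOf (t (.evictR i z)))) := by
  have hval : ∀ z ∈ s.2.keys, s.2.count z = s.2.val z := fun z hz => by simp [Counters.count, hz]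
  unfold evict evictState
  simp only
  split_ifs with h1
  · have hc : ∀ z ∈ s.2.keys, evictThreshold ℓ s.1 (s.2.val z) (keyBase ℓ t z) (t (.evictU i z))
        (t (.evictR i z)) = redrawnSeed ℓ s.1 (s.2.count z) (t (.hash z)) (t (.evictU i z))
          (expOf (t (.evictR i z))) := by
      intro z hz
      rw [hval z hz]; rfl
    rw [argmaxKey_congr hc]
    cases hy : argmaxKey s.2.keys (fun z => redrawnSeed ℓ s.1 (s.2.count z) (t (.hash z))
      (t (.evictU i z)) (expOf (t (.evictR i z)))) with
    | none => rfl
    | some y =>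
      simp only
      rw [hc y (argmaxKey_mem hy)]
      unfold visible
      simp only [Prod.mk.injEq, true_and]
      ext z
      unfold Counters.count scaled invRate
      simp only
      split_ifs with h2 h3 h4 h5 <;> first | rfl | simp_all
  · cases hy : argmaxKey s.2.keys (fun z => ENNReal.ofReal (keyBase ℓ t z)) with
    | none => unfold keyBase at hy; simp only [hy]; rfl
    | some y =>
      unfold keyBase at hy
      simp only [hy]
      unfold visible keyBase
      simp only [Prod.mk.injEq, true_and]
      ext z
      unfold Counters.count
      simp only
      split_ifs <;> simp_all

theorem visible_step (k : ℕ) (ℓ : ℝ) (t : Draw X → ℝ) (i : ℕ) (y : X) (w : ℝ)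
    (s : ℝ≥0∞ × Counters X) :
    visible (fixedSizeStep k ℓ t i y w s) = stepState k ℓ y w (visible s) (fun z => t (.hash z))
      (expOf (t (.entry i))) (fun z => (t (.evictU i z), expOf (t (.evictR i z)))) := by
  by_cases h1 : y ∈ s.2.keys
  · have h1' : y ∈ (visible s).2.1 := h1
    have hc : (visible s).2.2 y = s.2.val y := by simp [visible, Counters.count, h1]
    rw [fixedSizeStep, if_pos h1, stepState, if_pos h1', hc]
    simp only [visible, count_set]
    simp [Counters.set, h1]
  have h1' : y ∉ (visible s).2.1 := h1
  rw [fixedSizeStep, if_neg h1, stepState, if_neg h1']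
  by_cases h2 : expOf (t (.entry i)) * invRate ℓ s.1 < w ∧ (1 < s.1 * ENNReal.ofReal ℓ ∨
      (s.1 * ENNReal.ofReal ℓ ≤ 1 ∧ ENNReal.ofReal (t (.hash y) / ℓ) < s.1))
  · by_cases h3 : (insert y s.2.keys).card = k + 1
    · refine (congrArg visible ((if_pos h2).trans (if_pos h3))).trans
        (Eq.trans ?_ ((if_pos h2).trans (if_pos h3)).symm)
      have := visible_evict ℓ t i (s.1, s.2.set y (w - expOf (t (.entry i)) * invRate ℓ s.1))
      rw [count_set] at this
      exact this
    · refine (congrArg visible ((if_pos h2).trans (if_neg h3))).trans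
        (Eq.trans ?_ ((if_pos h2).trans (if_neg h3)).symm)
      simp only [visible, count_set]; rfl
  · exact (congrArg visible (if_neg h2)).trans (if_neg h2).symm

end AbstractStep

/-! ### Measurability of states with a random finite set of keys -/

section Measurability

variable {α β γ X : Type*} [MeasurableSpace α] [MeasurableSpace γ]

/-- Random key sets and maximizers are treated as discrete labels without any σ-algebra, even for
uncountable `X`. Finitely many measurable fibres suffice. -/
theorem measurable_fiberwise {κ : α → β} (hκ : ∀ b, MeasurableSet {a | κ a = b}) {F : Finset β}
    (hF : ∀ a, κ a ∈ F) {f : β → α → γ} (hf : ∀ b, Measurable (f b)) :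
    Measurable fun a => f (κ a) a := by
  intro B hB
  have : (fun a => f (κ a) a) ⁻¹' B = ⋃ b ∈ F, ({a | κ a = b} ∩ f b ⁻¹' B) := by
    ext a
    simp only [Set.mem_preimage, Set.mem_iUnion, Set.mem_inter_iff, Set.mem_ofPred_eq]
    constructor
    · intro h; exact ⟨κ a, hF a, rfl, h⟩
    · rintro ⟨b, _, rfl, h⟩; exact h
  rw [this]
  exact Finset.measurableSet_biUnion F fun b _ => (hκ b).inter (hf b hB)

theorem measurableSet_fiberwise {κ : α → β} (hκ : ∀ b, MeasurableSet {a | κ a = b}) {F : Finset β}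
    (hF : ∀ a, κ a ∈ F) {p : β → α → Prop} (hp : ∀ b, MeasurableSet {a | p b a}) :
    MeasurableSet {a | p (κ a) a} := by
  have : {a | p (κ a) a} = ⋃ b ∈ F, ({a | κ a = b} ∩ {a | p b a}) := by
    ext a
    simp only [Set.mem_iUnion, Set.mem_inter_iff, Set.mem_ofPred_eq]
    constructor
    · intro h; exact ⟨κ a, hF a, rfl, h⟩
    · rintro ⟨b, _, rfl, h⟩; exact h
  rw [this]
  exact Finset.measurableSet_biUnion F fun b _ => (hκ b).inter (hp b)

theorem argmax_mem_image {β : Type*} [DecidableEq β] (l : List β) (f : β → ℝ≥0∞) :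
    l.argmax f ∈ insert none (l.toFinset.image some) := by
  cases h : l.argmax f with
  | none => simp
  | some c => simpa using List.argmax_mem h

/-- Induction along the list: appending `b` only adds one comparison of `b` with the previous
maximizer. -/
theorem measurableSet_argmax (l : List X) {f : α → X → ℝ≥0∞} (hf : ∀ z, Measurable fun a => f a z)
    (o : Option X) : MeasurableSet {a | l.argmax (f a) = o} := by
  classical
  induction l using List.reverseRecOn generalizing o with
  | nil => simp
  | append_singleton l b ih =>
    simp only [List.argmax_concat]
    refine measurableSet_fiberwise (κ := fun a => l.argmax (f a))
      (p := fun c a => Option.casesOn c (some b) (fun c => if f a c < f a b then some b else some c)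
        = o) ih (fun a => argmax_mem_image l (f a)) ?_
    intro c
    cases c with
    | none => simp
    | some c =>
      have : {a | (if f a c < f a b then some b else some c) = o} =
          {a | f a c < f a b ∧ some b = o} ∪ {a | ¬ f a c < f a b ∧ some c = o} := by
        ext a
        by_cases h : f a c < f a b <;> simp [h, -not_lt]
      change MeasurableSet {a | (if f a c < f a b then some b else some c) = o}
      rw [this]
      have h1 := measurableSet_lt (hf c) (hf b)
      exact (measurableSet_and h1 (.const _)).union (measurableSet_and h1.compl (.const _))

theorem measurableSet_argmaxKey (S : Finset X) {f : α → X → ℝ≥0∞}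
    (hf : ∀ z, Measurable fun a => f a z) (o : Option X) :
    MeasurableSet {a | argmaxKey S (f a) = o} := measurableSet_argmax _ hf o

/-- Measurability of a random threshold, set of keys and family of counts. -/
structure MeasurableState (f : α → ℝ≥0∞ × Finset X × (X → ℝ)) : Prop where
  threshold : Measurable fun a => (f a).1
  keys : ∀ S, MeasurableSet {a | (f a).2.1 = S}
  finite : ∃ F : Finset (Finset X), ∀ a, (f a).2.1 ∈ F
  counts : Measurable fun a => (f a).2.2

theorem MeasurableState.comp {f : α → ℝ≥0∞ × Finset X × (X → ℝ)} (hf : MeasurableState f)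
    {g : γ → α} (hg : Measurable g) : MeasurableState fun a => f (g a) where
  threshold := hf.threshold.comp hg
  keys := fun S => (hf.keys S).preimage hg
  finite := hf.finite.imp fun _ h a => h (g a)
  counts := hf.counts.comp hg

theorem measurableState_fiberwise {κ : α → β} (hκ : ∀ b, MeasurableSet {a | κ a = b}) {F : Finset β}
    (hF : ∀ a, κ a ∈ F) {f : β → α → ℝ≥0∞ × Finset X × (X → ℝ)}
    (hf : ∀ b, MeasurableState (f b)) : MeasurableState fun a => f (κ a) a where
  threshold := measurable_fiberwise (f := fun b a => (f b a).1) hκ hF fun b => (hf b).threshold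
  keys := fun S => measurableSet_fiberwise (p := fun b a => (f b a).2.1 = S) hκ hF
    fun b => (hf b).keys S
  finite := by
    classical
    choose G hG using fun b => (hf b).finite
    exact ⟨F.biUnion G, fun a => Finset.mem_biUnion.2 ⟨κ a, hF a, hG _ a⟩⟩
  counts := measurable_fiberwise (f := fun b a => (f b a).2.2) hκ hF fun b => (hf b).counts

theorem measurableState_ite {p : α → Prop} [DecidablePred p] (hp : MeasurableSet {a | p a})
    {f g : α → ℝ≥0∞ × Finset X × (X → ℝ)} (hf : MeasurableState f) (hg : MeasurableState g) :
    MeasurableState fun a => if p a then f a else g a := by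
  have := measurableState_fiberwise (κ := fun a => decide (p a)) (F := Finset.univ)
    (f := fun b a => if b = true then f a else g a) ?_ (fun a => Finset.mem_univ _) ?_
  · simpa using this
  · intro b
    cases b
    · have : {a | decide (p a) = false} = {a | p a}ᶜ := by ext a; simp
      rw [this]; exact hp.compl
    · simpa only [decide_eq_true_eq] using hp
  · intro b
    cases b
    · simpa using hg
    · simpa using hf

theorem measurableState_mk {τ : α → ℝ≥0∞} {c : α → X → ℝ} (hτ : Measurable τ) (hc : Measurable c)
    (S : Finset X) : MeasurableState fun a => (τ a, S, c a) :=
  ⟨hτ, fun _ => MeasurableSet.const (S = _), ⟨{S}, fun _ => by simp⟩, hc⟩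

/-- Test functions are indexed by the key set and measurable in threshold, counts and a further
vector `h`. The vector is later taken to be the hashes, which persist from one element to the next.
-/
theorem MeasurableState.measurable_test {f : α → ℝ≥0∞ × Finset X × (X → ℝ)}
    (hf : MeasurableState f) {h : α → X → ℝ} (hh : Measurable h)
    {g : Finset X → ℝ≥0∞ × (X → ℝ) × (X → ℝ) → γ} (hg : ∀ S, Measurable (g S)) :
    Measurable fun a => g (f a).2.1 ((f a).1, (f a).2.2, h a) := by
  obtain ⟨F, hF⟩ := hf.finite
  exact measurable_fiberwise (f := fun S a => g S ((f a).1, (f a).2.2, h a)) hf.keys hF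
    fun S => (hg S).comp (hf.threshold.prodMk (hf.counts.prodMk hh))

/-- Since the infimum is attained, being at most `b < ⊤` means that at least `k` of the values are
at most `b`, a condition on a finite sum of indicators. -/
theorem measurable_kthSmallest {k : ℕ} (hk : 1 ≤ k) (K : Finset X) {σ : α → X → ℝ≥0∞}
    (hσ : ∀ z ∈ K, Measurable fun a => σ a z) : Measurable fun a => kthSmallest k K (σ a) := by
  apply measurable_of_Iic
  intro b
  by_cases hb : b = ⊤
  · subst hb; simp
  have : (fun a => kthSmallest k K (σ a)) ⁻¹' Set.Iic b =
      {a | k ≤ ∑ z ∈ K, if σ a z ≤ b then 1 else 0} := by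
    ext a
    simp only [Set.mem_preimage, Set.mem_Iic, Set.mem_ofPred_eq, ← Finset.card_filter]
    constructor
    · intro h
      rcases kthSmallest_eq_top_or hk K (σ a) with h2 | h2
      · rw [h2, top_le_iff] at h; exact absurd h hb
      · exact h2.trans (Finset.card_le_card
          (Finset.monotone_filter_right _ fun z _ hz => le_trans hz h))
    · intro h
      exact sInf_le h
  rw [this]
  apply measurableSet_le measurable_const
  apply Finset.measurable_fun_sum
  intro z hz
  exact Measurable.ite (measurableSet_le (hσ z hz) measurable_const) measurable_const
    measurable_const

theorem measurableState_bottomSample [DecidableEq X] (k : ℕ) (K : Finset X) {σ : α → X → ℝ≥0∞}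
    (hσ : ∀ z ∈ K, Measurable fun a => σ a z) {c : α → X → ℝ≥0∞ → ℝ}
    (hc : ∀ z ∈ K, Measurable fun p : α × ℝ≥0∞ => c p.1 z p.2) :
    MeasurableState fun a => bottomSample k K (σ a) (c a) := by
  have hτ := measurable_kthSmallest (by omega : 1 ≤ k + 1) K hσ
  have hlt : ∀ z ∈ K, MeasurableSet {a | σ a z < kthSmallest (k + 1) K (σ a)} :=
    fun z hz => measurableSet_lt (hσ z hz) hτ
  refine ⟨hτ, ?_, ⟨K.powerset, fun a => Finset.mem_powerset.2 (Finset.filter_subset _ _)⟩, ?_⟩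
  · intro S
    by_cases hS : S ⊆ K
    · have : {a | (bottomSample k K (σ a) (c a)).2.1 = S} =
          ⋂ z ∈ K, {a | σ a z < kthSmallest (k + 1) K (σ a) ↔ z ∈ S} := by
        ext a
        simp only [bottomSample, Set.mem_ofPred_eq, Set.mem_iInter]
        constructor
        · rintro rfl z hz; simp [hz]
        · intro h
          ext z
          rw [Finset.mem_filter]
          exact ⟨fun h1 => (h z h1.1).1 h1.2, fun h1 => ⟨hS h1, (h z (hS h1)).2 h1⟩⟩
      rw [this]
      refine Finset.measurableSet_biInter K fun z hz => ?_
      by_cases hzS : z ∈ S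
      · simpa only [hzS, iff_true] using hlt z hz
      · simp only [hzS, iff_false]; exact (hlt z hz).compl
    · convert! MeasurableSet.empty
      ext a
      simp only [bottomSample, Set.mem_ofPred_eq, Set.mem_empty_iff_false, iff_false]
      rintro rfl
      exact hS (Finset.filter_subset _ _)
  · rw [measurable_pi_iff]
    intro z
    simp only [bottomSample]
    by_cases hz : z ∈ K
    · simp only [hz, true_and]
      exact Measurable.ite (hlt z hz) ((hc z hz).comp (measurable_id.prodMk hτ)) measurable_const
    · simp only [hz, false_and, if_false]; exact measurable_const

theorem measurable_redrawnSeed (ℓ : ℝ) {τ : α → ℝ≥0∞} {c h u E : α → ℝ} (hτ : Measurable τ)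
    (hc : Measurable c) (hh : Measurable h) (hu : Measurable u) (hE : Measurable E) :
    Measurable fun a => redrawnSeed ℓ (τ a) (c a) (h a) (u a) (E a) := by
  unfold redrawnSeed redraw
  exact (measurable_seedOf ℓ).comp (((hτ.mul hu.ennreal_ofReal).min
    (hE.div hc).ennreal_ofReal).prodMk hh)

variable [DecidableEq X]

theorem measurable_update_fun {c : α → X → ℝ} {v : α → ℝ} (hc : Measurable c) (hv : Measurable v)
    (y : X) : Measurable fun a => Function.update (c a) y (v a) :=
  (measurable_update_pair y).comp (hc.prodMk hv)

theorem measurableState_evictState (ℓ : ℝ) {τ : α → ℝ≥0∞} (A : Finset X) {c h : α → X → ℝ}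
    {η : α → X → ℝ × ℝ} (hτ : Measurable τ) (hc : Measurable c) (hh : Measurable h)
    (hη : Measurable η) : MeasurableState fun a => evictState ℓ (τ a) A (c a) (h a) (η a) := by
  have hcz : ∀ z, Measurable fun a => c a z := fun z => (measurable_pi_apply z).comp hc
  have hhz : ∀ z, Measurable fun a => h a z := fun z => (measurable_pi_apply z).comp hh
  have hηz : ∀ z, Measurable fun a => η a z := fun z => (measurable_pi_apply z).comp hη
  have hZ : ∀ z, Measurable fun a => redrawnSeed ℓ (τ a) (c a z) (h a z) (η a z).1 (η a z).2 :=
    fun z => measurable_redrawnSeed ℓ hτ (hcz z) (hhz z) (hηz z).fst (hηz z).snd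
  have hb : ∀ z, Measurable fun a => ENNReal.ofReal (h a z / ℓ) := fun z =>
    ((hhz z).div_const ℓ).ennreal_ofReal
  unfold evictState
  apply measurableState_ite (measurableSet_lt measurable_const (hτ.mul_const _))
  · refine measurableState_fiberwise
      (κ := fun a => argmaxKey A (fun z => redrawnSeed ℓ (τ a) (c a z) (h a z) (η a z).1 (η a z).2))
      (f := fun o a => match o with
        | none => (τ a, A, c a)
        | some y => (redrawnSeed ℓ (τ a) (c a y) (h a y) (η a y).1 (η a y).2, A.erase y, fun z =>
            if z ∈ A.erase y then
              if rate ℓ (redrawnSeed ℓ (τ a) (c a y) (h a y) (η a y).1 (η a y).2) / τ a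
                < ENNReal.ofReal (η a z).1
              then c a z - (η a z).2 *
                invRate ℓ (redrawnSeed ℓ (τ a) (c a y) (h a y) (η a y).1 (η a y).2) else c a z
            else 0))
      (fun o => measurableSet_argmaxKey A hZ o)
      (fun a => argmax_mem_image A.toList _) ?_
    intro o
    cases o with
    | none => exact measurableState_mk hτ hc A
    | some y =>
      refine measurableState_mk (hZ y) ?_ (A.erase y)
      rw [measurable_pi_iff]
      intro z
      by_cases hz : z ∈ A.erase y
      · simp only [hz, if_true]
        refine Measurable.ite (measurableSet_lt ?_ (hηz z).fst.ennreal_ofReal) ?_ (hcz z)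
        · exact (measurable_const.max (hZ y)).div hτ
        · exact (hcz z).sub ((hηz z).snd.mul ((measurable_invRate ℓ).comp (hZ y)))
      · simp only [hz, if_false]; exact measurable_const
  · refine measurableState_fiberwise
      (κ := fun a => argmaxKey A (fun z => ENNReal.ofReal (h a z / ℓ)))
      (f := fun o a => match o with
        | none => (τ a, A, c a)
        | some y => (ENNReal.ofReal (h a y / ℓ), A.erase y,
            fun z => if z ∈ A.erase y then c a z else 0))
      (fun o => measurableSet_argmaxKey A hb o)
      (fun a => argmax_mem_image A.toList _) ?_
    intro o
    cases o with
    | none => exact measurableState_mk hτ hc A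
    | some y =>
      refine measurableState_mk (hb y) ?_ (A.erase y)
      rw [measurable_pi_iff]
      intro z
      by_cases hz : z ∈ A.erase y
      · simp only [hz, if_true]; exact hcz z
      · simp only [hz, if_false]; exact measurable_const

theorem measurableState_stepState (k : ℕ) (ℓ : ℝ) (y : X) (w : ℝ)
    {s : α → ℝ≥0∞ × Finset X × (X → ℝ)} (hs : MeasurableState s) {h : α → X → ℝ} {e₀ : α → ℝ}
    {η : α → X → ℝ × ℝ} (hh : Measurable h) (he : Measurable e₀) (hη : Measurable η) :
    MeasurableState fun a => stepState k ℓ y w (s a) (h a) (e₀ a) (η a) := by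
  obtain ⟨F, hF⟩ := hs.finite
  refine measurableState_fiberwise (κ := fun a => (s a).2.1)
    (f := fun S a => stepState k ℓ y w ((s a).1, S, (s a).2.2) (h a) (e₀ a) (η a)) hs.keys hF ?_
  intro S
  have hτ := hs.threshold
  have hc := hs.counts
  have hq : Measurable fun a => e₀ a * invRate ℓ (s a).1 :=
    he.mul ((measurable_invRate ℓ).comp hτ)
  have hτℓ : Measurable fun a => (s a).1 * ENNReal.ofReal ℓ := hτ.mul_const _
  unfold stepState
  by_cases hy : y ∈ S
  · simp only [hy, if_true]
    exact measurableState_mk hτ (measurable_update_fun hc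
      (((measurable_pi_apply y).comp hc).add_const w) y) S
  · simp only [hy, if_false]
    apply measurableState_ite
    · refine measurableSet_and (measurableSet_lt hq measurable_const) ?_
      refine (measurableSet_lt measurable_const hτℓ).union (measurableSet_and
        (measurableSet_le hτℓ measurable_const) (measurableSet_lt ?_ hτ))
      exact (((measurable_pi_apply y).comp hh).div_const ℓ).ennreal_ofReal
    · have hu := measurable_update_fun hc (hq.const_sub w) y
      split_ifs
      · exact measurableState_evictState ℓ (insert y S) hτ hu hh hη
      · exact measurableState_mk hτ hu _
    · exact measurableState_mk hτ hc S

end Measurability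

/-! ### The eviction redraw preserves the law of its outcome -/

section Redraw

/-- Two partially defined maps with the same law where they are defined. -/
theorem map_ite_eq_of_lintegral_eq {α γ : Type*} [MeasurableSpace α] [MeasurableSpace γ]
    {μ : Measure α} [IsProbabilityMeasure μ] {p₁ p₂ : α → Prop} [DecidablePred p₁]
    [DecidablePred p₂] (hp₁ : MeasurableSet {a | p₁ a}) (hp₂ : MeasurableSet {a | p₂ a})
    {f₁ f₂ : α → γ} (hf₁ : Measurable f₁) (hf₂ : Measurable f₂)
    (h : ∀ φ : γ → ℝ≥0∞, Measurable φ →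
      ∫⁻ a, (if p₁ a then φ (f₁ a) else 0) ∂μ = ∫⁻ a, (if p₂ a then φ (f₂ a) else 0) ∂μ) (c : γ) :
    μ.map (fun a => if p₁ a then f₁ a else c) = μ.map (fun a => if p₂ a then f₂ a else c) := by
  have hone : μ {a | p₁ a} = μ {a | p₂ a} := by
    have := h (fun _ => 1) measurable_const
    rw [← lintegral_indicator_one hp₁, ← lintegral_indicator_one hp₂]
    simpa only [Set.indicator_apply, Set.mem_ofPred_eq, Pi.one_apply] using this
  have hcompl : μ {a | p₁ a}ᶜ = μ {a | p₂ a}ᶜ := by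
    rw [prob_compl_eq_one_sub hp₁, prob_compl_eq_one_sub hp₂, hone]
  have key : ∀ (p : α → Prop) [DecidablePred p] (hp : MeasurableSet {a | p a}) (f : α → γ)
      (_ : Measurable f) (B : Set γ) (_ : MeasurableSet B),
      μ.map (fun a => if p a then f a else c) B =
        ∫⁻ a, (if p a then B.indicator (fun _ => 1) (f a) else 0) ∂μ +
          μ {a | p a}ᶜ * B.indicator (fun _ => 1) c := by
    intro p _ hp f hf B hB
    have h2 : ∫⁻ a, ({a | p a}ᶜ).indicator (fun _ => B.indicator (fun _ => (1 : ℝ≥0∞)) c) a ∂μ =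
        μ {a | p a}ᶜ * B.indicator (fun _ => 1) c := by
      rw [lintegral_indicator_const hp.compl, mul_comm]
    rw [← h2, ← lintegral_add_right _ (measurable_const.indicator hp.compl),
      ← lintegral_indicator_one hB, lintegral_map (measurable_one.indicator hB)
        (Measurable.ite hp hf measurable_const)]
    apply lintegral_congr
    intro a
    by_cases hpa : p a
    · simp [hpa]; rfl
    · simp [hpa]; rfl
  ext B hB
  rw [key p₁ hp₁ f₁ hf₁ B hB, key p₂ hp₂ f₂ hf₂ B hB, hcompl,
    h _ (measurable_const.indicator hB)]

/-- The joint law of the hash, the arrival variable and the eviction draws of a key. -/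
noncomputable def keyLaw : Measure ((ℝ × ℝ) × ℝ × ℝ) := pairLaw.prod pairLaw

instance : IsProbabilityMeasure keyLaw := by unfold keyLaw; infer_instance

/-- The seed drawn by the eviction step. -/
noncomputable def seedDrawn (ℓ : ℝ) (t : ℝ≥0∞) (ω : ℝ) (v : (ℝ × ℝ) × ℝ × ℝ) : ℝ≥0∞ :=
  redrawnSeed ℓ t (ω - v.1.2 * invRate ℓ t) v.1.1 v.2.1 v.2.2

/-- The seed given by the arrival variable. -/
noncomputable def seedArrival (ℓ : ℝ) (ω : ℝ) (v : (ℝ × ℝ) × ℝ × ℝ) : ℝ≥0∞ :=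
  seedOf ℓ (arrival ω v.1.2) v.1.1

/-- The counter after the threshold is lowered from `t` to `τ` by the eviction step. -/
noncomputable def counterLowered (ℓ : ℝ) (t : ℝ≥0∞) (ω : ℝ) (τ : ℝ≥0∞) (v : (ℝ × ℝ) × ℝ × ℝ) : ℝ :=
  if rate ℓ τ / t < ENNReal.ofReal v.2.1
  then ω - v.1.2 * invRate ℓ t - v.2.2 * invRate ℓ τ else ω - v.1.2 * invRate ℓ t

/-- The counter at threshold `τ` given by the arrival variable. -/
noncomputable def counterArrival (ℓ : ℝ) (ω : ℝ) (τ : ℝ≥0∞) (v : (ℝ × ℝ) × ℝ × ℝ) : ℝ :=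
  ω - v.1.2 * invRate ℓ τ

theorem measurable_seedDrawn (ℓ : ℝ) (t : ℝ≥0∞) (ω : ℝ) : Measurable (seedDrawn ℓ t ω) := by
  unfold seedDrawn
  exact measurable_redrawnSeed ℓ measurable_const (by fun_prop) (by fun_prop) (by fun_prop)
    (by fun_prop)

theorem measurable_seedArrival (ℓ : ℝ) (ω : ℝ) : Measurable (seedArrival ℓ ω) :=
  (measurable_seedOf ℓ).comp (((measurable_arrival ω).comp (by fun_prop)).prodMk (by fun_prop))

theorem measurable_counterLowered (ℓ : ℝ) (t : ℝ≥0∞) (ω : ℝ) :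
    Measurable fun p : ℝ≥0∞ × (ℝ × ℝ) × ℝ × ℝ => counterLowered ℓ t ω p.1 p.2 := by
  unfold counterLowered
  have h := measurable_invRate ℓ
  refine Measurable.ite (measurableSet_lt ?_ (by fun_prop)) ?_ (by fun_prop)
  · unfold rate; fun_prop
  · fun_prop

theorem measurable_counterArrival (ℓ : ℝ) (ω : ℝ) :
    Measurable fun p : ℝ≥0∞ × (ℝ × ℝ) × ℝ × ℝ => counterArrival ℓ ω p.1 p.2 := by
  unfold counterArrival
  have h := measurable_invRate ℓ
  fun_prop

theorem invRate_nonneg (ℓ : ℝ) (τ : ℝ≥0∞) : 0 ≤ invRate ℓ τ := ENNReal.toReal_nonneg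

theorem ae_keyLaw_not_lt {ℓ : ℝ} {t : ℝ≥0∞} {ω : ℝ} (hω : ω ≤ 0) :
    ∀ᵐ v ∂keyLaw, ¬ v.1.2 * invRate ℓ t < ω := by
  have g1 : ∀ᵐ v ∂keyLaw, 0 < v.1.1 ∧ v.1.1 < 1 ∧ 0 < v.1.2 :=
    Measure.quasiMeasurePreserving_fst.ae ae_pairLaw
  filter_upwards [g1] with v h
  have := mul_nonneg h.2.2.le (invRate_nonneg ℓ t)
  linarith

theorem lintegral_counterLowered {ℓ : ℝ} (hℓ : 0 < ℓ) {t : ℝ≥0∞} (ω : ℝ)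
    (ht : ENNReal.ofReal (1 / ℓ) < t) {τ : ℝ≥0∞} (hτt : τ ≤ t) (hτ : τ ≠ ⊤)
    {φ : ℝ × ℝ → ℝ≥0∞} (hφ : Measurable φ) :
    ∫⁻ v, (if v.1.2 * invRate ℓ t < ω ∧ seedDrawn ℓ t ω v < τ
      then φ (v.1.1, counterLowered ℓ t ω τ v) else 0) ∂keyLaw =
    ∫⁻ v, (if v.1.2 * invRate ℓ t < ω ∧ seedArrival ℓ ω v < τ
      then φ (v.1.1, counterArrival ℓ ω τ v) else 0) ∂keyLaw := by
  rcases lt_or_ge 0 ω with hω | hω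
  · exact lintegral_lowering hℓ hω ht hτt hτ hφ
  · apply lintegral_congr_ae
    filter_upwards [ae_keyLaw_not_lt (ℓ := ℓ) (t := t) hω] with v h
    simp [h, -not_lt]

theorem lintegral_seedDrawn {ℓ : ℝ} {t : ℝ≥0∞} (ω : ℝ) (ht : ENNReal.ofReal (1 / ℓ) < t)
    {ψ : ℝ × ℝ≥0∞ → ℝ≥0∞} (hψ : Measurable ψ) :
    ∫⁻ v, (if v.1.2 * invRate ℓ t < ω then ψ (v.1.1, seedDrawn ℓ t ω v) else 0) ∂keyLaw =
    ∫⁻ v, (if v.1.2 * invRate ℓ t < ω then ψ (v.1.1, seedArrival ℓ ω v) else 0) ∂keyLaw := by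
  rcases lt_or_ge 0 ω with hω | hω
  · exact lintegral_redraw hω ht hψ
  · apply lintegral_congr_ae
    filter_upwards [ae_keyLaw_not_lt (ℓ := ℓ) (t := t) hω] with v h
    simp [h, -not_lt]

/-- The seed is either `h/ℓ` or `e/ω`, and neither variable has atoms. -/
theorem ae_seedOf_ne {ℓ ω : ℝ} (hℓ : 0 < ℓ) (hω : 0 < ω) (c : ℝ≥0∞) :
    ∀ᵐ a ∂pairLaw, seedOf ℓ (arrival ω a.2) a.1 ≠ c := by
  have h1 : ∀ᵐ a ∂pairLaw, a.1 ≠ ℓ * c.toReal :=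
    Measure.quasiMeasurePreserving_fst.ae
      (by simp [ae_iff, measure_singleton] : ∀ᵐ u ∂unifLaw, u ≠ ℓ * c.toReal)
  have h2 : ∀ᵐ a ∂pairLaw, a.2 ≠ ω * c.toReal :=
    Measure.quasiMeasurePreserving_snd.ae
      (by simp [ae_iff, measure_singleton] : ∀ᵐ u ∂stdExp, u ≠ ω * c.toReal)
  filter_upwards [h1, h2, ae_pairLaw] with a h1 h2 h3 hc
  unfold seedOf at hc
  split_ifs at hc
  · apply h1
    rw [← hc, ENNReal.toReal_ofReal (div_nonneg h3.1.le hℓ.le)]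
    field_simp
  · apply h2
    rw [← hc, arrival_of_pos hω, ENNReal.toReal_ofReal (div_nonneg h3.2.2.le hω.le)]
    field_simp

theorem seedDrawn_ne_top (ℓ : ℝ) (t : ℝ≥0∞) (ω : ℝ) (v : (ℝ × ℝ) × ℝ × ℝ) :
    seedDrawn ℓ t ω v ≠ ⊤ := by
  unfold seedDrawn redrawnSeed seedOf
  split_ifs
  · exact ENNReal.ofReal_ne_top
  · exact ((min_le_right _ _).trans_lt ENNReal.ofReal_lt_top).ne

theorem seedDrawn_le {ℓ : ℝ} (hℓ : 0 < ℓ) {t : ℝ≥0∞} (ht : ENNReal.ofReal (1 / ℓ) < t) (ω : ℝ)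
    {v : (ℝ × ℝ) × ℝ × ℝ} (h1 : v.1.1 ≤ 1) (h2 : v.2.1 ≤ 1) : seedDrawn ℓ t ω v ≤ t := by
  unfold seedDrawn redrawnSeed seedOf
  split_ifs
  · exact (ofReal_div_le hℓ h1).trans ht.le
  · refine (min_le_left _ _).trans ?_
    calc t * ENNReal.ofReal v.2.1 ≤ t * 1 := by gcongr; rwa [ENNReal.ofReal_le_one]
      _ = t := mul_one t

variable {X : Type*} [DecidableEq X]

/-- Contribution to the eviction step of the outcome that `y₀` has the largest seed. -/
noncomputable def evictTerm (A : Finset X) (q : ℝ) (ω : X → ℝ) (h₀ : X → ℝ)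
    (g : Finset X → ℝ≥0∞ × (X → ℝ) × (X → ℝ) → ℝ≥0∞)
    (Z : X → (ℝ × ℝ) × ℝ × ℝ → ℝ≥0∞) (c : X → ℝ≥0∞ → (ℝ × ℝ) × ℝ × ℝ → ℝ) (y₀ : X)
    (κ : X → (ℝ × ℝ) × ℝ × ℝ) : ℝ≥0∞ :=
  if (∀ z ∈ A, (κ z).1.2 * q < ω z) ∧ ∀ z ∈ A.erase y₀, Z z (κ z) < Z y₀ (κ y₀) then
    g (A.erase y₀) (Z y₀ (κ y₀), fun z => if z ∈ A.erase y₀ then c z (Z y₀ (κ y₀)) (κ z) else 0,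
      fun z => if z ∈ A then (κ z).1.1 else h₀ z) else 0

/-- The conditional contribution of the other keys, given the seed `τ` and the hash `h` of `y₀`. -/
noncomputable def evictRest (A : Finset X) (q : ℝ) (ω : X → ℝ) (h₀ : X → ℝ)
    (g : Finset X → ℝ≥0∞ × (X → ℝ) × (X → ℝ) → ℝ≥0∞)
    (Z : X → (ℝ × ℝ) × ℝ × ℝ → ℝ≥0∞) (c : X → ℝ≥0∞ → (ℝ × ℝ) × ℝ × ℝ → ℝ) (y₀ : X)
    (τ : ℝ≥0∞) (h : ℝ) (κ : X → (ℝ × ℝ) × ℝ × ℝ) : ℝ≥0∞ :=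
  if ∀ z ∈ A.erase y₀, (κ z).1.2 * q < ω z ∧ Z z (κ z) < τ then
    g (A.erase y₀) (τ, fun z => if z ∈ A.erase y₀ then c z τ (κ z) else 0,
      fun z => if z = y₀ then h else if z ∈ A then (κ z).1.1 else h₀ z) else 0

omit [DecidableEq X] in
theorem measurableSet_forall_mem {α : Type*} [MeasurableSpace α] (A : Finset X)
    {p : X → α → Prop} (hp : ∀ z ∈ A, MeasurableSet {a | p z a}) :
    MeasurableSet {a | ∀ z ∈ A, p z a} := by
  have : {a | ∀ z ∈ A, p z a} = ⋂ z ∈ A, {a | p z a} := by ext; simp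
  rw [this]
  exact Finset.measurableSet_biInter A hp

omit [DecidableEq X] in
theorem measurable_ite_fun {α : Type*} [MeasurableSpace α] {p : X → Prop} [DecidablePred p]
    {f f' : α → X → ℝ} (hf : ∀ z, Measurable fun a => f a z)
    (hf' : ∀ z, Measurable fun a => f' a z) :
    Measurable fun a z => if p z then f a z else f' a z := by
  rw [measurable_pi_iff]
  intro z
  by_cases h : p z <;> simp [h, hf, hf']

section Generic

variable (A : Finset X) (q : ℝ) (ω : X → ℝ) (h₀ : X → ℝ)
    {g : Finset X → ℝ≥0∞ × (X → ℝ) × (X → ℝ) → ℝ≥0∞} (hg : ∀ S, Measurable (g S))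
    {Z : X → (ℝ × ℝ) × ℝ × ℝ → ℝ≥0∞} (hZ : ∀ z, Measurable (Z z))
    {c : X → ℝ≥0∞ → (ℝ × ℝ) × ℝ × ℝ → ℝ}
    (hc : ∀ z, Measurable fun p : ℝ≥0∞ × (ℝ × ℝ) × ℝ × ℝ => c z p.1 p.2)

include hg hZ hc

theorem measurable_evictTerm (y₀ : X) : Measurable (evictTerm A q ω h₀ g Z c y₀) := by
  unfold evictTerm
  have hZy : ∀ z, Measurable fun κ : X → (ℝ × ℝ) × ℝ × ℝ => Z z (κ z) := fun z =>
    (hZ z).comp (measurable_pi_apply z)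
  refine Measurable.ite (measurableSet_and (measurableSet_forall_mem A fun z _ =>
    measurableSet_lt (by fun_prop) measurable_const) (measurableSet_forall_mem _ fun z _ =>
    measurableSet_lt (hZy z) (hZy y₀))) ?_ measurable_const
  refine (hg _).comp ((hZy y₀).prodMk ((measurable_ite_fun (fun z => ?_) fun _ =>
    measurable_const).prodMk (measurable_ite_fun (fun z => by fun_prop) fun _ => measurable_const)))
  exact (hc z).comp ((hZy y₀).prodMk (measurable_pi_apply z))

theorem measurable_evictRest (y₀ : X) : Measurable
    fun p : (ℝ≥0∞ × ℝ) × (X → (ℝ × ℝ) × ℝ × ℝ) =>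
      evictRest A q ω h₀ g Z c y₀ p.1.1 p.1.2 p.2 := by
  unfold evictRest
  refine Measurable.ite (measurableSet_forall_mem _ fun z _ => measurableSet_and
    (measurableSet_lt (by fun_prop) measurable_const)
    (measurableSet_lt ((hZ z).comp (by fun_prop)) (by fun_prop))) ?_ measurable_const
  refine (hg _).comp ((by fun_prop : Measurable fun p : (ℝ≥0∞ × ℝ) × (X → (ℝ × ℝ) × ℝ × ℝ) =>
    p.1.1).prodMk ((measurable_ite_fun (fun z => ?_) fun _ => measurable_const).prodMk
    (measurable_ite_fun (fun z => by fun_prop) fun z => ?_)))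
  · exact (hc z).comp (by fun_prop :
      Measurable fun p : (ℝ≥0∞ × ℝ) × (X → (ℝ × ℝ) × ℝ × ℝ) => (p.1.1, p.2 z))
  · by_cases hz : z ∈ A <;> simp only [hz, if_true, if_false] <;> fun_prop

/-- The outer integral runs over the variables of the evicted key `y₀`. Given them, the threshold
`τ` is a constant, and the other keys are independent and interact only through `τ`. -/
theorem lintegral_evictTerm {y₀ : X} (hy₀ : y₀ ∈ A) :
    ∫⁻ κ, evictTerm A q ω h₀ g Z c y₀ κ ∂(Measure.infinitePi fun _ : X => keyLaw) =
    ∫⁻ v, (if v.1.2 * q < ω y₀ then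
      ∫⁻ κ, evictRest A q ω h₀ g Z c y₀ (Z y₀ v) v.1.1 κ ∂(Measure.infinitePi fun _ : X => keyLaw)
      else 0) ∂keyLaw := by
  have hm := measurable_evictTerm A q ω h₀ hg hZ hc y₀
  rw [lintegral_infinitePi_update _ y₀ hm, lintegral_lintegral_swap
    (f := fun κ v => evictTerm A q ω h₀ g Z c y₀ (Function.update κ y₀ v))
    (hm.comp (measurable_update_pair y₀)).aemeasurable]
  apply lintegral_congr
  intro v
  have key : ∀ κ, evictTerm A q ω h₀ g Z c y₀ (Function.update κ y₀ v) =
      if v.1.2 * q < ω y₀ then evictRest A q ω h₀ g Z c y₀ (Z y₀ v) v.1.1 κ else 0 := by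
    intro κ
    have hne : ∀ z ∈ A.erase y₀, Function.update κ y₀ v z = κ z := fun z hz =>
      Function.update_of_ne (Finset.ne_of_mem_erase hz) _ _
    have hcond : ((∀ z ∈ A, (Function.update κ y₀ v z).1.2 * q < ω z) ∧
        ∀ z ∈ A.erase y₀, Z z (Function.update κ y₀ v z) < Z y₀ (Function.update κ y₀ v y₀)) ↔
        v.1.2 * q < ω y₀ ∧ ∀ z ∈ A.erase y₀, (κ z).1.2 * q < ω z ∧ Z z (κ z) < Z y₀ v := by
      rw [Function.update_self]
      constructor
      · rintro ⟨h1, h2⟩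
        refine ⟨by simpa using h1 y₀ hy₀, fun z hz => ?_⟩
        have h3 := h1 z (Finset.mem_of_mem_erase hz)
        have h4 := h2 z hz
        rw [hne z hz] at h3 h4
        exact ⟨h3, h4⟩
      · rintro ⟨h1, h2⟩
        refine ⟨fun z hz => ?_, fun z hz => by rw [hne z hz]; exact (h2 z hz).2⟩
        by_cases hzy : z = y₀
        · subst hzy; simpa using h1
        · have := Finset.mem_erase.2 ⟨hzy, hz⟩
          rw [hne z this]; exact (h2 z this).1
    unfold evictTerm evictRest
    simp only [hcond]
    rw [← ite_and]
    congr 2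
    · rw [Function.update_self]
      congr 2
      · ext z
        by_cases hz : z ∈ A.erase y₀
        · simp only [hz, if_true, hne z hz]
        · simp only [hz, if_false]
      · ext z
        by_cases hzy : z = y₀
        · subst hzy; simp [hy₀]
        · simp [hzy]
  simp_rw [key]
  split_ifs <;> simp

end Generic

/-- At a fixed threshold the survival conditions factorize over the keys, so the single-key identity
`lintegral_counterLowered` applies to each coordinate of the product law. -/
theorem lintegral_evictRest_eq {ℓ : ℝ} (hℓ : 0 < ℓ) {t : ℝ≥0∞} (ht : ENNReal.ofReal (1 / ℓ) < t)
    (A : Finset X) (ω : X → ℝ) (h₀ : X → ℝ)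
    {g : Finset X → ℝ≥0∞ × (X → ℝ) × (X → ℝ) → ℝ≥0∞} (hg : ∀ S, Measurable (g S))
    (y₀ : X) {τ : ℝ≥0∞} (hτt : τ ≤ t) (hτ : τ ≠ ⊤) (h : ℝ) :
    ∫⁻ κ, evictRest A (invRate ℓ t) ω h₀ g (fun z => seedDrawn ℓ t (ω z))
      (fun z => counterLowered ℓ t (ω z)) y₀ τ h κ ∂(Measure.infinitePi fun _ : X => keyLaw) =
    ∫⁻ κ, evictRest A (invRate ℓ t) ω h₀ g (fun z => seedArrival ℓ (ω z))
      (fun z => counterArrival ℓ (ω z)) y₀ τ h κ ∂(Measure.infinitePi fun _ : X => keyLaw) := by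
  -- The first entry of `a z` is a flag, `1` for a survivor and `0` otherwise. The product of the
  -- flags is the indicator that all keys survive, so the default values never contribute.
  set Γ : (X → ℝ × ℝ × ℝ) → ℝ≥0∞ := fun a => (∏ z ∈ A.erase y₀, ENNReal.ofReal (a z).1) *
    g (A.erase y₀) (τ, fun z => if z ∈ A.erase y₀ then (a z).2.2 else 0,
      fun z => if z = y₀ then h else if z ∈ A then (a z).2.1 else h₀ z) with hΓ
  have hΓm : Measurable Γ := by
    refine Measurable.mul (by fun_prop) ((hg _).comp (measurable_const.prodMk
      ((measurable_ite_fun (fun z => by fun_prop) fun _ => measurable_const).prodMk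
      (measurable_ite_fun (fun z => measurable_const) fun z => ?_))))
    by_cases hz : z ∈ A <;> simp only [hz, if_true, if_false] <;> fun_prop
  have key : ∀ (Z : X → (ℝ × ℝ) × ℝ × ℝ → ℝ≥0∞) (c : X → ℝ≥0∞ → (ℝ × ℝ) × ℝ × ℝ → ℝ)
      (_ : ∀ z, Measurable (Z z)) (_ : ∀ z, Measurable (c z τ)),
      ∫⁻ κ, evictRest A (invRate ℓ t) ω h₀ g Z c y₀ τ h κ
        ∂(Measure.infinitePi fun _ : X => keyLaw) =
      ∫⁻ a, Γ a ∂(Measure.infinitePi fun z : X => keyLaw.map (fun v =>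
        if v.1.2 * invRate ℓ t < ω z ∧ Z z v < τ then ((1 : ℝ), v.1.1, c z τ v) else 0)) := by
    intro Z c hZ hc
    have hΦ : ∀ z, Measurable fun v : (ℝ × ℝ) × ℝ × ℝ =>
        if v.1.2 * invRate ℓ t < ω z ∧ Z z v < τ then ((1 : ℝ), v.1.1, c z τ v) else 0 := by
      intro z
      have hZz := hZ z
      have hcz := hc z
      exact Measurable.ite (measurableSet_and (measurableSet_lt (by fun_prop) measurable_const)
        (measurableSet_lt (hZ z) measurable_const)) (by fun_prop) measurable_const
    have hΦ' : Measurable fun (κ : X → (ℝ × ℝ) × ℝ × ℝ) z =>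
        if (κ z).1.2 * invRate ℓ t < ω z ∧ Z z (κ z) < τ then ((1 : ℝ), (κ z).1.1, c z τ (κ z))
        else 0 := measurable_pi_iff.2 fun z => (hΦ z).comp (measurable_pi_apply z)
    rw [← Measure.infinitePi_map_pi _ hΦ, lintegral_map hΓm hΦ']
    apply lintegral_congr
    intro κ
    unfold evictRest
    split_ifs with hcond
    · simp only [hΓ]
      rw [Finset.prod_eq_one fun z hz => by simp [hcond z hz], one_mul]
      congr 3
      · ext z
        by_cases hz : z ∈ A.erase y₀
        · simp only [hz, if_true, if_pos (hcond z hz)]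
        · simp only [hz, if_false]
      · ext z
        by_cases hzy : z = y₀
        · simp [hzy]
        · by_cases hz : z ∈ A
          · simp only [hzy, if_false, hz, if_true,
              if_pos (hcond z (Finset.mem_erase.2 ⟨hzy, hz⟩))]
          · simp only [hzy, if_false, hz]
    · push Not at hcond
      obtain ⟨z, hz, hcond⟩ := hcond
      symm
      simp only [hΓ, mul_eq_zero]
      left
      apply Finset.prod_eq_zero hz
      rw [if_neg (by rintro ⟨h1, h2⟩; exact absurd h2 (not_lt.2 (hcond h1)))]
      simp
  have hZ₁ : ∀ z, Measurable (seedDrawn ℓ t (ω z)) := fun z => measurable_seedDrawn ℓ t (ω z)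
  have hZ₂ : ∀ z, Measurable (seedArrival ℓ (ω z)) := fun z => measurable_seedArrival ℓ (ω z)
  have hc₁ : ∀ z, Measurable (counterLowered ℓ t (ω z) τ) := fun z =>
    (measurable_counterLowered ℓ t (ω z)).comp (measurable_const.prodMk measurable_id)
  have hc₂ : ∀ z, Measurable (counterArrival ℓ (ω z) τ) := fun z =>
    (measurable_counterArrival ℓ (ω z)).comp (measurable_const.prodMk measurable_id)
  rw [key _ _ hZ₁ hc₁, key _ _ hZ₂ hc₂]
  congr 2
  ext1 z
  have hc₁z := hc₁ z
  have hc₂z := hc₂ z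
  apply map_ite_eq_of_lintegral_eq
  · exact measurableSet_and (measurableSet_lt (by fun_prop) measurable_const)
      (measurableSet_lt (hZ₁ z) measurable_const)
  · exact measurableSet_and (measurableSet_lt (by fun_prop) measurable_const)
      (measurableSet_lt (hZ₂ z) measurable_const)
  · fun_prop
  · fun_prop
  · intro φ hφ
    exact lintegral_counterLowered hℓ (ω z) ht hτt hτ (φ := fun a => φ (1, a.1, a.2)) (by fun_prop)

/-- The outcome of the eviction step that evicts `y₀` has the same law for the redrawn seeds and
for the seeds given by the arrival variables. -/
theorem lintegral_evictTerm_eq {ℓ : ℝ} (hℓ : 0 < ℓ) {t : ℝ≥0∞} (ht : ENNReal.ofReal (1 / ℓ) < t)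
    (A : Finset X) (ω : X → ℝ) (h₀ : X → ℝ)
    {g : Finset X → ℝ≥0∞ × (X → ℝ) × (X → ℝ) → ℝ≥0∞} (hg : ∀ S, Measurable (g S))
    {y₀ : X} (hy₀ : y₀ ∈ A) :
    ∫⁻ κ, evictTerm A (invRate ℓ t) ω h₀ g (fun z => seedDrawn ℓ t (ω z))
      (fun z => counterLowered ℓ t (ω z)) y₀ κ ∂(Measure.infinitePi fun _ : X => keyLaw) =
    ∫⁻ κ, evictTerm A (invRate ℓ t) ω h₀ g (fun z => seedArrival ℓ (ω z))
      (fun z => counterArrival ℓ (ω z)) y₀ κ ∂(Measure.infinitePi fun _ : X => keyLaw) := by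
  have hZ₁ : ∀ z, Measurable (seedDrawn ℓ t (ω z)) := fun z => measurable_seedDrawn ℓ t (ω z)
  have hZ₂ : ∀ z, Measurable (seedArrival ℓ (ω z)) := fun z => measurable_seedArrival ℓ (ω z)
  have hc₁ : ∀ z, Measurable _ := fun z => measurable_counterLowered ℓ t (ω z)
  have hc₂ : ∀ z, Measurable _ := fun z => measurable_counterArrival ℓ (ω z)
  rw [lintegral_evictTerm A _ ω h₀ hg hZ₁ hc₁ hy₀, lintegral_evictTerm A _ ω h₀ hg hZ₂ hc₂ hy₀]
  have hR := (measurable_evictRest A (invRate ℓ t) ω h₀ hg hZ₂ hc₂ y₀).lintegral_prod_right'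
    (ν := Measure.infinitePi fun _ : X => keyLaw)
  -- Two replacements are made. The integrated rest depends on `y₀` only through its hash and seed,
  -- whose joint law is unchanged by the redraw. The rest itself is then replaced at the drawn
  -- threshold, which is finite and at most `t`.
  have h2 := lintegral_seedDrawn (ω y₀) ht (hR.comp measurable_swap)
  simp only [Function.comp, Prod.swap] at h2
  rw [← h2]
  have g1 : ∀ᵐ v ∂keyLaw, 0 < v.1.1 ∧ v.1.1 < 1 ∧ 0 < v.1.2 :=
    Measure.quasiMeasurePreserving_fst.ae ae_pairLaw
  have g2 : ∀ᵐ v ∂keyLaw, 0 < v.2.1 ∧ v.2.1 < 1 ∧ 0 < v.2.2 :=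
    Measure.quasiMeasurePreserving_snd.ae ae_pairLaw
  apply lintegral_congr_ae
  filter_upwards [g1, g2] with v g1 g2
  rw [lintegral_evictRest_eq hℓ ht A ω h₀ hg y₀ (seedDrawn_le hℓ ht (ω y₀) g1.2.1.le g2.2.1.le)
    (seedDrawn_ne_top ℓ t (ω y₀) v)]

/-- With the variables of `b` fixed, the redrawn seed of `a`, where its counter is positive, has the
law of its original seed, which charges no single value. -/
theorem ae_seedDrawn_ne {ℓ : ℝ} (hℓ : 0 < ℓ) {t : ℝ≥0∞} (ht : ENNReal.ofReal (1 / ℓ) < t)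
    (ω : X → ℝ) {a b : X} (hab : a ≠ b) :
    ∀ᵐ κ ∂(Measure.infinitePi fun _ : X => keyLaw), (κ a).1.2 * invRate ℓ t < ω a →
      seedDrawn ℓ t (ω a) (κ a) ≠ seedDrawn ℓ t (ω b) (κ b) := by
  have hZ : ∀ z, Measurable (seedDrawn ℓ t (ω z)) := fun z => measurable_seedDrawn ℓ t (ω z)
  have hm : MeasurableSet {κ : X → (ℝ × ℝ) × ℝ × ℝ | (κ a).1.2 * invRate ℓ t < ω a ∧
      seedDrawn ℓ t (ω a) (κ a) = seedDrawn ℓ t (ω b) (κ b)} :=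
    measurableSet_and (measurableSet_lt (by fun_prop) measurable_const)
      (measurableSet_eq_fun ((hZ a).comp (measurable_pi_apply a))
        ((hZ b).comp (measurable_pi_apply b)))
  have h0 : (Measure.infinitePi fun _ : X => keyLaw) {κ : X → (ℝ × ℝ) × ℝ × ℝ |
      (κ a).1.2 * invRate ℓ t < ω a ∧
      seedDrawn ℓ t (ω a) (κ a) = seedDrawn ℓ t (ω b) (κ b)} = 0 := by
    rw [← lintegral_indicator_one hm, lintegral_infinitePi_update _ a (measurable_one.indicator hm)]
    have : ∀ κ : X → (ℝ × ℝ) × ℝ × ℝ, ∫⁻ v, Set.indicator {κ : X → (ℝ × ℝ) × ℝ × ℝ |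
        (κ a).1.2 * invRate ℓ t < ω a ∧ seedDrawn ℓ t (ω a) (κ a) = seedDrawn ℓ t (ω b) (κ b)}
        (1 : (X → (ℝ × ℝ) × ℝ × ℝ) → ℝ≥0∞) (Function.update κ a v) ∂keyLaw = 0 := by
      intro κ
      have h1 := lintegral_seedDrawn (ω a) ht
        (ψ := fun p => Set.indicator {seedDrawn ℓ t (ω b) (κ b)} (fun _ => 1) p.2)
        ((measurable_const.indicator (measurableSet_singleton _)).comp measurable_snd)
      have h2 : ∀ᵐ v ∂keyLaw, 0 < ω a →
          seedArrival ℓ (ω a) v ≠ seedDrawn ℓ t (ω b) (κ b) := by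
        by_cases hω : 0 < ω a
        · have := (Measure.quasiMeasurePreserving_fst (μ := pairLaw) (ν := pairLaw)).ae
            (ae_seedOf_ne hℓ hω (seedDrawn ℓ t (ω b) (κ b)))
          filter_upwards [this] with v hv _ using hv
        · exact ae_of_all _ fun v h => absurd h hω
      have h3 : ∫⁻ v, (if v.1.2 * invRate ℓ t < ω a then
          Set.indicator {seedDrawn ℓ t (ω b) (κ b)} (fun _ => (1 : ℝ≥0∞)) (seedArrival ℓ (ω a) v)
          else 0) ∂keyLaw = 0 := by
        rw [lintegral_eq_zero_iff']
        · have g1 : ∀ᵐ v ∂keyLaw, 0 < v.1.1 ∧ v.1.1 < 1 ∧ 0 < v.1.2 :=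
            Measure.quasiMeasurePreserving_fst.ae ae_pairLaw
          filter_upwards [h2, g1] with v h2 g1
          split_ifs with h
          · have : 0 < ω a := lt_of_le_of_lt (mul_nonneg g1.2.2.le (invRate_nonneg ℓ t)) h
            simp [h2 this]
          · rfl
        · exact (Measurable.ite (measurableSet_lt (by fun_prop) measurable_const)
            ((measurable_const.indicator (measurableSet_singleton _)).comp
              (measurable_seedArrival ℓ (ω a))) measurable_const).aemeasurable
      rw [← h1.trans h3]
      apply lintegral_congr
      intro v
      by_cases hv : v.1.2 * invRate ℓ t < ω a <;>
        simp [Set.indicator_apply, Function.update_of_ne hab.symm, hv, -not_lt]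
    simp [this]
  rw [ae_iff]
  exact measure_mono_null (fun κ hκ => (Classical.not_imp.1 hκ).imp id not_not.1) h0

theorem argmaxKey_eq_some {S : Finset X} {f : X → ℝ≥0∞} {y : X} (hy : y ∈ S)
    (h : ∀ z ∈ S.erase y, f z < f y) : argmaxKey S f = some y := by
  cases hc : argmaxKey S f with
  | none =>
    have : S.toList = [] := List.argmax_eq_none.1 hc
    rw [Finset.toList_eq_nil] at this
    simp [this] at hy
  | some c =>
    have h1 := List.le_of_mem_argmax (Finset.mem_toList.2 hy) hc
    by_contra hne
    have h2 : c ≠ y := fun h => hne (by rw [h])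
    exact absurd h1 (not_le.2 (h c (Finset.mem_erase.2 ⟨h2, argmaxKey_mem hc⟩)))

theorem exists_strict_max {S : Finset X} (hS : S.Nonempty) {f : X → ℝ≥0∞}
    (h : ∀ a ∈ S, ∀ b ∈ S, a ≠ b → f a ≠ f b) : ∃ y ∈ S, ∀ z ∈ S.erase y, f z < f y := by
  obtain ⟨y, hy, hmax⟩ := Finset.exists_max_image S f hS
  refine ⟨y, hy, fun z hz => ?_⟩
  rw [Finset.mem_erase] at hz
  exact lt_of_le_of_ne (hmax z hz.2) (h z hz.2 y hy hz.1)

/-- A sum over the possible strict maxima has a single nonzero term. -/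
theorem sum_strict_max {S : Finset X} {f : X → ℝ≥0∞} {y : X} (hy : y ∈ S)
    (h : ∀ z ∈ S.erase y, f z < f y) (F : X → ℝ≥0∞) :
    ∑ y' ∈ S, (if ∀ z ∈ S.erase y', f z < f y' then F y' else 0) = F y := by
  rw [Finset.sum_eq_single_of_mem y hy, if_pos h]
  intro b hb hby
  rw [if_neg]
  intro h2
  exact absurd (h b (Finset.mem_erase.2 ⟨hby, hb⟩))
    (not_lt.2 (h2 y (Finset.mem_erase.2 ⟨hby.symm, hy⟩)).le)

/-- The eviction step redraws the seeds of the cached keys without changing the law of its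
outcome. -/
theorem lintegral_evictState {ℓ : ℝ} (hℓ : 0 < ℓ) {t : ℝ≥0∞} (ht : ENNReal.ofReal (1 / ℓ) < t)
    {A : Finset X} (hA : A.Nonempty) (ω : X → ℝ) (h₀ : X → ℝ)
    {g : Finset X → ℝ≥0∞ × (X → ℝ) × (X → ℝ) → ℝ≥0∞} (hg : ∀ S, Measurable (g S))
    (s : (X → (ℝ × ℝ) × ℝ × ℝ) → ℝ≥0∞ × Finset X × (X → ℝ))
    (hs : ∀ κ, s κ = evictState ℓ t A (fun z => if z ∈ A then ω z - (κ z).1.2 * invRate ℓ t else 0)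
      (fun z => if z ∈ A then (κ z).1.1 else h₀ z) (fun z => (κ z).2)) :
    ∫⁻ κ, (if ∀ z ∈ A, (κ z).1.2 * invRate ℓ t < ω z then
      g (s κ).2.1 ((s κ).1, (s κ).2.2, fun z => if z ∈ A then (κ z).1.1 else h₀ z) else 0)
      ∂(Measure.infinitePi fun _ : X => keyLaw) =
    ∑ y₀ ∈ A, ∫⁻ κ, evictTerm A (invRate ℓ t) ω h₀ g (fun z => seedArrival ℓ (ω z))
      (fun z => counterArrival ℓ (ω z)) y₀ κ ∂(Measure.infinitePi fun _ : X => keyLaw) := by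
  rw [← Finset.sum_congr rfl fun y₀ hy₀ => lintegral_evictTerm_eq hℓ ht A ω h₀ hg hy₀,
    ← lintegral_finsetSum _ fun y₀ _ => measurable_evictTerm A _ ω h₀ hg
      (fun z => measurable_seedDrawn ℓ t (ω z)) (fun z => measurable_counterLowered ℓ t (ω z)) y₀]
  have hne : ∀ᵐ κ ∂(Measure.infinitePi fun _ : X => keyLaw), ∀ a ∈ A, ∀ b ∈ A, a ≠ b →
      (κ a).1.2 * invRate ℓ t < ω a →
      seedDrawn ℓ t (ω a) (κ a) ≠ seedDrawn ℓ t (ω b) (κ b) := by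
    simp only [Filter.eventually_all_finset]
    intro a _ b _
    by_cases hab : a = b
    · exact ae_of_all _ fun _ h => absurd hab h
    · filter_upwards [ae_seedDrawn_ne hℓ ht ω hab] with κ h _ using h
  have htℓ : 1 < t * ENNReal.ofReal ℓ := by
    have h1 : ENNReal.ofReal (1 / ℓ) * ENNReal.ofReal ℓ = 1 := by
      rw [← ENNReal.ofReal_mul (by positivity), one_div_mul_cancel hℓ.ne', ENNReal.ofReal_one]
    rw [← h1]
    exact ENNReal.mul_lt_mul_left (by simpa using hℓ) ENNReal.ofReal_ne_top ht
  apply lintegral_congr_ae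
  filter_upwards [hne] with κ hκ
  by_cases hgood : ∀ z ∈ A, (κ z).1.2 * invRate ℓ t < ω z
  · rw [if_pos hgood]
    obtain ⟨y, hy, hmax⟩ := exists_strict_max (f := fun z => seedDrawn ℓ t (ω z) (κ z)) hA
      fun a ha b hb hab => hκ a ha b hb hab (hgood a ha)
    have hterm : ∀ x ∈ A, evictTerm A (invRate ℓ t) ω h₀ g (fun z => seedDrawn ℓ t (ω z))
        (fun z => counterLowered ℓ t (ω z)) x κ =
        if ∀ z ∈ A.erase x, seedDrawn ℓ t (ω z) (κ z) < seedDrawn ℓ t (ω x) (κ x) then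
          g (A.erase x) (seedDrawn ℓ t (ω x) (κ x), fun z => if z ∈ A.erase x then
            counterLowered ℓ t (ω z) (seedDrawn ℓ t (ω x) (κ x)) (κ z) else 0,
            fun z => if z ∈ A then (κ z).1.1 else h₀ z) else 0 := fun x _ => by
      unfold evictTerm
      exact if_congr (and_iff_right hgood) rfl rfl
    rw [Finset.sum_congr rfl hterm, sum_strict_max (f := fun z => seedDrawn ℓ t (ω z) (κ z)) hy hmax]
    have hseed : ∀ z ∈ A, redrawnSeed ℓ t
        (if z ∈ A then ω z - (κ z).1.2 * invRate ℓ t else 0) (if z ∈ A then (κ z).1.1 else h₀ z)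
        (κ z).2.1 (κ z).2.2 = seedDrawn ℓ t (ω z) (κ z) := by
      intro z hz
      simp only [hz, if_true]; rfl
    have harg : argmaxKey A (fun z => redrawnSeed ℓ t
        (if z ∈ A then ω z - (κ z).1.2 * invRate ℓ t else 0) (if z ∈ A then (κ z).1.1 else h₀ z)
        (κ z).2.1 (κ z).2.2) = some y := by
      rw [argmaxKey_congr hseed]
      exact argmaxKey_eq_some hy hmax
    have hsκ : s κ = (seedDrawn ℓ t (ω y) (κ y), A.erase y, fun z => if z ∈ A.erase y then
        counterLowered ℓ t (ω z) (seedDrawn ℓ t (ω y) (κ y)) (κ z) else 0) := by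
      rw [hs, evictState, if_pos htℓ, harg]
      simp only
      rw [hseed y hy]
      simp only [Prod.mk.injEq, true_and]
      ext z
      by_cases hz : z ∈ A.erase y
      · simp only [hz, if_true, Finset.mem_of_mem_erase hz]; rfl
      · simp only [hz, if_false]
    rw [hsκ]
  · rw [if_neg hgood]
    symm
    apply Finset.sum_eq_zero
    intro y _
    unfold evictTerm
    rw [if_neg fun h => hgood h.1]

end Redraw

/-! ### Combining the old and the new arrival of a key -/

section Mixing

theorem invRate_top (ℓ : ℝ) : invRate ℓ ⊤ = 0 := by simp [invRate, rate]

theorem seedOf_mono {ℓ h : ℝ} (hℓ : 0 < ℓ) (h1 : h ≤ 1) {m m' : ℝ≥0∞} (hm : m ≤ m') :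
    seedOf ℓ m h ≤ seedOf ℓ m' h := by
  unfold seedOf
  split_ifs with h2 h3 h3
  · exact le_rfl
  · exact (ofReal_div_le hℓ h1).trans (not_le.1 h3).le
  · exact absurd (hm.trans h3) h2
  · exact hm

theorem seedOf_lt_iff {ℓ h : ℝ} (hℓ : 0 < ℓ) (h1 : h ≤ 1) {m τ : ℝ≥0∞}
    (hm : m ≠ ENNReal.ofReal (1 / ℓ)) :
    seedOf ℓ m h < τ ↔ ENNReal.ofReal (h / ℓ) < τ ∧ m < rate ℓ τ := by
  refine ⟨fun hs => ⟨(of_seedOf_lt hℓ h1 hs).1, ?_⟩, fun hs => seedOf_lt hs.1 hs.2⟩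
  unfold seedOf at hs
  split_ifs at hs with h2
  · exact (lt_of_le_of_ne h2 hm).trans_le (le_max_left _ _)
  · exact hs.trans_le (le_max_right _ _)

theorem seedOf_lt_iff_of_lt {ℓ h : ℝ} (hℓ : 0 < ℓ) (h1 : h ≤ 1) {m τ : ℝ≥0∞}
    (hτ : ENNReal.ofReal (1 / ℓ) < τ) : seedOf ℓ m h < τ ↔ m < τ := by
  unfold seedOf
  split_ifs with h2
  · exact ⟨fun _ => h2.trans_lt hτ, fun _ => (ofReal_div_le hℓ h1).trans_lt hτ⟩
  · rfl

theorem arrival_lt_iff {W e : ℝ} (hW : 0 ≤ W) (he : 0 < e) {L : ℝ≥0∞} (hL0 : 0 < L) :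
    arrival W e < L ↔ e * L⁻¹.toReal < W := by
  rcases eq_or_lt_of_le hW with rfl | hW
  · rw [arrival_zero he]
    exact ⟨fun h => absurd h not_top_lt,
      fun h => absurd h (not_lt.2 (mul_nonneg he.le ENNReal.toReal_nonneg))⟩
  rw [arrival_of_pos hW]
  by_cases hL : L = ⊤
  · subst hL; simp [hW]
  · have hl : 0 < L.toReal := ENNReal.toReal_pos hL0.ne' hL
    rw [ENNReal.ofReal_lt_iff_lt_toReal (div_nonneg he.le hW.le) hL, ENNReal.toReal_inv,
      ← div_eq_mul_inv, div_lt_iff₀ hW, div_lt_iff₀ hl, mul_comm]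

theorem arrival_lt_rate_iff {ℓ : ℝ} (hℓ : 0 < ℓ) {W e : ℝ} (hW : 0 ≤ W) (he : 0 < e) (τ : ℝ≥0∞) :
    arrival W e < rate ℓ τ ↔ e * invRate ℓ τ < W := arrival_lt_iff hW he (rate_pos hℓ τ)

theorem arrival_ne_top {w : ℝ} (hw : 0 < w) (e : ℝ) : arrival w e ≠ ⊤ := by
  rw [arrival_of_pos hw]; exact ENNReal.ofReal_ne_top

theorem ae_arrival_ne {W : ℝ} (hW : 0 ≤ W) (c : ℝ≥0∞) (hc : W = 0 → c ≠ ⊤) :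
    ∀ᵐ e ∂stdExp, arrival W e ≠ c := by
  rcases eq_or_lt_of_le hW with rfl | hW
  · filter_upwards [ae_stdExp_pos] with e he
    rw [arrival_zero he]; exact (hc rfl).symm
  · have h2 : ∀ᵐ a ∂stdExp, a ≠ W * c.toReal := by simp [ae_iff, measure_singleton]
    filter_upwards [h2, ae_stdExp_pos] with e h2 he h
    apply h2
    rw [← h, arrival_of_pos hW, ENNReal.toReal_ofReal (by positivity)]
    field_simp

variable {X : Type*} [DecidableEq X]

theorem kthSmallest_erase_congr {k : ℕ} {K : Finset X} {σ₁ σ₂ : X → ℝ≥0∞} {y : X}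
    (h : ∀ z, z ≠ y → σ₁ z = σ₂ z) :
    kthSmallest k (K.erase y) σ₁ = kthSmallest k (K.erase y) σ₂ :=
  kthSmallest_congr fun z hz => h z (Finset.ne_of_mem_erase hz)

/-- Once `y` lies below the `k`-th smallest seed `T` of the others, `T` is the threshold. The exact
seed of `y` then no longer matters, only its counter at `T`. -/
theorem bottomSample_congr_of_lt {k : ℕ} (hk : 1 ≤ k) {K : Finset X} {y : X} (hy : y ∈ K)
    {σ₁ σ₂ : X → ℝ≥0∞} {c₁ c₂ : X → ℝ≥0∞ → ℝ} (hσ : ∀ z, z ≠ y → σ₁ z = σ₂ z)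
    (hc : ∀ z, z ≠ y → c₁ z = c₂ z) {T : ℝ≥0∞} (hT : T = kthSmallest k (K.erase y) σ₁)
    (h1 : σ₁ y < T) (h2 : σ₂ y < T) (hcT : c₁ y T = c₂ y T) :
    bottomSample k K σ₁ c₁ = bottomSample k K σ₂ c₂ := by
  have e1 : kthSmallest (k + 1) K σ₁ = T := by
    rw [hT]; exact kthSmallest_of_lt hk hy (hT ▸ h1)
  have e2 : kthSmallest (k + 1) K σ₂ = T := by
    rw [hT, kthSmallest_erase_congr hσ]
    exact kthSmallest_of_lt hk hy (by rw [← kthSmallest_erase_congr hσ, ← hT]; exact h2)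
  have h3 : ∀ z, σ₁ z < T ↔ σ₂ z < T := by
    intro z
    by_cases hz : z = y
    · subst hz; simp [h1, h2]
    · rw [hσ z hz]
  unfold bottomSample
  rw [e1, e2]
  simp only [h3, Prod.mk.injEq, true_and]
  ext z
  by_cases hz : z = y
  · subst hz; rw [hcT]
  · rw [hc z hz]

/-- At or above `T` the key `y` is not sampled: its seed may still be the threshold, but its counter
is never read. -/
theorem bottomSample_congr_of_le {k : ℕ} (hk : 1 ≤ k) {K : Finset X} {y : X} (hy : y ∈ K)
    {σ : X → ℝ≥0∞} {c₁ c₂ : X → ℝ≥0∞ → ℝ} (hc : ∀ z, z ≠ y → c₁ z = c₂ z)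
    (h : kthSmallest k (K.erase y) σ ≤ σ y) :
    bottomSample k K σ c₁ = bottomSample k K σ c₂ := by
  have h1 : ¬ σ y < kthSmallest (k + 1) K σ := by
    rw [lt_kthSmallest_iff hk hy]; exact not_lt.2 h
  unfold bottomSample
  simp only [Prod.mk.injEq, true_and]
  ext z
  by_cases hz : z = y
  · subst hz; simp [h1, -not_lt]
  · rw [hc z hz]

/-- The law of hashes and arrival variables of all keys. -/
noncomputable def arrivalLaw (X : Type*) : Measure (X → ℝ × ℝ) :=
  Measure.infinitePi fun _ : X => pairLaw

instance : IsProbabilityMeasure (arrivalLaw X) := by unfold arrivalLaw; infer_instance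

/-- The seeds given by the arrival variables when the keys have weights `W`. -/
noncomputable def idealSeed (ℓ : ℝ) (W : X → ℝ) (ξ : X → ℝ × ℝ) (z : X) : ℝ≥0∞ :=
  seedOf ℓ (arrival (W z) (ξ z).2) (ξ z).1

/-- The bottom-`k` sample when the keys have weights `W`; its law is the law of the state of the
algorithm. -/
noncomputable def idealState (k : ℕ) (ℓ : ℝ) (K : Finset X) (W : X → ℝ) (ξ : X → ℝ × ℝ) :
    ℝ≥0∞ × Finset X × (X → ℝ) :=
  bottomSample k K (idealSeed ℓ W ξ) fun z τ => W z - (ξ z).2 * invRate ℓ τ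

/-- The bottom-`k` sample after an element `(y,w)` with arrival variable `e₀`, in which the arrival
at the old elements of `y` takes precedence. -/
noncomputable def mixedState (k : ℕ) (ℓ : ℝ) (K : Finset X) (W : X → ℝ) (y : X) (w : ℝ)
    (ξ : X → ℝ × ℝ) (e₀ : ℝ) : ℝ≥0∞ × Finset X × (X → ℝ) :=
  bottomSample k K (Function.update (idealSeed ℓ W ξ) y
      (seedOf ℓ (min (arrival (W y) (ξ y).2) (arrival w e₀)) (ξ y).1)) fun z τ =>
    if z = y then
      if (ξ y).2 * invRate ℓ τ < W y then W y + w - (ξ y).2 * invRate ℓ τ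
      else w - e₀ * invRate ℓ τ
    else W z - (ξ z).2 * invRate ℓ τ

omit [DecidableEq X] in
theorem measurable_idealSeed (ℓ : ℝ) (W : X → ℝ) (z : X) :
    Measurable fun ξ : X → ℝ × ℝ => idealSeed ℓ W ξ z :=
  (measurable_seedOf ℓ).comp (((measurable_arrival (W z)).comp (by fun_prop)).prodMk (by fun_prop))

theorem measurableState_idealState (k : ℕ) (ℓ : ℝ) (K : Finset X) (W : X → ℝ) :
    MeasurableState (idealState k ℓ K W) := by
  have h := measurable_invRate ℓ
  exact measurableState_bottomSample k K (fun z _ => measurable_idealSeed ℓ W z) fun z _ => by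
    fun_prop

theorem measurableState_mixedState (k : ℕ) (ℓ : ℝ) (K : Finset X) (W : X → ℝ) (y : X) (w : ℝ) :
    MeasurableState fun p : (X → ℝ × ℝ) × ℝ => mixedState k ℓ K W y w p.1 p.2 := by
  have h := measurable_invRate ℓ
  refine measurableState_bottomSample k K (fun z _ => ?_) fun z _ => ?_
  · by_cases hz : z = y
    · subst hz
      simp only [Function.update_self]
      exact (measurable_seedOf ℓ).comp ((((measurable_arrival (W z)).comp (by fun_prop)).min
        ((measurable_arrival w).comp (by fun_prop))).prodMk (by fun_prop))
    · simp only [Function.update_of_ne hz]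
      exact (measurable_idealSeed ℓ W z).comp measurable_fst
  · by_cases hz : z = y
    · simp only [hz, if_true]
      exact Measurable.ite (measurableSet_lt (by fun_prop) measurable_const) (by fun_prop)
        (by fun_prop)
    · simp only [hz, if_false]; fun_prop

/-- The value of a test function at a state. -/
def evalTest (g : Finset X → ℝ≥0∞ × (X → ℝ) × (X → ℝ) → ℝ≥0∞)
    (s : ℝ≥0∞ × Finset X × (X → ℝ)) (h : X → ℝ) : ℝ≥0∞ := g s.2.1 (s.1, s.2.2, h)

omit [DecidableEq X] in
theorem MeasurableState.evalTest {α : Type*} [MeasurableSpace α]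
    {f : α → ℝ≥0∞ × Finset X × (X → ℝ)} (hf : MeasurableState f) {h : α → X → ℝ}
    (hh : Measurable h) {g : Finset X → ℝ≥0∞ × (X → ℝ) × (X → ℝ) → ℝ≥0∞}
    (hg : ∀ S, Measurable (g S)) : Measurable fun a => evalTest g (f a) (h a) :=
  hf.measurable_test hh hg

/-- The other keys and the hash of `y` are fixed, and `T` is the `k`-th smallest seed of the others.
A sampled `y` contributes only its counter at `T`, an unsampled `y` only its seed. The two
contributions can therefore be computed separately, by memorylessness and by the law of the minimum;
a joint identity is not needed. -/
theorem lintegral_mixed_single {k : ℕ} (hk : 1 ≤ k) {ℓ : ℝ} (hℓ : 0 < ℓ) {K : Finset X} {y : X}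
    (hy : y ∈ K) {W w : ℝ} (hW : 0 ≤ W) (hw : 0 < w) (σ : X → ℝ≥0∞) {c : X → ℝ≥0∞ → ℝ}
    (hc : ∀ z, Measurable (c z)) (H : X → ℝ) {h : ℝ} (h1 : h ≤ 1) {g : Finset X → ℝ≥0∞ × (X → ℝ) × (X → ℝ) → ℝ≥0∞}
    (hg : ∀ S, Measurable (g S)) :
    ∫⁻ e, ∫⁻ e₀, evalTest g (bottomSample k K
        (Function.update σ y (seedOf ℓ (min (arrival W e) (arrival w e₀)) h))
        (Function.update c y fun τ => if e * invRate ℓ τ < W then W + w - e * invRate ℓ τ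
          else w - e₀ * invRate ℓ τ)) H ∂stdExp ∂stdExp =
    ∫⁻ e, evalTest g (bottomSample k K (Function.update σ y (seedOf ℓ (arrival (W + w) e) h))
        (Function.update c y fun τ => W + w - e * invRate ℓ τ)) H ∂stdExp := by
  set T := kthSmallest k (K.erase y) σ with hT
  have hTu : ∀ m, T = kthSmallest k (K.erase y) (Function.update σ y m) := fun m =>
    kthSmallest_erase_congr fun z hz => (Function.update_of_ne hz _ _).symm
  set B : ℝ≥0∞ → (ℝ≥0∞ → ℝ) → ℝ≥0∞ × Finset X × (X → ℝ) := fun m v =>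
    bottomSample k K (Function.update σ y (seedOf ℓ m h)) (Function.update c y v) with hB
  have hBin : ∀ m m' v v', seedOf ℓ m h < T → seedOf ℓ m' h < T → v T = v' T → B m v = B m' v' := by
    intro m m' v v' h1 h2 h3
    exact bottomSample_congr_of_lt hk hy
      (fun z hz => by rw [Function.update_of_ne hz, Function.update_of_ne hz])
      (fun z hz => by rw [Function.update_of_ne hz, Function.update_of_ne hz])
      (hTu (seedOf ℓ m h)) (by simpa using h1) (by simpa using h2) (by simpa using h3)
  have hBout : ∀ m v v', T ≤ seedOf ℓ m h → B m v = B m v' := by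
    intro m v v' h1
    apply bottomSample_congr_of_le hk hy
      (fun z hz => by rw [Function.update_of_ne hz, Function.update_of_ne hz])
    rw [← hTu]; simpa using h1
  change ∫⁻ e, ∫⁻ e₀, evalTest g (B (min (arrival W e) (arrival w e₀)) fun τ =>
      if e * invRate ℓ τ < W then W + w - e * invRate ℓ τ else w - e₀ * invRate ℓ τ) H
      ∂stdExp ∂stdExp =
    ∫⁻ e, evalTest g (B (arrival (W + w) e) fun τ => W + w - e * invRate ℓ τ) H ∂stdExp
  -- With fewer than `k` finite seeds among the others, `y` is always kept with its full weight,
  -- because the loss rate is infinite.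
  by_cases htop : T = ⊤
  · have hfin : ∀ m, m ≠ ⊤ → seedOf ℓ m h < T := by
      intro m hm
      rw [htop]; unfold seedOf
      split_ifs
      · exact ENNReal.ofReal_lt_top
      · exact lt_top_iff_ne_top.2 hm
    have e1 : ∀ e e₀, B (min (arrival W e) (arrival w e₀)) (fun τ =>
        if e * invRate ℓ τ < W then W + w - e * invRate ℓ τ else w - e₀ * invRate ℓ τ) =
        B 0 fun _ => W + w := by
      intro e e₀
      apply hBin _ _ _ _ (hfin _ _) (hfin _ ENNReal.zero_ne_top)
      · rw [htop]
        beta_reduce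
        rw [invRate_top]
        split_ifs with h
        · ring
        · have : W = 0 := by
            have : ¬ 0 < W := by simpa using h
            linarith
          rw [this]; ring
      · exact ne_top_of_le_ne_top (arrival_ne_top hw e₀) (min_le_right _ _)
    have e2 : ∀ e, B (arrival (W + w) e) (fun τ => W + w - e * invRate ℓ τ) =
        B 0 fun _ => W + w := by
      intro e
      apply hBin _ _ _ _ (hfin _ (arrival_ne_top (by positivity) e)) (hfin _ ENNReal.zero_ne_top)
      rw [htop]
      beta_reduce
      rw [invRate_top]; ring
    simp_rw [e1, e2]
    simp
  have hG2 : Measurable fun m => evalTest g (B m fun _ => 0) H := by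
    refine MeasurableState.evalTest (measurableState_bottomSample k K (fun z _ => ?_) fun z _ => ?_)
      measurable_const hg
    · by_cases hz : z = y
      · subst hz
        simp only [Function.update_self]
        exact (measurable_seedOf ℓ).comp (measurable_id.prodMk measurable_const)
      · simp only [Function.update_of_ne hz]; exact measurable_const
    · by_cases hz : z = y
      · subst hz
        simp only [Function.update_self]; exact measurable_const
      · simp only [Function.update_of_ne hz]
        exact (hc z).comp measurable_snd
  have hhigh : ∀ {m : ℝ≥0∞}, rate ℓ T < m → T ≤ seedOf ℓ m h := fun hm =>
    not_lt.1 fun h2 => absurd (of_seedOf_lt hℓ h1 h2).2 (not_le.2 hm)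
  -- If the base hash is not below `T`, no arrival value brings `y` into the sample, and only the
  -- law of the minimum matters.
  rcases le_or_gt T (ENNReal.ofReal (h / ℓ)) with hh | hh
  · have hall : ∀ m, T ≤ seedOf ℓ m h := fun m =>
      not_lt.1 fun h2 => absurd (of_seedOf_lt hℓ h1 h2).1 (not_lt.2 hh)
    have e3 : ∀ m v, B m v = B m fun _ => 0 := fun m v => hBout m v _ (hall m)
    have e1 : ∫⁻ e, ∫⁻ e₀, evalTest g (B (min (arrival W e) (arrival w e₀)) fun _ => 0) H
        ∂stdExp ∂stdExp = ∫⁻ p, evalTest g (B (min (arrival W p.1) (arrival w p.2)) fun _ => 0) H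
        ∂(stdExp.prod stdExp) := by
      rw [lintegral_prod]
      exact (hG2.comp (((measurable_arrival W).comp measurable_fst).min
        ((measurable_arrival w).comp measurable_snd))).aemeasurable
    have e2 := lintegral_map (μ := stdExp.prod stdExp) hG2
      (((measurable_arrival W).comp measurable_fst).min
        ((measurable_arrival w).comp measurable_snd))
    have e4 := map_min_arrival hW hw
    simp only [Function.comp_def] at e2
    rw [e4, lintegral_map hG2 (measurable_arrival _)] at e2
    calc _ = ∫⁻ e, ∫⁻ e₀, evalTest g (B (min (arrival W e) (arrival w e₀)) fun _ => 0) H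
        ∂stdExp ∂stdExp := lintegral_congr fun e => lintegral_congr fun e₀ => by rw [e3]
      _ = ∫⁻ e, evalTest g (B (arrival (W + w) e) fun _ => 0) H ∂stdExp := by rw [e1, ← e2]
      _ = _ := lintegral_congr fun e => by
          rw [e3 _ fun τ => W + w - e * invRate ℓ τ]
  set L := rate ℓ T with hL
  have hL0 : 0 < L := rate_pos hℓ T
  have hLtop : L ≠ ⊤ := rate_ne_top htop
  set q := invRate ℓ T with hq
  have hl : 0 < L.toReal := ENNReal.toReal_pos hL0.ne' hLtop
  have hql : q = (L.toReal)⁻¹ := ENNReal.toReal_inv L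
  have hGv : Measurable fun v : ℝ => evalTest g (B 0 fun _ => v) H := by
    refine MeasurableState.evalTest (measurableState_bottomSample k K (fun z _ => ?_) fun z _ => ?_)
      measurable_const hg
    · exact measurable_const
    · by_cases hz : z = y
      · subst hz
        simp only [Function.update_self]; exact measurable_fst
      · simp only [Function.update_of_ne hz]
        exact (hc z).comp measurable_snd
  have hlow : ∀ {m : ℝ≥0∞} v, m < L → B m v = B 0 fun _ => v T := fun v hm =>
    hBin _ _ _ _ (seedOf_lt hh hm) (seedOf_lt hh hL0) rfl
  -- `F₁` collects the outcomes with `y` sampled, in terms of the exponential; `F₂` collects the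
  -- others, in terms of the arrival value.
  set F₁ : ℝ → ℝ≥0∞ := fun a => if a * q < W + w then evalTest g (B 0 fun _ => W + w - a * q) H
    else 0 with hF₁
  set F₂ : ℝ≥0∞ → ℝ≥0∞ := fun m => if L ≤ m then evalTest g (B m fun _ => 0) H else 0 with hF₂
  have hF₁m : Measurable F₁ := Measurable.ite (measurableSet_lt (by fun_prop) (by fun_prop))
    (hGv.comp (by fun_prop)) measurable_const
  have hF₂m : Measurable F₂ := Measurable.ite measurableSet_Ici hG2 measurable_const
  have hR : ∫⁻ e, evalTest g (B (arrival (W + w) e) fun τ => W + w - e * invRate ℓ τ) H ∂stdExp =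
      ∫⁻ e, F₁ e ∂stdExp + ∫⁻ e, F₂ (arrival (W + w) e) ∂stdExp := by
    rw [← lintegral_add_left hF₁m]
    apply lintegral_congr_ae
    filter_upwards [ae_stdExp_pos, ae_arrival_ne (W := W + w) (by positivity) L
      (fun h => absurd h (by positivity))] with e he hne
    have h2 : arrival (W + w) e < L ↔ e * q < W + w :=
      arrival_lt_rate_iff hℓ (by positivity) he T
    by_cases h3 : arrival (W + w) e < L
    · rw [hlow _ h3, hF₁, hF₂]
      simp only [if_pos (h2.1 h3), if_neg (not_le.2 h3), add_zero]
      rfl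
    · rw [hBout _ _ (fun _ => 0) (hhigh (lt_of_le_of_ne (not_lt.1 h3) hne.symm)), hF₁, hF₂]
      simp only [if_neg (fun h => h3 (h2.2 h)), if_pos (not_lt.1 h3), zero_add]
  have hmin : Measurable fun p : ℝ × ℝ => min (arrival W p.1) (arrival w p.2) :=
    ((measurable_arrival W).comp measurable_fst).min ((measurable_arrival w).comp measurable_snd)
  have hmem : Measurable fun p : ℝ × ℝ => if p.1 < L.toReal * W then p.1 else L.toReal * W + p.2 :=
    Measurable.ite (measurableSet_lt (by fun_prop) (by fun_prop)) (by fun_prop) (by fun_prop)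
  rw [hR]
  -- The exponential for weight `W + w` is built from `e` and `e₀`: `e` itself while `e < L W`, so
  -- that the old elements are sampled, and `L W + e₀` afterwards. The loss `W + e₀/L` then leaves
  -- the counter `w - e₀/L`.
  have hF₁e : ∫⁻ e, F₁ e ∂stdExp = ∫⁻ p : ℝ × ℝ,
      F₁ (if p.1 < L.toReal * W then p.1 else L.toReal * W + p.2) ∂(stdExp.prod stdExp) := by
    rw [← lintegral_map hF₁m hmem, map_memoryless (mul_nonneg hl.le hW)]
  rw [hF₁e, ← lintegral_map hF₂m (measurable_arrival _), ← map_min_arrival hW hw,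
    lintegral_map hF₂m hmin]
  have hF₁c : Measurable fun p : ℝ × ℝ =>
    F₁ (if p.1 < L.toReal * W then p.1 else L.toReal * W + p.2) := hF₁m.comp hmem
  have hFc : Measurable fun p : ℝ × ℝ =>
    F₁ (if p.1 < L.toReal * W then p.1 else L.toReal * W + p.2) +
      F₂ (min (arrival W p.1) (arrival w p.2)) := hF₁c.add (hF₂m.comp hmin)
  rw [← lintegral_add_left hF₁c, lintegral_prod _ hFc.aemeasurable]
  apply lintegral_congr_ae
  filter_upwards [ae_stdExp_pos, ae_arrival_ne hW L (fun _ => hLtop)] with e he hne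
  apply lintegral_congr_ae
  filter_upwards [ae_stdExp_pos, ae_arrival_ne hw.le L (fun _ => hLtop)] with e₀ he₀ hne₀
  have h2 := arrival_lt_rate_iff hℓ hW he T
  have h3 := arrival_lt_rate_iff hℓ hw.le he₀ T
  have h4 : e < L.toReal * W ↔ e * q < W := by
    rw [hql, ← div_eq_mul_inv, div_lt_iff₀ hl, mul_comm]
  have h5 : (L.toReal * W + e₀) * q = W + e₀ * q := by rw [hql]; field_simp
  by_cases h6 : e * q < W
  · have h7 : min (arrival W e) (arrival w e₀) < L := min_lt_of_left_lt (h2.2 h6)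
    rw [hlow _ h7, hF₁, hF₂]
    simp only [if_pos (h4.2 h6), if_neg (not_le.2 h7), add_zero]
    rw [← hq, if_pos h6, if_pos (by linarith)]
  · have h8 : L < arrival W e := lt_of_le_of_ne (not_lt.1 fun h => h6 (h2.1 h)) hne.symm
    by_cases h7 : arrival w e₀ < L
    · have h9 : min (arrival W e) (arrival w e₀) < L := min_lt_of_right_lt h7
      rw [hlow _ h9, hF₁, hF₂]
      simp only [if_neg (fun h => h6 (h4.1 h)), if_neg (not_le.2 h9), add_zero]
      rw [← hq, if_neg h6, h5, if_pos (by linarith [h3.1 h7])]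
      congr 3
      ext; ring
    · have h9 : L < min (arrival W e) (arrival w e₀) :=
        lt_min h8 (lt_of_le_of_ne (not_lt.1 h7) hne₀.symm)
      rw [hBout _ _ (fun _ => 0) (hhigh h9), hF₁, hF₂]
      simp only [if_neg (fun h => h6 (h4.1 h)), if_pos h9.le]
      rw [h5, if_neg (fun h => h7 (h3.2 (by linarith))), zero_add]

/-- Taking the first arrival among old and new elements of `y` yields the state for the increased
weight. -/
theorem lintegral_mixedState {k : ℕ} (hk : 1 ≤ k) {ℓ : ℝ} (hℓ : 0 < ℓ) {K : Finset X} {y : X}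
    (hy : y ∈ K) {W : X → ℝ} {w : ℝ} (hW : 0 ≤ W y) (hw : 0 < w)
    {g : Finset X → ℝ≥0∞ × (X → ℝ) × (X → ℝ) → ℝ≥0∞} (hg : ∀ S, Measurable (g S)) :
    ∫⁻ ξ, ∫⁻ e₀, evalTest g (mixedState k ℓ K W y w ξ e₀) (fun z => (ξ z).1) ∂stdExp
        ∂(arrivalLaw X) =
      ∫⁻ ξ, evalTest g (idealState k ℓ K (Function.update W y (W y + w)) ξ) (fun z => (ξ z).1)
        ∂(arrivalLaw X) := by
  have hm1 : Measurable fun p : (X → ℝ × ℝ) × ℝ =>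
      evalTest g (mixedState k ℓ K W y w p.1 p.2) (fun z => (p.1 z).1) :=
    (measurableState_mixedState k ℓ K W y w).evalTest
      (measurable_pi_lambda _ fun z => by fun_prop) hg
  have hm2 : ∀ V, Measurable fun ξ => evalTest g (idealState k ℓ K V ξ) (fun z => (ξ z).1) :=
    fun V => (measurableState_idealState k ℓ K V).evalTest
      (measurable_pi_lambda _ fun z => by fun_prop) hg
  unfold arrivalLaw
  rw [lintegral_infinitePi_update _ y hm1.lintegral_prod_right',
    lintegral_infinitePi_update _ y (hm2 _)]
  refine lintegral_congr fun ξ => ?_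
  have hup : Measurable fun a : ℝ × ℝ => Function.update ξ y a := measurable_update ξ
  have hm3 : Measurable fun a : ℝ × ℝ => ∫⁻ e₀, evalTest g
      (mixedState k ℓ K W y w (Function.update ξ y a) e₀)
      (fun z => (Function.update ξ y a z).1) ∂stdExp :=
    (hm1.lintegral_prod_right' (ν := stdExp)).comp hup
  have hm4 : Measurable fun a : ℝ × ℝ => evalTest g
      (idealState k ℓ K (Function.update W y (W y + w)) (Function.update ξ y a))
      (fun z => (Function.update ξ y a z).1) := (hm2 _).comp hup
  unfold pairLaw
  rw [lintegral_prod _ hm3.aemeasurable, lintegral_prod _ hm4.aemeasurable]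
  apply lintegral_congr_ae
  filter_upwards [ae_unifLaw_mem] with h hh
  have key := lintegral_mixed_single hk hℓ hy hW hw (idealSeed ℓ W ξ)
    (c := fun z τ => W z - (ξ z).2 * invRate ℓ τ)
    (fun z => measurable_const.sub ((measurable_invRate ℓ).const_mul _))
    (Function.update (fun z => (ξ z).1) y h) hh.2.le hg
  have hH : ∀ e, (fun z => (Function.update ξ y (h, e) z).1) =
      Function.update (fun z => (ξ z).1) y h := by
    intro e; ext z
    by_cases hz : z = y
    · subst hz; simp
    · simp [Function.update_of_ne hz]
  convert key using 1
  · refine lintegral_congr fun e => lintegral_congr fun e₀ => ?_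
    rw [hH]
    congr 1
    unfold mixedState
    congr 1
    · ext z
      by_cases hz : z = y
      · subst hz; simp
      · simp [Function.update_of_ne hz, idealSeed]
    · ext z τ
      by_cases hz : z = y
      · subst hz; simp
      · simp [hz]
  · refine lintegral_congr fun e => ?_
    rw [hH]
    congr 1
    unfold idealState
    congr 1
    · ext z
      by_cases hz : z = y
      · subst hz; simp [idealSeed]
      · simp [Function.update_of_ne hz, idealSeed]
    · ext z τ
      by_cases hz : z = y
      · subst hz; simp
      · simp [Function.update_of_ne hz]

end Mixing

/-! ### Steps that agree with the mixed sample pathwise -/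

section StepPathwise

theorem one_lt_mul_ofReal_iff {ℓ : ℝ} (hℓ : 0 < ℓ) (τ : ℝ≥0∞) :
    1 < τ * ENNReal.ofReal ℓ ↔ ENNReal.ofReal (1 / ℓ) < τ := by
  have h0 : ENNReal.ofReal ℓ ≠ 0 := by simpa using hℓ
  have h1 : ENNReal.ofReal (1 / ℓ) * ENNReal.ofReal ℓ = 1 := by
    rw [← ENNReal.ofReal_mul (by positivity), one_div_mul_cancel hℓ.ne', ENNReal.ofReal_one]
  rw [← h1]
  exact ENNReal.mul_lt_mul_iff_left h0 ENNReal.ofReal_ne_top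

theorem seedOf_of_lt {ℓ h : ℝ} {m : ℝ≥0∞} (hm : ENNReal.ofReal (1 / ℓ) < m) :
    seedOf ℓ m h = m := if_neg (not_le.2 hm)

theorem seedOf_eq_of_lt_seedOf {ℓ h : ℝ} (hℓ : 0 < ℓ) (h1 : h ≤ 1) {m : ℝ≥0∞}
    (hs : ENNReal.ofReal (1 / ℓ) < seedOf ℓ m h) : seedOf ℓ m h = m := by
  unfold seedOf at hs ⊢
  split_ifs at hs ⊢ with h2
  · exact absurd hs (not_lt.2 (ofReal_div_le hℓ h1))
  · rfl

theorem seedOf_eq_of_seedOf_le {ℓ h : ℝ} {m : ℝ≥0∞}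
    (hs : seedOf ℓ m h ≤ ENNReal.ofReal (1 / ℓ)) : seedOf ℓ m h = ENNReal.ofReal (h / ℓ) := by
  unfold seedOf at hs ⊢
  split_ifs at hs ⊢ with h2
  · rfl
  · exact absurd hs h2

theorem rate_le_of_le_seedOf {ℓ h : ℝ} {m τ : ℝ≥0∞}
    (hh : ENNReal.ofReal (h / ℓ) < τ) (hs : τ ≤ seedOf ℓ m h) : rate ℓ τ ≤ m :=
  not_lt.1 fun h2 => absurd (seedOf_lt hh h2) (not_lt.2 hs)

theorem seedOf_eq_top_iff {ℓ h : ℝ} {m : ℝ≥0∞} : seedOf ℓ m h = ⊤ ↔ m = ⊤ := by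
  unfold seedOf
  split_ifs with h2
  · exact ⟨fun h => absurd h ENNReal.ofReal_ne_top,
      fun h => absurd h (h2.trans_lt ENNReal.ofReal_lt_top).ne⟩
  · rfl

theorem rate_of_le {ℓ : ℝ} {τ : ℝ≥0∞} (h : τ ≤ ENNReal.ofReal (1 / ℓ)) :
    rate ℓ τ = ENNReal.ofReal (1 / ℓ) := max_eq_left h

theorem invRate_of_le {ℓ : ℝ} {τ : ℝ≥0∞} (h : τ ≤ ENNReal.ofReal (1 / ℓ)) :
    invRate ℓ τ = (ENNReal.ofReal (1 / ℓ))⁻¹.toReal := by rw [invRate, rate_of_le h]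

variable {X : Type*} [DecidableEq X]

/-- When an element `(y,w)` is processed, the state becomes the mixed sample, unless the element
triggers an eviction at a threshold above `1/ℓ`. -/
theorem stepState_eq_mixedState {k : ℕ} {ℓ : ℝ} (hℓ : 0 < ℓ) {K : Finset X}
    {W : X → ℝ} (hW : ∀ z, 0 ≤ W z) {y : X} (hy : y ∈ K) {w : ℝ} (hw : 0 < w) {ξ : X → ℝ × ℝ}
    {e₀ : ℝ} (hξ : ∀ z ∈ K, 0 < (ξ z).1 ∧ (ξ z).1 < 1 ∧ 0 < (ξ z).2) (he₀ : 0 < e₀)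
    (hties : ∀ a ∈ K, ∀ b ∈ K, a ≠ b → idealSeed ℓ W ξ a = idealSeed ℓ W ξ b →
      idealSeed ℓ W ξ a = ⊤)
    (hhash : ∀ a ∈ K, ∀ b ∈ K, a ≠ b → (ξ a).1 ≠ (ξ b).1)
    (hMy : arrival (W y) (ξ y).2 ≠ ENNReal.ofReal (1 / ℓ))
    (hv : arrival w e₀ ≠ ENNReal.ofReal (1 / ℓ)) (η : X → ℝ × ℝ)
    (hE : ¬ (y ∉ (idealState k ℓ K W ξ).2.1 ∧ (idealState k ℓ K W ξ).2.1.card = k ∧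
      ENNReal.ofReal (1 / ℓ) < (idealState k ℓ K W ξ).1 ∧
      e₀ * invRate ℓ (idealState k ℓ K W ξ).1 < w)) :
    stepState k ℓ y w (idealState k ℓ K W ξ) (fun z => (ξ z).1) e₀ η =
      mixedState k ℓ K W y w ξ e₀ := by
  set σ := idealSeed ℓ W ξ with hσ
  set m := min (arrival (W y) (ξ y).2) (arrival w e₀) with hm
  set s' := seedOf ℓ m (ξ y).1 with hs'
  set τ := kthSmallest (k + 1) K σ with hτ
  have hst1 : (idealState k ℓ K W ξ).1 = τ := rfl
  have hst2 : (idealState k ℓ K W ξ).2.1 = K.filter (fun z => σ z < τ) := rfl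
  have hst3 : (idealState k ℓ K W ξ).2.2 = fun z =>
    if z ∈ K ∧ σ z < τ then W z - (ξ z).2 * invRate ℓ τ else 0 := rfl
  have hmix : mixedState k ℓ K W y w ξ e₀ = bottomSample k K (Function.update σ y s')
      fun z τ => if z = y then
        if (ξ y).2 * invRate ℓ τ < W y then W y + w - (ξ y).2 * invRate ℓ τ
        else w - e₀ * invRate ℓ τ
      else W z - (ξ z).2 * invRate ℓ τ := rfl
  have hyξ := hξ y hy
  have hs'le : s' ≤ σ y := seedOf_mono hℓ hyξ.2.1.le (min_le_left _ _)
  have hσy : σ y = seedOf ℓ (arrival (W y) (ξ y).2) (ξ y).1 := rfl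
  have hmne : m ≠ ENNReal.ofReal (1 / ℓ) := by
    rw [hm]; rcases min_choice (arrival (W y) (ξ y).2) (arrival w e₀) with h | h <;> rw [h] <;>
      assumption
  rw [hst1, hst2] at hE
  rw [hmix, stepState, hst1, hst2, hst3]
  by_cases hyS : y ∈ K.filter (fun z => σ z < τ)
  · have hyτ : σ y < τ := (Finset.mem_filter.1 hyS).2
    rw [if_pos hyS]
    obtain ⟨e1, e2⟩ := kthSmallest_update_of_same_side (by omega : 1 ≤ k + 1) hs'le (Or.inl hyτ)
    unfold bottomSample
    rw [e1]
    simp only [← hτ] at e2 ⊢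
    simp only [e2, Prod.mk.injEq, true_and]
    ext z
    by_cases hz : z = y
    · subst hz
      have hlt : (ξ z).2 * invRate ℓ τ < W z := by
        rw [← arrival_lt_rate_iff hℓ (hW z) hyξ.2.2]
        exact ((seedOf_lt_iff hℓ hyξ.2.1.le hMy).1 hyτ).2
      simp only [Function.update_self, hyτ, hy, and_self, if_true, hlt]
      ring
    · simp only [Function.update_of_ne hz, hz, if_false]
  have hyτ : τ ≤ σ y := not_lt.1 fun h => hyS (Finset.mem_filter.2 ⟨hy, h⟩)
  rw [if_neg hyS]
  -- As `y` is not sampled, a base hash below `τ` forces its old arrival value up to the rate or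
  -- beyond. Only the new element can lower the seed below `τ`, which is the entry test.
  have hs'iff : s' < τ ↔ ENNReal.ofReal ((ξ y).1 / ℓ) < τ ∧ e₀ * invRate ℓ τ < w := by
    rw [hs', seedOf_lt_iff hℓ hyξ.2.1.le hmne]
    refine and_congr_right fun hh => ?_
    have h2 := rate_le_of_le_seedOf hh (hσy ▸ hyτ)
    rw [hm, min_lt_iff, or_iff_right (not_lt.2 h2), arrival_lt_rate_iff hℓ hw.le he₀]
  have hentry : (e₀ * invRate ℓ τ < w ∧ (1 < τ * ENNReal.ofReal ℓ ∨
      (τ * ENNReal.ofReal ℓ ≤ 1 ∧ ENNReal.ofReal ((ξ y).1 / ℓ) < τ))) ↔ s' < τ := by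
    rw [hs'iff, ← not_lt, one_lt_mul_ofReal_iff hℓ, and_comm]
    refine and_congr_left fun _ => ⟨?_, fun h => ?_⟩
    · rintro (h | h)
      · exact (ofReal_div_le hℓ hyξ.2.1.le).trans_lt h
      · exact h.2
    · by_cases h2 : ENNReal.ofReal (1 / ℓ) < τ
      · exact Or.inl h2
      · exact Or.inr ⟨h2, h⟩
  by_cases hent : s' < τ
  swap
  · rw [if_neg (fun h => hent (hentry.1 h))]
    obtain ⟨e1, e2⟩ := kthSmallest_update_of_same_side (by omega : 1 ≤ k + 1) hs'le
      (Or.inr (not_lt.1 hent))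
    change (τ, K.filter (fun z => σ z < τ),
      fun z => if z ∈ K ∧ σ z < τ then W z - (ξ z).2 * invRate ℓ τ else 0) = _
    unfold bottomSample
    rw [e1]
    simp only [← hτ] at e2 ⊢
    simp only [e2, Prod.mk.injEq, true_and]
    ext z
    by_cases hz : z = y
    · subst hz
      simp only [not_lt.2 hyτ, and_false, if_false]
    · simp only [hz, if_false]
  rw [if_pos (hentry.2 hent)]
  obtain ⟨hhτ, he₀w⟩ := hs'iff.1 hent
  have hMrate : rate ℓ τ ≤ arrival (W y) (ξ y).2 := rate_le_of_le_seedOf hhτ (hσy ▸ hyτ)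
  have hcardle := card_filter_lt_kthSmallest (by omega : 1 ≤ k + 1) K σ
  rw [← hτ] at hcardle
  set S := K.filter (fun z => σ z < τ) with hS
  have hcard : (insert y S).card = S.card + 1 := Finset.card_insert_of_notMem hyS
  by_cases hk1 : S.card = k
  swap
  · rw [if_neg (by omega)]
    -- A cache that is not full means an infinite threshold. An uncached `y` then has seed `⊤`, so
    -- it has weight `0` and was not seen before.
    have hτtop : τ = ⊤ := (kthSmallest_eq_top_or_card hties).resolve_right hk1
    have hWy : W y = 0 := by
      rcases (hW y).eq_or_lt with h | h
      · exact h.symm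
      · exact absurd (seedOf_eq_top_iff.1 (top_le_iff.1 (hτtop ▸ hyτ))) (arrival_ne_top h _)
    have hf : K.filter (fun z => Function.update σ y s' z < ⊤) = insert y S := by
      ext z
      rw [Finset.mem_filter, Finset.mem_insert, hS, Finset.mem_filter]
      by_cases hz : z = y
      · subst hz; simp [hy, hτtop ▸ hent]
      · simp [hz, hτtop]
    have hk2 : kthSmallest (k + 1) K (Function.update σ y s') = ⊤ :=
      kthSmallest_eq (by rw [hf]; omega) (Or.inl rfl)
    unfold bottomSample
    rw [hk2, hf, hτtop]
    simp only [Prod.mk.injEq, true_and]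
    ext z
    by_cases hz : z = y
    · subst hz
      simp only [Function.update_self, hτtop ▸ hent, hy, and_self, if_true, invRate_top, hWy,
        mul_zero, lt_irrefl, if_false]
    · simp only [Function.update_of_ne hz, hz, if_false]
  -- In this remaining eviction all seeds in question are base hashes. The rate is `1/ℓ` before and
  -- after, so the counters stay as they are.
  have hτle : τ ≤ ENNReal.ofReal (1 / ℓ) := not_lt.1 fun h => hE ⟨hyS, hk1, h, he₀w⟩
  rw [if_pos (by omega), evictState,
    if_neg (fun h => not_lt.2 hτle ((one_lt_mul_ofReal_iff hℓ τ).1 h))]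
  set A := insert y S with hA
  have hAK : A ⊆ K := Finset.insert_subset hy (Finset.filter_subset _ _)
  have hseed : ∀ z ∈ A, Function.update σ y s' z = ENNReal.ofReal ((ξ z).1 / ℓ) := by
    intro z hz
    by_cases hzy : z = y
    · subst hzy
      rw [Function.update_self]
      exact seedOf_eq_of_seedOf_le (hent.le.trans hτle)
    · rw [Function.update_of_ne hzy]
      have := (Finset.mem_filter.1 (Finset.mem_of_mem_insert_of_ne hz hzy)).2
      exact seedOf_eq_of_seedOf_le (this.le.trans hτle)
  obtain ⟨y₀, hy₀, hmax⟩ := exists_strict_max (S := A) ⟨y, Finset.mem_insert_self _ _⟩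
    (f := fun z => ENNReal.ofReal ((ξ z).1 / ℓ)) fun a ha b hb hab h => by
      have ha' := hξ a (hAK ha)
      have hb' := hξ b (hAK hb)
      apply hhash a (hAK ha) b (hAK hb) hab
      rw [ENNReal.ofReal_eq_ofReal_iff (by have := ha'.1; positivity)
        (by have := hb'.1; positivity)] at h
      field_simp at h
      exact h
  rw [argmaxKey_eq_some hy₀ hmax]
  simp only
  obtain ⟨e1, e2⟩ := kthSmallest_update_evict hy hyτ hent (A := A) rfl (by omega) hy₀
    (fun z hz => by rw [hseed z (Finset.mem_of_mem_erase hz), hseed y₀ hy₀]; exact hmax z hz)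
  unfold bottomSample
  rw [e1, e2, hseed y₀ hy₀]
  simp only [Prod.mk.injEq, true_and]
  have hτ'le : ENNReal.ofReal ((ξ y₀).1 / ℓ) ≤ ENNReal.ofReal (1 / ℓ) :=
    ofReal_div_le hℓ (hξ y₀ (hAK hy₀)).2.1.le
  have hq : invRate ℓ (ENNReal.ofReal ((ξ y₀).1 / ℓ)) = invRate ℓ τ := by
    rw [invRate_of_le hτ'le, invRate_of_le hτle]
  ext z
  have hiff : z ∈ K ∧ Function.update σ y s' z < ENNReal.ofReal ((ξ y₀).1 / ℓ) ↔
      z ∈ A.erase y₀ := by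
    rw [← e2, Finset.mem_filter, hseed y₀ hy₀]
  simp only [hiff, hq]
  by_cases hz : z ∈ A.erase y₀
  · simp only [hz, if_true]
    by_cases hzy : z = y
    · subst hzy
      have : ¬ (ξ z).2 * invRate ℓ τ < W z := by
        rw [← arrival_lt_rate_iff hℓ (hW z) hyξ.2.2]
        exact not_lt.2 hMrate
      simp only [Function.update_self, this, if_true, if_false]
    · have hzS := Finset.mem_filter.1
        (Finset.mem_of_mem_insert_of_ne (Finset.mem_of_mem_erase hz) hzy)
      simp only [Function.update_of_ne hzy, hzS, hzy, if_false, and_self, if_true]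
  · simp only [hz, if_false]

end StepPathwise

/-! ### Exchanging the variables that the eviction concerns -/

section Exchange

variable {X : Type*}

theorem map_exchange_first :
    (pairLaw.prod pairLaw).map (fun p : (ℝ × ℝ) × ℝ × ℝ => ((p.2.1, p.1.2), p.2.2)) =
      pairLaw.prod stdExp := by
  have hm : Measurable fun p : (ℝ × ℝ) × ℝ × ℝ => ((p.2.1, p.1.2), p.2.2) := by fun_prop
  refine Measure.ext_of_lintegral _ fun f hf => ?_
  have hfm : Measurable fun p : (ℝ × ℝ) × ℝ × ℝ => f ((p.2.1, p.1.2), p.2.2) := hf.comp hm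
  rw [lintegral_map hf hm, lintegral_prod _ hfm.aemeasurable, lintegral_prod _ hf.aemeasurable]
  have h1 : Measurable fun a : ℝ × ℝ => ∫⁻ b, f (a, b) ∂stdExp := hf.lintegral_prod_right'
  have h2 : Measurable fun a : ℝ × ℝ => ∫⁻ b : ℝ × ℝ, f ((b.1, a.2), b.2) ∂pairLaw :=
    (hf.comp hm).lintegral_prod_right'
  have h3 : ∀ a : ℝ × ℝ, ∫⁻ b : ℝ × ℝ, f ((b.1, a.2), b.2) ∂pairLaw =
      ∫⁻ b₁, ∫⁻ b₂, f ((b₁, a.2), b₂) ∂stdExp ∂unifLaw := fun a => by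
    have hb : Measurable fun b : ℝ × ℝ => f ((b.1, a.2), b.2) := hf.comp (by fun_prop)
    unfold pairLaw
    rw [lintegral_prod _ hb.aemeasurable]
  have h4 : Measurable fun x : ℝ => ∫⁻ b₁, ∫⁻ b₂, f ((b₁, x), b₂) ∂stdExp ∂unifLaw :=
    (h1.comp measurable_swap).lintegral_prod_right'
  have h5 : Measurable fun a : ℝ × ℝ => ∫⁻ b₁, ∫⁻ b₂, f ((b₁, a.2), b₂) ∂stdExp ∂unifLaw :=
    h4.comp measurable_snd
  rw [lintegral_congr h3]
  unfold pairLaw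
  rw [lintegral_prod _ h5.aemeasurable, lintegral_prod _ h1.aemeasurable]
  simp only [lintegral_const, measure_univ, mul_one]
  rw [lintegral_lintegral_swap]
  exact (h1.comp measurable_swap).aemeasurable

theorem map_exchange_third :
    (pairLaw.prod pairLaw).map (fun p : (ℝ × ℝ) × ℝ × ℝ => (p.1, p.2.2)) =
      pairLaw.prod stdExp := by
  have h1 : pairLaw.map Prod.snd = stdExp := by
    unfold pairLaw; rw [Measure.map_snd_prod]; simp
  have h2 := Measure.map_prod_map pairLaw pairLaw measurable_id
    (measurable_snd : Measurable (Prod.snd : ℝ × ℝ → ℝ))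
  rw [Measure.map_id, h1] at h2
  exact h2.symm

theorem map_exchange_second :
    (pairLaw.prod pairLaw).map (fun p : (ℝ × ℝ) × ℝ × ℝ => (p.2, p.1.2)) =
      pairLaw.prod stdExp :=
  calc _ = ((pairLaw.prod pairLaw).map Prod.swap).map
        (fun p : (ℝ × ℝ) × ℝ × ℝ => (p.1, p.2.2)) := by
        rw [Measure.map_map (by fun_prop) measurable_swap]; rfl
    _ = _ := by rw [Measure.prod_swap, map_exchange_third]

variable [DecidableEq X]

/-- Replacement of the variables of the keys in `S` and of the hash of `y`. -/
def exchange (S : Finset X) (y : X) (ξ ζ : X → ℝ × ℝ) (z : X) : ℝ × ℝ :=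
  if z = y then ((ζ z).1, (ξ z).2) else if z ∈ S then ζ z else ξ z

theorem measurable_exchange (S : Finset X) (y : X) :
    Measurable fun p : (X → ℝ × ℝ) × (X → ℝ × ℝ) => exchange S y p.1 p.2 := by
  rw [measurable_pi_iff]
  intro z
  unfold exchange
  split_ifs <;> fun_prop

/-- Key by key, entries of two independent copies are interchanged; in each of the three cases the
product law of the selected entries is the same. -/
theorem map_exchange (S : Finset X) (y : X) :
    ((arrivalLaw X).prod (arrivalLaw X)).map (fun p => (exchange S y p.1 p.2, (p.2 y).2)) =
      (arrivalLaw X).prod stdExp := by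
  set Φ : X → (ℝ × ℝ) × ℝ × ℝ → (ℝ × ℝ) × ℝ := fun z p =>
    if z = y then ((p.2.1, p.1.2), p.2.2) else if z ∈ S then (p.2, p.1.2) else (p.1, p.2.2) with hΦ
  have hΦm : ∀ z, Measurable (Φ z) := by
    intro z; rw [hΦ]; beta_reduce
    split_ifs <;> fun_prop
  have hΦl : ∀ z, (pairLaw.prod pairLaw).map (Φ z) = pairLaw.prod stdExp := by
    intro z; rw [hΦ]; beta_reduce
    split_ifs
    · exact map_exchange_first
    · exact map_exchange_second
    · exact map_exchange_third
  have h1 := prod_infinitePi_map_pi (fun _ : X => pairLaw) (fun _ : X => pairLaw) Φ hΦm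
  simp only [hΦl] at h1
  have h2 := prod_infinitePi_map_pi (fun _ : X => pairLaw) (fun _ : X => stdExp) (fun _ p => p)
    fun _ => measurable_id
  simp only [Measure.map_id'] at h2
  have hΦ' : Measurable fun (p : (X → ℝ × ℝ) × (X → ℝ × ℝ)) (z : X) => Φ z (p.1 z, p.2 z) :=
    measurable_pi_lambda _ fun z => (hΦm z).comp (by fun_prop)
  have hzip : Measurable fun (p : (X → ℝ × ℝ) × (X → ℝ)) (z : X) => (p.1 z, p.2 z) :=
    measurable_pi_lambda _ fun z => by fun_prop
  have hπ : Measurable fun p : X → (ℝ × ℝ) × ℝ => ((fun z => (p z).1), (p y).2) :=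
    (measurable_pi_lambda _ fun z => by fun_prop).prodMk (by fun_prop)
  have h3 := congrArg (Measure.map fun p : X → (ℝ × ℝ) × ℝ => ((fun z => (p z).1), (p y).2))
    (h1.trans h2.symm)
  rw [Measure.map_map hπ hΦ', Measure.map_map hπ hzip] at h3
  have h4 := Measure.map_prod_map (Measure.infinitePi fun _ : X => pairLaw)
    (Measure.infinitePi fun _ : X => stdExp) measurable_id (measurable_pi_apply y)
  rw [Measure.map_id, Measure.infinitePi_map_eval] at h4
  unfold arrivalLaw
  rw [h4]
  refine Eq.trans ?_ h3
  congr 1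
  ext p : 1
  simp only [Function.comp_def, hΦ, if_true, Prod.mk.injEq, and_true]
  ext z : 1
  unfold exchange
  split_ifs <;> rfl

/-- The law of the sample, the entry test and the eviction draws. -/
noncomputable def stepLaw (X : Type*) : Measure ((X → ℝ × ℝ) × ℝ × (X → ℝ × ℝ)) :=
  (arrivalLaw X).prod (stdExp.prod (arrivalLaw X))

/-- Splits the randomness of a step into an outer family `ξ` and an independent family `κ`. For the
keys of `S`, `κ` supplies hash, arrival variable and eviction draws; for `y` it supplies hash, entry
variable and eviction draws, while the old arrival variable of `y` stays in `ξ`. -/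
theorem map_exchange_stepLaw (S : Finset X) (y : X) :
    ((arrivalLaw X).prod (Measure.infinitePi fun _ : X => keyLaw)).map
      (fun p => (exchange S y p.1 (fun z => (p.2 z).1), (p.2 y).1.2, fun z => (p.2 z).2)) =
      stepLaw X := by
  have hK := prod_infinitePi_map_pi (fun _ : X => pairLaw) (fun _ : X => pairLaw) (fun _ p => p)
    fun _ => measurable_id
  simp only [Measure.map_id'] at hK
  have hzip : Measurable fun (p : (X → ℝ × ℝ) × (X → ℝ × ℝ)) (z : X) => (p.1 z, p.2 z) :=
    measurable_pi_lambda _ fun z => by fun_prop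
  have h1 := Measure.map_prod_map (arrivalLaw X) ((arrivalLaw X).prod (arrivalLaw X))
    measurable_id hzip
  have hK' : ((arrivalLaw X).prod (arrivalLaw X)).map
      (fun (p : (X → ℝ × ℝ) × (X → ℝ × ℝ)) (z : X) => (p.1 z, p.2 z)) =
      Measure.infinitePi fun _ : X => keyLaw := hK
  rw [Measure.map_id, hK'] at h1
  have hex := measurable_exchange S y
  have hpair : Measurable fun p : (X → ℝ × ℝ) × (X → ℝ × ℝ) =>
      (exchange S y p.1 p.2, (p.2 y).2) := hex.prodMk (by fun_prop)
  have hR : Measurable fun p : (X → ℝ × ℝ) × (X → (ℝ × ℝ) × ℝ × ℝ) =>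
      (exchange S y p.1 (fun z => (p.2 z).1), (p.2 y).1.2, fun z => (p.2 z).2) :=
    (hex.comp (measurable_fst.prodMk (measurable_pi_lambda _ fun z => by fun_prop))).prodMk
      ((by fun_prop : Measurable _).prodMk (measurable_pi_lambda _ fun z => by fun_prop))
  have hP : Measurable (Prod.map (id : (X → ℝ × ℝ) → X → ℝ × ℝ)
      fun (p : (X → ℝ × ℝ) × (X → ℝ × ℝ)) (z : X) => (p.1 z, p.2 z)) := measurable_id.prodMap hzip
  have h2 := Measure.map_prod_map ((arrivalLaw X).prod (arrivalLaw X)) (arrivalLaw X) hpair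
    measurable_id
  rw [map_exchange, Measure.map_id] at h2
  unfold stepLaw
  rw [h1, Measure.map_map hR hP, ← Measure.prodAssoc_prod, ← Measure.prodAssoc_prod, h2,
    Measure.map_map (hR.comp hP) (by fun_prop), Measure.map_map (by fun_prop) (hpair.prodMap measurable_id)]
  rfl

end Exchange

/-! ### The event of an eviction above `1/ℓ` -/

section EvictEvent

variable {X : Type*} [DecidableEq X]

/-- When the `k` keys of `S` lie below all others, the `(k+1)`-st smallest value is the minimum over
the complement, and is `⊤` if there is none. -/
theorem kthSmallest_eq_inf {k : ℕ} {K S : Finset X} (hSK : S ⊆ K) (hS : S.card = k)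
    {σ : X → ℝ≥0∞} (h : ∀ z ∈ S, σ z < (K \ S).inf σ) :
    kthSmallest (k + 1) K σ = (K \ S).inf σ ∧ K.filter (fun z => σ z < (K \ S).inf σ) = S := by
  have hf : K.filter (fun z => σ z < (K \ S).inf σ) = S := by
    ext z
    rw [Finset.mem_filter]
    refine ⟨fun hz => ?_, fun hz => ⟨hSK hz, h z hz⟩⟩
    by_contra hzS
    exact absurd hz.2 (not_lt.2 (Finset.inf_le (Finset.mem_sdiff.2 ⟨hz.1, hzS⟩)))
  refine ⟨kthSmallest_eq (by rw [hf]; omega) ?_, hf⟩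
  rcases (K \ S).eq_empty_or_nonempty with he | hne
  · left; rw [he, Finset.inf_empty]
  · right
    obtain ⟨b, hb, hbe⟩ := Finset.exists_mem_eq_inf _ hne σ
    have hb' := Finset.mem_sdiff.1 hb
    rw [← hS, ← Finset.card_insert_of_notMem hb'.2]
    apply Finset.card_le_card
    intro z hz
    rcases Finset.mem_insert.1 hz with rfl | hz
    · exact Finset.mem_filter.2 ⟨hb'.1, hbe.ge⟩
    · exact Finset.mem_filter.2 ⟨hSK hz, (h z hz).le⟩

/-- The threshold before the eviction, in terms of the variables that the eviction does not
concern. -/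
noncomputable def thresholdOutside (ℓ : ℝ) (K S : Finset X) (W : X → ℝ) (y : X) (ξ : X → ℝ × ℝ) :
    ℝ≥0∞ := min (arrival (W y) (ξ y).2) ((K \ insert y S).inf (idealSeed ℓ W ξ))

/-- This invariance is why `thresholdOutside` uses the old arrival value of `y` and not its seed:
the seed depends on the hash of `y`, which is exchanged. -/
theorem thresholdOutside_exchange (ℓ : ℝ) (K S : Finset X) (W : X → ℝ) (y : X)
    (ξ ζ : X → ℝ × ℝ) :
    thresholdOutside ℓ K S W y (exchange S y ξ ζ) = thresholdOutside ℓ K S W y ξ := by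
  unfold thresholdOutside
  congr 1
  · simp [exchange]
  · apply Finset.inf_congr rfl
    intro z hz
    have hz' := (Finset.mem_sdiff.1 hz).2
    rw [Finset.mem_insert, not_or] at hz'
    simp [idealSeed, exchange, hz'.1, hz'.2]

/-- Above `1/ℓ` a seed and its arrival value coincide, so at such levels replacing the seed of `y`
by its arrival value does not change the minimum. -/
theorem lt_thresholdOutside_iff {ℓ : ℝ} (hℓ : 0 < ℓ) {K S : Finset X} {W : X → ℝ} {y : X}
    (hy : y ∈ K) (hyS : y ∉ S) {ξ : X → ℝ × ℝ} (hξ : (ξ y).1 ≤ 1) {t : ℝ≥0∞}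
    (ht : ENNReal.ofReal (1 / ℓ) < t) :
    thresholdOutside ℓ K S W y ξ = t ↔ (K \ S).inf (idealSeed ℓ W ξ) = t := by
  have h1 : K \ S = insert y (K \ insert y S) := by
    ext z
    by_cases hz : z = y
    · subst hz; simp [hy, hyS]
    · simp [hz]
  rw [h1, Finset.inf_insert]
  unfold thresholdOutside
  set B := (K \ insert y S).inf (idealSeed ℓ W ξ)
  have h2 : ENNReal.ofReal (1 / ℓ) < arrival (W y) (ξ y).2 →
      idealSeed ℓ W ξ y = arrival (W y) (ξ y).2 := seedOf_of_lt
  have h3 : ENNReal.ofReal (1 / ℓ) < idealSeed ℓ W ξ y →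
      idealSeed ℓ W ξ y = arrival (W y) (ξ y).2 := seedOf_eq_of_lt_seedOf hℓ hξ
  constructor
  · intro h
    rw [h2 (lt_of_lt_of_le (h ▸ ht) (min_le_left _ _))]; exact h
  · intro h
    rw [← h3 (lt_of_lt_of_le (h ▸ ht) inf_le_left)]; exact h

/-- With `keys_idealState_eq` this describes the event given the outer variables: the threshold `t`
is a constant, and the keys of `S` must satisfy the separate conditions `e_z / t < W z`. The event
is thus a product event. -/
theorem idealState_of_keys_eq {k : ℕ} {ℓ : ℝ} (hℓ : 0 < ℓ) {K S : Finset X} (hSK : S ⊆ K)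
    (hS : S.card = k) {W : X → ℝ} (hW : ∀ z, 0 ≤ W z) {y : X} (hy : y ∈ K) (hyS : y ∉ S)
    {ξ : X → ℝ × ℝ} (hξ : ∀ z ∈ K, 0 < (ξ z).1 ∧ (ξ z).1 < 1 ∧ 0 < (ξ z).2)
    (h1 : (idealState k ℓ K W ξ).2.1 = S)
    (h2 : ENNReal.ofReal (1 / ℓ) < (idealState k ℓ K W ξ).1) :
    (idealState k ℓ K W ξ).1 = thresholdOutside ℓ K S W y ξ ∧
      ∀ z ∈ S, (ξ z).2 * invRate ℓ (thresholdOutside ℓ K S W y ξ) < W z := by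
  set σ := idealSeed ℓ W ξ with hσ
  have h1 : K.filter (fun z => σ z < kthSmallest (k + 1) K σ) = S := h1
  have h2 : ENNReal.ofReal (1 / ℓ) < kthSmallest (k + 1) K σ := h2
  change kthSmallest (k + 1) K σ = _ ∧ _
  have h3 : kthSmallest (k + 1) K σ ≤ (K \ S).inf σ := by
    apply Finset.le_inf
    intro z hz
    have hz := Finset.mem_sdiff.1 hz
    exact not_lt.1 fun h => hz.2 (h1 ▸ Finset.mem_filter.2 ⟨hz.1, h⟩)
  have h4 : ∀ z ∈ S, σ z < kthSmallest (k + 1) K σ := fun z hz => by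
    rw [← h1] at hz; exact (Finset.mem_filter.1 hz).2
  have h5 := (kthSmallest_eq_inf hSK hS fun z hz => (h4 z hz).trans_le h3).1
  have h6 := (lt_thresholdOutside_iff hℓ hy hyS (hξ y hy).2.1.le h2).2 h5.symm
  refine ⟨h6.symm, fun z hz => ?_⟩
  rw [h6]
  have hzξ := hξ z (hSK hz)
  rw [← arrival_lt_rate_iff hℓ (hW z) hzξ.2.2, rate_of_lt h2]
  exact (seedOf_lt_iff_of_lt hℓ hzξ.2.1.le h2).1 (h4 z hz)

theorem keys_idealState_eq {k : ℕ} {ℓ : ℝ} (hℓ : 0 < ℓ) {K S : Finset X} (hSK : S ⊆ K)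
    (hS : S.card = k) {W : X → ℝ} (hW : ∀ z, 0 ≤ W z) {y : X} (hy : y ∈ K) (hyS : y ∉ S)
    {ξ : X → ℝ × ℝ} (hξ : ∀ z ∈ K, 0 < (ξ z).1 ∧ (ξ z).1 < 1 ∧ 0 < (ξ z).2)
    (ht : ENNReal.ofReal (1 / ℓ) < thresholdOutside ℓ K S W y ξ)
    (h1 : ∀ z ∈ S, (ξ z).2 * invRate ℓ (thresholdOutside ℓ K S W y ξ) < W z) :
    (idealState k ℓ K W ξ).1 = thresholdOutside ℓ K S W y ξ ∧
      (idealState k ℓ K W ξ).2.1 = S := by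
  set t := thresholdOutside ℓ K S W y ξ with htdef
  have h2 := (lt_thresholdOutside_iff hℓ hy hyS (hξ y hy).2.1.le ht).1 htdef.symm
  have h3 : ∀ z ∈ S, idealSeed ℓ W ξ z < (K \ S).inf (idealSeed ℓ W ξ) := by
    intro z hz
    have hzξ := hξ z (hSK hz)
    rw [h2]
    refine (seedOf_lt_iff_of_lt hℓ hzξ.2.1.le ht).2 ?_
    rw [← rate_of_lt ht, arrival_lt_rate_iff hℓ (hW z) hzξ.2.2]
    exact h1 z hz
  obtain ⟨h4, h5⟩ := kthSmallest_eq_inf hSK hS h3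
  rw [h2] at h4 h5
  refine ⟨h4, ?_⟩
  change K.filter (fun z => _ < kthSmallest (k + 1) K (idealSeed ℓ W ξ)) = S
  rw [h4]; exact h5

end EvictEvent

/-! ### Almost sure absence of ties, and the mixed sample at an eviction -/

section StepLaw

theorem ae_infinitePi_eval {ι E : Type*} [MeasurableSpace E] (μ : ι → Measure E)
    [∀ i, IsProbabilityMeasure (μ i)] (i : ι) {p : E → Prop} (h : ∀ᵐ a ∂(μ i), p a) :
    ∀ᵐ ξ ∂(Measure.infinitePi μ), p (ξ i) :=
  (measurePreserving_eval_infinitePi μ i).quasiMeasurePreserving.ae h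

/-- Given the coordinate `b`, the coordinate `a` is independent of it and avoids the prescribed
value almost surely. -/
theorem ae_infinitePi_ne {ι E γ : Type*} [MeasurableSpace E] (μ : ι → Measure E)
    [∀ i, IsProbabilityMeasure (μ i)] {a b : ι} (hab : a ≠ b) {F G : E → γ}
    (hm : MeasurableSet {p : E × E | F p.1 = G p.2}) (h : ∀ c, ∀ᵐ v ∂(μ a), F v ≠ c) :
    ∀ᵐ ξ ∂(Measure.infinitePi μ), F (ξ a) ≠ G (ξ b) := by
  classical
  have hms : MeasurableSet {ξ : ι → E | F (ξ a) = G (ξ b)} :=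
    hm.preimage (f := fun ξ : ι → E => (ξ a, ξ b)) (by fun_prop)
  rw [ae_iff]
  simp only [not_not]
  rw [← lintegral_indicator_one hms, lintegral_infinitePi_update _ a (measurable_one.indicator hms),
    lintegral_eq_zero_iff']
  · refine ae_of_all _ fun ξ => ?_
    have h2 : Measurable fun v => Set.indicator {ξ : ι → E | F (ξ a) = G (ξ b)}
        (1 : (ι → E) → ℝ≥0∞) (Function.update ξ a v) :=
      (measurable_one.indicator hms).comp (measurable_update ξ)
    refine (lintegral_eq_zero_iff' h2.aemeasurable).2 ?_
    filter_upwards [h (G (ξ b))] with v hv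
    refine Set.indicator_of_notMem (fun h3 => hv ?_) _
    have h3 : F (Function.update ξ a v a) = G (Function.update ξ a v b) := h3
    rwa [Function.update_self, Function.update_of_ne hab.symm] at h3
  · exact (((measurable_one.indicator hms).comp (measurable_update_pair a)).lintegral_prod_right'
      (ν := μ a)).aemeasurable

variable {X : Type*} [DecidableEq X]

omit [DecidableEq X] in
theorem ae_arrivalLaw_mem (K : Finset X) :
    ∀ᵐ ξ ∂(arrivalLaw X), ∀ z ∈ K, 0 < (ξ z).1 ∧ (ξ z).1 < 1 ∧ 0 < (ξ z).2 := by
  simp only [Filter.eventually_all_finset]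
  exact fun z _ => ae_infinitePi_eval (fun _ : X => pairLaw) z ae_pairLaw

omit [DecidableEq X] in
theorem ae_arrivalLaw_hash_ne (K : Finset X) :
    ∀ᵐ ξ ∂(arrivalLaw X), ∀ a ∈ K, ∀ b ∈ K, a ≠ b → (ξ a).1 ≠ (ξ b).1 := by
  simp only [Filter.eventually_all_finset]
  intro a _ b _
  by_cases hab : a = b
  · exact ae_of_all _ fun _ h => absurd hab h
  · have := ae_infinitePi_ne (fun _ : X => pairLaw) hab (F := Prod.fst) (G := Prod.fst)
      (measurableSet_eq_fun (by fun_prop) (by fun_prop)) fun c =>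
        Measure.quasiMeasurePreserving_fst.ae
          (by simp [ae_iff, measure_singleton] : ∀ᵐ u ∂unifLaw, u ≠ c)
    filter_upwards [this] with ξ h _ using h

-- The exception for `⊤` is needed: keys of weight `0` all have that seed.
omit [DecidableEq X] in
theorem ae_arrivalLaw_seed_ne {ℓ : ℝ} (hℓ : 0 < ℓ) {W : X → ℝ} (hW : ∀ z, 0 ≤ W z)
    (K : Finset X) :
    ∀ᵐ ξ ∂(arrivalLaw X), ∀ a ∈ K, ∀ b ∈ K, a ≠ b → idealSeed ℓ W ξ a = idealSeed ℓ W ξ b →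
      idealSeed ℓ W ξ a = ⊤ := by
  have hm : ∀ z, Measurable fun v : ℝ × ℝ => seedOf ℓ (arrival (W z) v.2) v.1 := fun z =>
    (measurable_seedOf ℓ).comp (((measurable_arrival (W z)).comp (by fun_prop)).prodMk
      (by fun_prop))
  have h1 : ∀ a b, a ≠ b → 0 < W a → ∀ᵐ ξ ∂(arrivalLaw X),
      idealSeed ℓ W ξ a ≠ idealSeed ℓ W ξ b := fun a b hab ha =>
    ae_infinitePi_ne (fun _ : X => pairLaw) hab
      (F := fun v => seedOf ℓ (arrival (W a) v.2) v.1)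
      (G := fun v => seedOf ℓ (arrival (W b) v.2) v.1)
      (measurableSet_eq_fun ((hm a).comp measurable_fst) ((hm b).comp measurable_snd))
      (ae_seedOf_ne hℓ ha)
  simp only [Filter.eventually_all_finset]
  intro a ha b hb
  by_cases hab : a = b
  · exact ae_of_all _ fun _ h => absurd hab h
  rcases (hW a).eq_or_lt with h | h
  · filter_upwards [ae_arrivalLaw_mem K] with ξ hξ _ _
    rw [idealSeed, ← h, arrival_zero (hξ a ha).2.2, seedOf_eq_top_iff]
  · filter_upwards [h1 a b hab h] with ξ hξ _ h2 using absurd h2 hξ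

theorem idealState_eq_of_keys {k : ℕ} {ℓ : ℝ} {K S : Finset X} {W : X → ℝ} {ξ : X → ℝ × ℝ}
    {t : ℝ≥0∞} (h1 : (idealState k ℓ K W ξ).1 = t) (h2 : (idealState k ℓ K W ξ).2.1 = S) :
    idealState k ℓ K W ξ = (t, S, fun z => if z ∈ S then W z - (ξ z).2 * invRate ℓ t else 0) := by
  subst h1 h2
  unfold idealState bottomSample
  simp only [Prod.mk.injEq, true_and]
  ext z
  simp only [Finset.mem_filter]

/-- The uncached `y` has old arrival value at least `t`, while the new one is below `t`, so the new
one is the minimum. The new threshold is below `t` as well; the old elements of `y` still fail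
there, and its counter comes from the new element. -/
theorem mixedState_of_evict {k : ℕ} {ℓ : ℝ} (hℓ : 0 < ℓ) {K S : Finset X} {W : X → ℝ}
    (hW : ∀ z, 0 ≤ W z) {y : X} (hy : y ∈ K) (hyS : y ∉ S) (hS : S.card = k) {w : ℝ} (hw : 0 < w)
    {ξ : X → ℝ × ℝ} (hξ : 0 < (ξ y).1 ∧ (ξ y).1 < 1 ∧ 0 < (ξ y).2) {e₀ : ℝ} (he₀ : 0 < e₀)
    {t : ℝ≥0∞} (ht : ENNReal.ofReal (1 / ℓ) < t) (h1 : (idealState k ℓ K W ξ).1 = t)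
    (h2 : (idealState k ℓ K W ξ).2.1 = S) (h3 : e₀ * invRate ℓ t < w) {f : X → ℝ≥0∞}
    (hf : f = Function.update (idealSeed ℓ W ξ) y (seedOf ℓ (arrival w e₀) (ξ y).1)) {y₀ : X}
    (hy₀ : y₀ ∈ insert y S) (hmax : ∀ z ∈ (insert y S).erase y₀, f z < f y₀) :
    mixedState k ℓ K W y w ξ e₀ = (f y₀, (insert y S).erase y₀, fun z =>
      if z ∈ (insert y S).erase y₀ then
        if z = y then w - e₀ * invRate ℓ (f y₀) else W z - (ξ z).2 * invRate ℓ (f y₀)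
      else 0) := by
  have h1 : kthSmallest (k + 1) K (idealSeed ℓ W ξ) = t := h1
  have h2 : K.filter (fun z => idealSeed ℓ W ξ z < kthSmallest (k + 1) K (idealSeed ℓ W ξ)) = S :=
    h2
  have hty : t ≤ idealSeed ℓ W ξ y := by
    rw [← h1]
    exact not_lt.1 fun h => hyS (h2 ▸ Finset.mem_filter.2 ⟨hy, h⟩)
  have hMy : idealSeed ℓ W ξ y = arrival (W y) (ξ y).2 :=
    seedOf_eq_of_lt_seedOf hℓ hξ.2.1.le (ht.trans_le hty)
  have hv : arrival w e₀ < t := by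
    rw [← rate_of_lt ht, arrival_lt_rate_iff hℓ hw.le he₀]; exact h3
  have hmin : min (arrival (W y) (ξ y).2) (arrival w e₀) = arrival w e₀ :=
    min_eq_right (hv.le.trans (hMy ▸ hty))
  have hlt : seedOf ℓ (arrival w e₀) (ξ y).1 < t := (seedOf_lt_iff_of_lt hℓ hξ.2.1.le ht).2 hv
  unfold mixedState
  rw [hmin, ← hf]
  obtain ⟨e1, e2⟩ := kthSmallest_update_evict (σ := idealSeed ℓ W ξ) hy (h1 ▸ hty) (h1 ▸ hlt)
    (A := insert y S) (by rw [h2]) (by rw [Finset.card_insert_of_notMem hyS, hS]) hy₀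
    (by rw [← hf]; exact hmax)
  rw [← hf] at e1 e2
  have hft : f y₀ < t := by
    rw [hf]
    by_cases hz : y₀ = y
    · subst hz; rw [Function.update_self]; exact hlt
    · rw [Function.update_of_ne hz]
      have := Finset.mem_of_mem_insert_of_ne hy₀ hz
      rw [← h2] at this
      exact h1 ▸ (Finset.mem_filter.1 this).2
  have hny : ¬ (ξ y).2 * invRate ℓ (f y₀) < W y := by
    rw [← arrival_lt_rate_iff hℓ (hW y) hξ.2.2, not_lt, ← hMy]
    refine le_trans ?_ hty
    rw [← rate_of_lt ht]
    exact max_le_max_left _ hft.le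
  unfold bottomSample
  rw [e1, e2]
  simp only [Prod.mk.injEq, true_and]
  ext z
  have hiff : z ∈ K ∧ f z < f y₀ ↔ z ∈ (insert y S).erase y₀ := by
    rw [← e2, Finset.mem_filter]
  simp only [hiff, hny, if_false]

end StepLaw

/-! ### The law of one step of the algorithm -/

section StepIntegral

variable {X : Type*} [DecidableEq X]

/-- The element `(y,w)` triggers an eviction from `S` at a threshold above `1/ℓ`. -/
def EvictsAbove (k : ℕ) (ℓ : ℝ) (K : Finset X) (W : X → ℝ) (w : ℝ) (S : Finset X)
    (ξ : X → ℝ × ℝ) (e₀ : ℝ) : Prop :=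
  (idealState k ℓ K W ξ).2.1 = S ∧ ENNReal.ofReal (1 / ℓ) < (idealState k ℓ K W ξ).1 ∧
    e₀ * invRate ℓ (idealState k ℓ K W ξ).1 < w

theorem measurableSet_evictsAbove (k : ℕ) (ℓ : ℝ) (K : Finset X) (W : X → ℝ) (w : ℝ)
    (S : Finset X) : MeasurableSet {p : (X → ℝ × ℝ) × ℝ × (X → ℝ × ℝ) |
      EvictsAbove k ℓ K W w S p.1 p.2.1} := by
  have h := (measurableState_idealState k ℓ K W).comp
    (measurable_fst : Measurable (Prod.fst : (X → ℝ × ℝ) × ℝ × (X → ℝ × ℝ) → _))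
  have hq := measurable_invRate ℓ
  have h1 := h.threshold
  exact measurableSet_and (h.keys S) (measurableSet_and (measurableSet_lt measurable_const h1)
    (measurableSet_lt (by fun_prop) measurable_const))

theorem measurable_stepTest (k : ℕ) (ℓ : ℝ) (K : Finset X) (W : X → ℝ) (y : X) (w : ℝ)
    {g : Finset X → ℝ≥0∞ × (X → ℝ) × (X → ℝ) → ℝ≥0∞} (hg : ∀ S, Measurable (g S)) :
    Measurable fun p : (X → ℝ × ℝ) × ℝ × (X → ℝ × ℝ) =>
      evalTest g (stepState k ℓ y w (idealState k ℓ K W p.1) (fun z => (p.1 z).1) p.2.1 p.2.2)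
        (fun z => (p.1 z).1) := by
  have hh : Measurable fun p : (X → ℝ × ℝ) × ℝ × (X → ℝ × ℝ) => fun z => (p.1 z).1 :=
    measurable_pi_lambda _ fun z => by fun_prop
  exact (measurableState_stepState k ℓ y w ((measurableState_idealState k ℓ K W).comp
    measurable_fst) hh (by fun_prop) (by fun_prop)).evalTest hh hg

theorem measurable_mixedTest (k : ℕ) (ℓ : ℝ) (K : Finset X) (W : X → ℝ) (y : X) (w : ℝ)
    {g : Finset X → ℝ≥0∞ × (X → ℝ) × (X → ℝ) → ℝ≥0∞} (hg : ∀ S, Measurable (g S)) :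
    Measurable fun p : (X → ℝ × ℝ) × ℝ × (X → ℝ × ℝ) =>
      evalTest g (mixedState k ℓ K W y w p.1 p.2.1) (fun z => (p.1 z).1) := by
  have hh : Measurable fun p : (X → ℝ × ℝ) × ℝ × (X → ℝ × ℝ) => fun z => (p.1 z).1 :=
    measurable_pi_lambda _ fun z => by fun_prop
  exact ((measurableState_mixedState k ℓ K W y w).comp (g := fun p : (X → ℝ × ℝ) × ℝ ×
    (X → ℝ × ℝ) => (p.1, p.2.1)) (by fun_prop)).evalTest hh hg

theorem stepState_of_evictsAbove {k : ℕ} {ℓ : ℝ} (hℓ : 0 < ℓ) {K S : Finset X} {W : X → ℝ} {y : X}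
    (hyS : y ∉ S) (hS : S.card = k) {w : ℝ} {ξ : X → ℝ × ℝ} {e₀ : ℝ}
    {t : ℝ≥0∞} (ht : ENNReal.ofReal (1 / ℓ) < t) (h1 : (idealState k ℓ K W ξ).1 = t)
    (h2 : (idealState k ℓ K W ξ).2.1 = S) (h3 : e₀ * invRate ℓ t < w) (h : X → ℝ)
    (η : X → ℝ × ℝ) :
    stepState k ℓ y w (idealState k ℓ K W ξ) h e₀ η = evictState ℓ t (insert y S)
      (Function.update (fun z => if z ∈ S then W z - (ξ z).2 * invRate ℓ t else 0) y
        (w - e₀ * invRate ℓ t)) h η := by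
  rw [idealState_eq_of_keys h1 h2, stepState, if_neg hyS,
    if_pos ⟨h3, Or.inl ((one_lt_mul_ofReal_iff hℓ t).2 ht)⟩,
    if_pos (by rw [Finset.card_insert_of_notMem hyS, hS])]

-- After the exchange and given `ξ`, the threshold `t` is constant and the cached keys have counters
-- `ω z - e_z / t` conditioned to be positive. This is the setting of `lintegral_evictState`, which
-- replaces the redrawn seeds by those of the arrival variables; the outcome is then the mixed
-- sample.
open Classical in
theorem lintegral_evictsAbove {k : ℕ} {ℓ : ℝ} (hℓ : 0 < ℓ) {K S : Finset X} (hSK : S ⊆ K)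
    (hS : S.card = k) {W : X → ℝ} (hW : ∀ z, 0 ≤ W z) {y : X} (hy : y ∈ K) (hyS : y ∉ S) {w : ℝ}
    (hw : 0 < w) {g : Finset X → ℝ≥0∞ × (X → ℝ) × (X → ℝ) → ℝ≥0∞} (hg : ∀ S, Measurable (g S)) :
    ∫⁻ p, (if EvictsAbove k ℓ K W w S p.1 p.2.1 then evalTest g (stepState k ℓ y w
      (idealState k ℓ K W p.1) (fun z => (p.1 z).1) p.2.1 p.2.2) (fun z => (p.1 z).1) else 0)
      ∂(stepLaw X) =
    ∫⁻ p, (if EvictsAbove k ℓ K W w S p.1 p.2.1 then evalTest g (mixedState k ℓ K W y w p.1 p.2.1)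
      (fun z => (p.1 z).1) else 0) ∂(stepLaw X) := by
  set A := insert y S with hA
  have hyA : y ∈ A := Finset.mem_insert_self _ _
  have hAK : A ⊆ K := Finset.insert_subset hy hSK
  -- The counter of `y` starts from the new element alone; the old elements of `y` enter only
  -- through `t`.
  set ω := Function.update W y w with hω
  have hm1 : Measurable fun p : (X → ℝ × ℝ) × ℝ × (X → ℝ × ℝ) =>
      if EvictsAbove k ℓ K W w S p.1 p.2.1 then evalTest g (stepState k ℓ y w
        (idealState k ℓ K W p.1) (fun z => (p.1 z).1) p.2.1 p.2.2) (fun z => (p.1 z).1) else 0 :=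
    Measurable.ite (measurableSet_evictsAbove k ℓ K W w S) (measurable_stepTest k ℓ K W y w hg)
      measurable_const
  have hm2 : Measurable fun p : (X → ℝ × ℝ) × ℝ × (X → ℝ × ℝ) =>
      if EvictsAbove k ℓ K W w S p.1 p.2.1 then evalTest g (mixedState k ℓ K W y w p.1 p.2.1)
        (fun z => (p.1 z).1) else 0 :=
    Measurable.ite (measurableSet_evictsAbove k ℓ K W w S) (measurable_mixedTest k ℓ K W y w hg)
      measurable_const
  have hR : Measurable fun p : (X → ℝ × ℝ) × (X → (ℝ × ℝ) × ℝ × ℝ) =>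
      (exchange S y p.1 (fun z => (p.2 z).1), (p.2 y).1.2, fun z => (p.2 z).2) :=
    ((measurable_exchange S y).comp (measurable_fst.prodMk
      (measurable_pi_lambda _ fun z => by fun_prop))).prodMk
      ((by fun_prop : Measurable _).prodMk (measurable_pi_lambda _ fun z => by fun_prop))
  have hm1R := hm1.comp hR
  have hm2R := hm2.comp hR
  simp only [Function.comp_def] at hm1R hm2R
  rw [← map_exchange_stepLaw S y, lintegral_map hm1 hR, lintegral_map hm2 hR,
    lintegral_prod _ hm1R.aemeasurable, lintegral_prod _ hm2R.aemeasurable]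
  apply lintegral_congr_ae
  filter_upwards [ae_arrivalLaw_mem K] with ξ hξ
  set t := thresholdOutside ℓ K S W y ξ with ht
  set ex : (X → (ℝ × ℝ) × ℝ × ℝ) → X → ℝ × ℝ := fun κ => exchange S y ξ fun z => (κ z).1 with hex
  have hexS : ∀ κ, ∀ z ∈ S, ex κ z = (κ z).1 := fun κ z hz => by
    have : z ≠ y := fun h => hyS (h ▸ hz)
    simp [hex, exchange, this, hz]
  have hexy : ∀ κ, ex κ y = ((κ y).1.1, (ξ y).2) := fun κ => by simp [hex, exchange]
  have hexO : ∀ κ, ∀ z, z ∉ A → ex κ z = ξ z := fun κ z hz => by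
    rw [hA, Finset.mem_insert, not_or] at hz
    simp [hex, exchange, hz.1, hz.2]
  have hext : ∀ κ, thresholdOutside ℓ K S W y (ex κ) = t := fun κ =>
    thresholdOutside_exchange ℓ K S W y ξ _
  have hωS : ∀ z ∈ S, ω z = W z := fun z hz => by
    have : z ≠ y := fun h => hyS (h ▸ hz)
    exact Function.update_of_ne this _ _
  have hωy : ω y = w := Function.update_self _ _ _
  have hhash : ∀ κ, (fun z => (ex κ z).1) = fun z => if z ∈ A then (κ z).1.1 else (ξ z).1 := by
    intro κ
    ext z
    by_cases hz : z ∈ A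
    · rw [if_pos hz]
      rcases Finset.mem_insert.1 hz with rfl | hz
      · rw [hexy]
      · rw [hexS κ z hz]
    · rw [if_neg hz, hexO κ z hz]
  have hgood : ∀ᵐ κ ∂(Measure.infinitePi fun _ : X => keyLaw), ∀ z ∈ K,
      0 < (κ z).1.1 ∧ (κ z).1.1 < 1 ∧ 0 < (κ z).1.2 := by
    simp only [Filter.eventually_all_finset]
    exact fun z _ => ae_infinitePi_eval (fun _ : X => keyLaw) z
      (Measure.quasiMeasurePreserving_fst.ae ae_pairLaw)
  have hexgood : ∀ κ : X → (ℝ × ℝ) × ℝ × ℝ,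
      (∀ z ∈ K, 0 < (κ z).1.1 ∧ (κ z).1.1 < 1 ∧ 0 < (κ z).1.2) →
      ∀ z ∈ K, 0 < (ex κ z).1 ∧ (ex κ z).1 < 1 ∧ 0 < (ex κ z).2 := by
    intro κ hκ z hz
    by_cases hzA : z ∈ A
    · rcases Finset.mem_insert.1 hzA with rfl | hzS
      · rw [hexy]; exact ⟨(hκ z hz).1, (hκ z hz).2.1, (hξ z hz).2.2⟩
      · rw [hexS κ z hzS]; exact hκ z hz
    · rw [hexO κ z hzA]; exact hξ z hz
  -- If the outer threshold is not above `1/ℓ`, the event does not occur, up to a null set, and both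
  -- integrands vanish.
  by_cases htℓ : ENNReal.ofReal (1 / ℓ) < t
  swap
  · apply lintegral_congr_ae
    filter_upwards [hgood] with κ hκ
    have : ¬ EvictsAbove k ℓ K W w S (ex κ) (κ y).1.2 := by
      rintro ⟨h1, h2, -⟩
      have h3 := (idealState_of_keys_eq hℓ hSK hS hW hy hyS (hexgood κ hκ) h1 h2).1
      rw [hext] at h3
      exact htℓ (h3 ▸ h2)
    rw [if_neg this, if_neg this]
  have hev : ∀ κ : X → (ℝ × ℝ) × ℝ × ℝ,
      (∀ z ∈ K, 0 < (κ z).1.1 ∧ (κ z).1.1 < 1 ∧ 0 < (κ z).1.2) →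
      (EvictsAbove k ℓ K W w S (ex κ) (κ y).1.2 ↔ ∀ z ∈ A, (κ z).1.2 * invRate ℓ t < ω z) := by
    intro κ hκ
    constructor
    · rintro ⟨h1, h2, h3⟩ z hz
      obtain ⟨h4, h5⟩ := idealState_of_keys_eq hℓ hSK hS hW hy hyS (hexgood κ hκ) h1 h2
      rw [hext] at h4 h5
      rcases Finset.mem_insert.1 hz with rfl | hz
      · rw [hωy, ← h4]; exact h3
      · rw [hωS z hz, ← hexS κ z hz]; exact h5 z hz
    · intro h
      obtain ⟨h4, h5⟩ := keys_idealState_eq hℓ hSK hS hW hy hyS (hexgood κ hκ)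
        (by rw [hext]; exact htℓ) (by
          intro z hz
          rw [hext, hexS κ z hz, ← hωS z hz]
          exact h z (Finset.mem_insert_of_mem hz))
      rw [hext] at h4
      exact ⟨h5, h4 ▸ htℓ, by rw [h4, ← hωy]; exact h y hyA⟩
  have hidl : ∀ κ, EvictsAbove k ℓ K W w S (ex κ) (κ y).1.2 →
      (∀ z ∈ K, 0 < (κ z).1.1 ∧ (κ z).1.1 < 1 ∧ 0 < (κ z).1.2) →
      (idealState k ℓ K W (ex κ)).1 = t := fun κ h hκ => by
    rw [← hext κ]
    exact (idealState_of_keys_eq hℓ hSK hS hW hy hyS (hexgood κ hκ) h.1 h.2.1).1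
  set st : (X → (ℝ × ℝ) × ℝ × ℝ) → ℝ≥0∞ × Finset X × (X → ℝ) := fun κ => evictState ℓ t A
    (fun z => if z ∈ A then ω z - (κ z).1.2 * invRate ℓ t else 0)
    (fun z => if z ∈ A then (κ z).1.1 else (ξ z).1) (fun z => (κ z).2) with hst
  have hL : ∫⁻ κ, (if EvictsAbove k ℓ K W w S (ex κ) (κ y).1.2 then evalTest g (stepState k ℓ y w
      (idealState k ℓ K W (ex κ)) (fun z => (ex κ z).1) (κ y).1.2 fun z => (κ z).2)
      (fun z => (ex κ z).1) else 0) ∂(Measure.infinitePi fun _ : X => keyLaw) =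
      ∫⁻ κ, (if ∀ z ∈ A, (κ z).1.2 * invRate ℓ t < ω z then
        g (st κ).2.1 ((st κ).1, (st κ).2.2, fun z => if z ∈ A then (κ z).1.1 else (ξ z).1) else 0)
        ∂(Measure.infinitePi fun _ : X => keyLaw) := by
    apply lintegral_congr_ae
    filter_upwards [hgood] with κ hκ
    by_cases h : EvictsAbove k ℓ K W w S (ex κ) (κ y).1.2
    · rw [if_pos h, if_pos ((hev κ hκ).1 h), hhash]
      have h1 := hidl κ h hκ
      have h2 : stepState k ℓ y w (idealState k ℓ K W (ex κ))
          (fun z => if z ∈ A then (κ z).1.1 else (ξ z).1) (κ y).1.2 (fun z => (κ z).2) = st κ := by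
        rw [stepState_of_evictsAbove hℓ hyS hS htℓ h1 h.1 (by rw [← h1]; exact h.2.2), hst]
        congr 1
        ext z
        by_cases hzy : z = y
        · subst hzy
          rw [Function.update_self, if_pos hyA, hωy]
        · rw [Function.update_of_ne hzy]
          by_cases hz : z ∈ S
          · rw [if_pos hz, if_pos (Finset.mem_insert_of_mem hz), hexS κ z hz, hωS z hz]
          · rw [if_neg hz, if_neg (by rw [hA, Finset.mem_insert]; tauto)]
      rw [h2]; rfl
    · rw [if_neg h, if_neg (fun h' => h ((hev κ hκ).2 h'))]
  refine hL.trans ?_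
  rw [lintegral_evictState hℓ htℓ ⟨y, hyA⟩ ω (fun z => (ξ z).1) hg st fun κ => rfl,
    ← lintegral_finsetSum _ fun y₀ _ => measurable_evictTerm A _ ω _ hg
      (fun z => measurable_seedArrival ℓ (ω z)) (fun z => measurable_counterArrival ℓ (ω z)) y₀]
  have hne : ∀ᵐ κ ∂(Measure.infinitePi fun _ : X => keyLaw), ∀ a ∈ A, ∀ b ∈ A, a ≠ b → 0 < ω a →
      seedArrival ℓ (ω a) (κ a) ≠ seedArrival ℓ (ω b) (κ b) := by
    simp only [Filter.eventually_all_finset]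
    intro a _ b _
    by_cases hab : a = b
    · exact ae_of_all _ fun _ h => absurd hab h
    by_cases ha : 0 < ω a
    · have := ae_infinitePi_ne (fun _ : X => keyLaw) hab
        (F := seedArrival ℓ (ω a)) (G := seedArrival ℓ (ω b))
        (measurableSet_eq_fun ((measurable_seedArrival ℓ _).comp measurable_fst)
          ((measurable_seedArrival ℓ _).comp measurable_snd))
        fun c => Measure.quasiMeasurePreserving_fst.ae (ae_seedOf_ne hℓ ha c)
      filter_upwards [this] with κ h _ _ using h
    · exact ae_of_all _ fun _ _ h => absurd h ha
  apply lintegral_congr_ae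
  filter_upwards [hgood, hne] with κ hκ hκne
  by_cases h : ∀ z ∈ A, (κ z).1.2 * invRate ℓ t < ω z
  swap
  · rw [if_neg (fun h' => h ((hev κ hκ).1 h'))]
    apply Finset.sum_eq_zero
    intro y₀ _
    unfold evictTerm
    rw [if_neg fun h' => h h'.1]
  have hE := (hev κ hκ).2 h
  rw [if_pos hE]
  have hpos : ∀ z ∈ A, 0 < ω z := fun z hz =>
    (mul_nonneg (hκ z (hAK hz)).2.2.le (invRate_nonneg ℓ t)).trans_lt (h z hz)
  obtain ⟨y₀, hy₀, hmax⟩ := exists_strict_max (f := fun z => seedArrival ℓ (ω z) (κ z)) ⟨y, hyA⟩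
    fun a ha b hb hab => hκne a ha b hb hab (hpos a ha)
  have hterm : ∀ b ∈ A, evictTerm A (invRate ℓ t) ω (fun z => (ξ z).1) g
      (fun z => seedArrival ℓ (ω z)) (fun z => counterArrival ℓ (ω z)) b κ =
      if ∀ z ∈ A.erase b, seedArrival ℓ (ω z) (κ z) < seedArrival ℓ (ω b) (κ b) then
        g (A.erase b) (seedArrival ℓ (ω b) (κ b), fun z => if z ∈ A.erase b then
          counterArrival ℓ (ω z) (seedArrival ℓ (ω b) (κ b)) (κ z) else 0,
          fun z => if z ∈ A then (κ z).1.1 else (ξ z).1) else 0 := fun b _ => by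
    unfold evictTerm
    exact if_congr (and_iff_right h) rfl rfl
  rw [Finset.sum_congr rfl hterm, sum_strict_max (f := fun z => seedArrival ℓ (ω z) (κ z)) hy₀ hmax]
  set f : X → ℝ≥0∞ := Function.update (idealSeed ℓ W (ex κ)) y
    (seedOf ℓ (arrival w (κ y).1.2) (ex κ y).1) with hf
  have hfA : ∀ z ∈ A, f z = seedArrival ℓ (ω z) (κ z) := by
    intro z hz
    rcases Finset.mem_insert.1 hz with rfl | hzS
    · rw [hf, Function.update_self, hωy, hexy]; rfl
    · have : z ≠ y := fun h => hyS (h ▸ hzS)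
      rw [hf, Function.update_of_ne this, hωS z hzS, idealSeed, hexS κ z hzS]; rfl
  have hmixed := mixedState_of_evict hℓ hW hy hyS hS hw (hexgood κ hκ y hy) (hκ y hy).2.2 htℓ
    (hidl κ hE hκ) hE.1 (by rw [← hωy]; exact h y hyA) hf hy₀ (fun z hz => by
      rw [hfA z (Finset.mem_of_mem_erase hz), hfA y₀ hy₀]; exact hmax z hz)
  rw [hfA y₀ hy₀] at hmixed
  rw [hhash, hmixed]
  unfold evalTest
  congr 3
  ext z
  dsimp only
  rw [← hA]
  by_cases hz : z ∈ A.erase y₀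
  · rw [if_pos hz, if_pos hz]
    rcases Finset.mem_insert.1 (Finset.mem_of_mem_erase hz) with rfl | hzS
    · rw [if_pos rfl, hωy]; rfl
    · have : z ≠ y := fun h => hyS (h ▸ hzS)
      rw [if_neg this, hωS z hzS, hexS κ z hzS]; rfl
  · rw [if_neg hz, if_neg hz]

open Classical in
/-- Processing an element `(y,w)` of the stream acts on the law of the ideal sample as taking the
first arrival among old and new elements of `y`. -/
theorem lintegral_stepState {k : ℕ} {ℓ : ℝ} (hℓ : 0 < ℓ) {K : Finset X} {W : X → ℝ}
    (hW : ∀ z, 0 ≤ W z) {y : X} (hy : y ∈ K) {w : ℝ} (hw : 0 < w)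
    {g : Finset X → ℝ≥0∞ × (X → ℝ) × (X → ℝ) → ℝ≥0∞} (hg : ∀ S, Measurable (g S)) :
    ∫⁻ p, evalTest g (stepState k ℓ y w (idealState k ℓ K W p.1) (fun z => (p.1 z).1) p.2.1 p.2.2)
      (fun z => (p.1 z).1) ∂(stepLaw X) =
    ∫⁻ p, evalTest g (mixedState k ℓ K W y w p.1 p.2.1) (fun z => (p.1 z).1) ∂(stepLaw X) := by
  set 𝓕 := (K.powersetCard k).filter (y ∉ ·) with h𝓕
  set U : (X → ℝ × ℝ) × ℝ × (X → ℝ × ℝ) → ℝ≥0∞ := fun p => evalTest g (stepState k ℓ y w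
    (idealState k ℓ K W p.1) (fun z => (p.1 z).1) p.2.1 p.2.2) (fun z => (p.1 z).1) with hU
  set V : (X → ℝ × ℝ) × ℝ × (X → ℝ × ℝ) → ℝ≥0∞ := fun p =>
    evalTest g (mixedState k ℓ K W y w p.1 p.2.1) (fun z => (p.1 z).1) with hV
  have hUm : Measurable U := measurable_stepTest k ℓ K W y w hg
  have hVm : Measurable V := measurable_mixedTest k ℓ K W y w hg
  set E : (X → ℝ × ℝ) × ℝ × (X → ℝ × ℝ) → Prop := fun p =>
    ∃ S ∈ 𝓕, EvictsAbove k ℓ K W w S p.1 p.2.1 with hE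
  have hEm : MeasurableSet {p | E p} := by
    have : {p | E p} = ⋃ S ∈ 𝓕, {p | EvictsAbove k ℓ K W w S p.1 p.2.1} := by
      ext p
      simp only [Set.mem_iUnion, Set.mem_ofPred_eq, hE, exists_prop]
    rw [this]
    exact Finset.measurableSet_biUnion 𝓕 fun S _ => measurableSet_evictsAbove k ℓ K W w S
  -- The events for different `S` are disjoint since each prescribes the key set. On their
  -- complement the pathwise identity applies.
  have hsplit : ∀ U : (X → ℝ × ℝ) × ℝ × (X → ℝ × ℝ) → ℝ≥0∞, Measurable U →
      ∫⁻ p, U p ∂(stepLaw X) = ∑ S ∈ 𝓕, ∫⁻ p,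
        (if EvictsAbove k ℓ K W w S p.1 p.2.1 then U p else 0) ∂(stepLaw X) +
        ∫⁻ p, (if E p then 0 else U p) ∂(stepLaw X) := by
    intro U hUm
    rw [← lintegral_finsetSum _ fun S _ => Measurable.ite (measurableSet_evictsAbove k ℓ K W w S)
      hUm measurable_const, ← lintegral_add_right _ (Measurable.ite hEm measurable_const hUm)]
    refine lintegral_congr fun p => ?_
    by_cases hp : E p
    · obtain ⟨S, hS, hSE⟩ := hp
      have hE' : E p := ⟨S, hS, hSE⟩
      rw [if_pos hE', Finset.sum_eq_single_of_mem S hS, if_pos hSE, add_zero]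
      intro S' _ hne
      exact if_neg fun h => hne (h.1.symm.trans hSE.1)
    · rw [if_neg hp, Finset.sum_eq_zero, zero_add]
      exact fun S hS => if_neg fun h => hp ⟨S, hS, h⟩
  rw [hsplit U hUm, hsplit V hVm]
  congr 1
  · refine Finset.sum_congr rfl fun S hS => ?_
    obtain ⟨h1, h2⟩ := Finset.mem_filter.1 hS
    obtain ⟨h3, h4⟩ := Finset.mem_powersetCard.1 h1
    exact lintegral_evictsAbove hℓ h3 h4 hW hy h2 hw hg
  · have hξ : ∀ {q : (X → ℝ × ℝ) → Prop}, (∀ᵐ ξ ∂(arrivalLaw X), q ξ) →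
        ∀ᵐ p ∂(stepLaw X), q p.1 := fun h => Measure.quasiMeasurePreserving_fst.ae h
    have he : ∀ {q : ℝ → Prop}, (∀ᵐ e ∂stdExp, q e) → ∀ᵐ p ∂(stepLaw X), q p.2.1 := fun h =>
      Measure.quasiMeasurePreserving_snd.ae (Measure.quasiMeasurePreserving_fst.ae h)
    have hM : ∀ᵐ ξ ∂(arrivalLaw X), arrival (W y) (ξ y).2 ≠ ENNReal.ofReal (1 / ℓ) :=
      ae_infinitePi_eval (fun _ : X => pairLaw) y (Measure.quasiMeasurePreserving_snd.ae
        (ae_arrival_ne (hW y) _ fun _ => ENNReal.ofReal_ne_top))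
    apply lintegral_congr_ae
    filter_upwards [hξ (ae_arrivalLaw_mem K), hξ (ae_arrivalLaw_hash_ne K),
      hξ (ae_arrivalLaw_seed_ne hℓ hW K), hξ hM, he ae_stdExp_pos,
      he (ae_arrival_ne hw.le (ENNReal.ofReal (1 / ℓ)) fun _ => ENNReal.ofReal_ne_top)]
      with p h1 h2 h3 h4 h5 h6
    by_cases hp : E p
    · rw [if_pos hp, if_pos hp]
    · rw [if_neg hp, if_neg hp, hU, hV]
      beta_reduce
      rw [stepState_eq_mixedState hℓ hW hy hw h1 h5 h3 h2 h4 h6 p.2.2]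
      rintro ⟨h7, h8, h9, h10⟩
      exact hp ⟨_, Finset.mem_filter.2 ⟨Finset.mem_powersetCard.2
        ⟨Finset.filter_subset _ _, h8⟩, h7⟩, rfl, h9, h10⟩

/-- Processing an element `(y,w)` of the stream turns the law of the ideal sample into the law of
the ideal sample for the increased weight of `y`. -/
theorem lintegral_stepState_eq_idealState {k : ℕ} (hk : 1 ≤ k) {ℓ : ℝ} (hℓ : 0 < ℓ) {K : Finset X}
    {W : X → ℝ} (hW : ∀ z, 0 ≤ W z) {y : X} (hy : y ∈ K) {w : ℝ} (hw : 0 < w)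
    {g : Finset X → ℝ≥0∞ × (X → ℝ) × (X → ℝ) → ℝ≥0∞} (hg : ∀ S, Measurable (g S)) :
    ∫⁻ p, evalTest g (stepState k ℓ y w (idealState k ℓ K W p.1) (fun z => (p.1 z).1) p.2.1 p.2.2)
      (fun z => (p.1 z).1) ∂(stepLaw X) =
    ∫⁻ ξ, evalTest g (idealState k ℓ K (Function.update W y (W y + w)) ξ) (fun z => (ξ z).1)
        ∂(arrivalLaw X) := by
  have hm := measurable_mixedTest k ℓ K W y w hg
  have h1 : ∫⁻ p, evalTest g (mixedState k ℓ K W y w p.1 p.2.1) (fun z => (p.1 z).1) ∂(stepLaw X) =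
      ∫⁻ ξ, ∫⁻ q, evalTest g (mixedState k ℓ K W y w ξ q.1) (fun z => (ξ z).1)
        ∂(stdExp.prod (arrivalLaw X)) ∂(arrivalLaw X) := lintegral_prod _ hm.aemeasurable
  have h2 : ∀ ξ : X → ℝ × ℝ, ∫⁻ q, evalTest g (mixedState k ℓ K W y w ξ q.1) (fun z => (ξ z).1)
        ∂(stdExp.prod (arrivalLaw X)) = ∫⁻ e, evalTest g (mixedState k ℓ K W y w ξ e)
          (fun z => (ξ z).1) ∂stdExp := by
    intro ξ
    have hm' : Measurable fun p : ℝ × (X → ℝ × ℝ) =>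
        evalTest g (mixedState k ℓ K W y w ξ p.1) fun z => (ξ z).1 :=
      ((measurableState_mixedState k ℓ K W y w).comp (g := fun p : ℝ × (X → ℝ × ℝ) => (ξ, p.1))
        (measurable_const.prodMk measurable_fst)).evalTest measurable_const hg
    rw [lintegral_prod _ hm'.aemeasurable]
    refine lintegral_congr fun e => ?_
    dsimp only
    rw [lintegral_const, measure_univ, mul_one]
  rw [lintegral_stepState hℓ hW hy hw hg, h1, lintegral_congr h2]
  exact lintegral_mixedState hk hℓ hy (hW y) hw hg

end StepIntegral

/-! ### Independence of functions of disjoint coordinates -/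

section Blocks

variable {ι E α β : Type*} [MeasurableSpace E] [MeasurableSpace α] [MeasurableSpace β]

/-- Functions of disjoint sets of coordinates are independent. -/
theorem lintegral_infinitePi_blocks (μ : ι → Measure E) [∀ i, IsProbabilityMeasure (μ i)]
    (s : Set ι) {G : (ι → E) → β} (hG : Measurable G)
    (hGs : ∀ t t', (∀ i ∈ s, t i = t' i) → G t = G t') {Q : (ι → E) → β → ℝ≥0∞}
    (hQ : Measurable fun p : (ι → E) × β => Q p.1 p.2)
    (hQs : ∀ t t' b, (∀ i ∉ s, t i = t' i) → Q t b = Q t' b) :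
    ∫⁻ t, Q t (G t) ∂(Measure.infinitePi μ) =
      ∫⁻ t, ∫⁻ b, Q t b ∂((Measure.infinitePi μ).map G) ∂(Measure.infinitePi μ) := by
  classical
  have hm : Measurable fun t => Q t (G t) := hQ.comp (measurable_id.prodMk hG)
  rw [lintegral_infinitePi_mix μ s hm]
  refine lintegral_congr fun t => ?_
  have hQt : Measurable (Q t) := hQ.comp measurable_prodMk_left
  rw [lintegral_map hQt hG]
  refine lintegral_congr fun t' => ?_
  rw [hGs _ t' fun i hi => Set.piecewise_eq_of_mem _ _ _ hi,
    hQs _ t _ fun i hi => Set.piecewise_eq_of_notMem _ _ _ hi]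

theorem infinitePi_map_blocks (μ : ι → Measure E) [∀ i, IsProbabilityMeasure (μ i)]
    (s : Set ι) {F : (ι → E) → α} (hF : Measurable F) {G : (ι → E) → β} (hG : Measurable G)
    (hFs : ∀ t t', (∀ i ∉ s, t i = t' i) → F t = F t')
    (hGs : ∀ t t', (∀ i ∈ s, t i = t' i) → G t = G t') :
    (Measure.infinitePi μ).map (fun t => (F t, G t)) =
      ((Measure.infinitePi μ).map F).prod ((Measure.infinitePi μ).map G) := by
  have := Measure.isProbabilityMeasure_map (μ := Measure.infinitePi μ) hF.aemeasurable
  have := Measure.isProbabilityMeasure_map (μ := Measure.infinitePi μ) hG.aemeasurable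
  refine Measure.ext_of_lintegral _ fun f hf => ?_
  rw [lintegral_map hf (hF.prodMk hG), lintegral_prod _ hf.aemeasurable,
    lintegral_map (Measurable.lintegral_prod_right' hf) hF]
  exact lintegral_infinitePi_blocks μ s hG hGs (Q := fun t b => f (F t, b))
    (hf.comp ((hF.comp measurable_fst).prodMk measurable_snd)) fun t t' b h => by rw [hFs t t' h]

theorem infinitePi_map_reindex {κ : Type*} (μ : Measure E) [IsProbabilityMeasure μ]
    {r : κ → ι} (hr : Function.Injective r) {φ : E → β} (hφ : Measurable φ) :
    (Measure.infinitePi fun _ : ι => μ).map (fun t z => φ (t (r z))) =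
      Measure.infinitePi fun _ : κ => μ.map φ := by
  have h1 : iIndepFun (fun (i : ι) (t : ι → E) => t i) (Measure.infinitePi fun _ : ι => μ) :=
    iIndepFun_infinitePi (X := fun _ a => a) fun _ => measurable_id
  have h2 := ((h1.precomp hr).comp (fun _ => φ) fun _ => hφ).map_fun_eq_infinitePi_map
    fun z => hφ.comp (measurable_pi_apply _)
  refine h2.trans ?_
  congr 1
  ext z : 1
  rw [← Measure.map_map hφ (measurable_pi_apply _), Measure.infinitePi_map_eval]

end Blocks

/-! ### The state of the fixed-size algorithm has the law of the ideal sample -/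

section Algorithm

variable {X : Type*}

/-- The law of the tape. -/
noncomputable def tapeLaw (X : Type*) : Measure (Draw X → ℝ) := Measure.infinitePi fun _ => unifLaw

instance : IsProbabilityMeasure (tapeLaw X) := by unfold tapeLaw; infer_instance

theorem tapeLaw_map_hash :
    (tapeLaw X).map (fun t z => t (.hash z)) = Measure.infinitePi fun _ : X => unifLaw := by
  have := infinitePi_map_reindex unifLaw (r := (Draw.hash : X → Draw X))
    (fun a b h => by injection h) measurable_id
  rwa [Measure.map_id] at this

theorem arrivalLaw_map_hash :
    (arrivalLaw X).map (fun ξ z => (ξ z).1) = Measure.infinitePi fun _ : X => unifLaw := by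
  have := infinitePi_map_reindex pairLaw (r := (id : X → X)) Function.injective_id measurable_fst
  have h1 : pairLaw.map Prod.fst = unifLaw := by
    unfold pairLaw; rw [Measure.map_fst_prod]; simp
  rw [h1] at this
  exact this

/-- The draws for the processing of the `i`-th element. -/
noncomputable def freshDraws (i : ℕ) (t : Draw X → ℝ) : ℝ × (X → ℝ × ℝ) :=
  (expOf (t (.entry i)), fun z => (t (.evictU i z), expOf (t (.evictR i z))))

theorem measurable_freshDraws (i : ℕ) :
    Measurable (freshDraws i : (Draw X → ℝ) → ℝ × (X → ℝ × ℝ)) :=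
  (measurable_expOf.comp (measurable_pi_apply _)).prodMk (measurable_pi_lambda _ fun _ =>
    (measurable_pi_apply _).prodMk (measurable_expOf.comp (measurable_pi_apply _)))

theorem tapeLaw_map_freshDraws (i : ℕ) :
    (tapeLaw X).map (freshDraws i) = stdExp.prod (arrivalLaw X) := by
  have hE : (tapeLaw X).map (fun t => expOf (t (.entry i))) = stdExp := by
    have h := Measure.map_map (μ := tapeLaw X) measurable_expOf
      (measurable_pi_apply (Draw.entry i : Draw X))
    unfold tapeLaw at h ⊢
    rw [Measure.infinitePi_map_eval, map_expOf] at h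
    exact h.symm
  have hU : (tapeLaw X).map (fun t z => t (.evictU i z)) =
      Measure.infinitePi fun _ : X => unifLaw := by
    have := infinitePi_map_reindex unifLaw (r := (Draw.evictU i : X → Draw X))
      (fun a b h => by injection h) measurable_id
    rwa [Measure.map_id] at this
  have hR : (tapeLaw X).map (fun t z => expOf (t (.evictR i z))) =
      Measure.infinitePi fun _ : X => stdExp := by
    have := infinitePi_map_reindex unifLaw (r := (Draw.evictR i : X → Draw X))
      (fun a b h => by injection h) measurable_expOf
    rwa [map_expOf] at this
  have hmU : Measurable fun (t : Draw X → ℝ) (z : X) => t (.evictU i z) :=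
    measurable_pi_lambda _ fun z => measurable_pi_apply _
  have hmR : Measurable fun (t : Draw X → ℝ) (z : X) => expOf (t (.evictR i z)) :=
    measurable_pi_lambda _ fun z => measurable_expOf.comp (measurable_pi_apply _)
  have hzip : Measurable fun (p : (X → ℝ) × (X → ℝ)) (z : X) => (p.1 z, p.2 z) :=
    measurable_pi_lambda _ fun z => by fun_prop
  have hη : (tapeLaw X).map (fun t z => (t (.evictU i z), expOf (t (.evictR i z)))) =
      arrivalLaw X := by
    have h1 := infinitePi_map_blocks (fun _ : Draw X => unifLaw)
      (Set.range fun z => Draw.evictR i z) hmU hmR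
      (fun t t' h => by
        ext z
        refine h _ ?_
        rintro ⟨a, ha⟩
        simp at ha)
      (fun t t' h => by
        ext z
        rw [h _ ⟨z, rfl⟩])
    have h2 := congrArg (Measure.map fun (p : (X → ℝ) × (X → ℝ)) (z : X) => (p.1 z, p.2 z)) h1
    rw [Measure.map_map hzip (hmU.prodMk hmR)] at h2
    refine h2.trans ?_
    unfold tapeLaw at hU hR
    rw [hU, hR]
    have h3 := prod_infinitePi_map_pi (fun _ : X => unifLaw) (fun _ : X => stdExp) (fun _ p => p)
      fun _ => measurable_id
    simp only [Measure.map_id'] at h3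
    exact h3
  have h1 := infinitePi_map_blocks (fun _ : Draw X => unifLaw)
    (F := fun t => expOf (t (.entry i)))
    (G := fun (t : Draw X → ℝ) (z : X) => (t (.evictU i z), expOf (t (.evictR i z))))
    {Draw.entry i}ᶜ (measurable_expOf.comp (measurable_pi_apply _))
    (measurable_freshDraws i).snd
    (fun t t' h => by rw [h _ (by simp)])
    (fun t t' h => by
      ext z : 1
      rw [h _ (by simp), h _ (by simp)])
  refine h1.trans ?_
  unfold tapeLaw at hE hη
  rw [hE, hη]

variable [DecidableEq X]

theorem evict_congr (ℓ : ℝ) {t t' : Draw X → ℝ} {i : ℕ} (hh : ∀ z, t (.hash z) = t' (.hash z))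
    (hU : ∀ z, t (.evictU i z) = t' (.evictU i z)) (hR : ∀ z, t (.evictR i z) = t' (.evictR i z))
    (s : ℝ≥0∞ × Counters X) : evict ℓ t i s = evict ℓ t' i s := by
  unfold evict keyBase
  simp only [hh, hU, hR]

theorem fixedSizeStep_congr (k : ℕ) (ℓ : ℝ) {t t' : Draw X → ℝ} {i : ℕ}
    (hh : ∀ z, t (.hash z) = t' (.hash z)) (hE : t (.entry i) = t' (.entry i))
    (hU : ∀ z, t (.evictU i z) = t' (.evictU i z)) (hR : ∀ z, t (.evictR i z) = t' (.evictR i z))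
    (y : X) (w : ℝ) (s : ℝ≥0∞ × Counters X) :
    fixedSizeStep k ℓ t i y w s = fixedSizeStep k ℓ t' i y w s := by
  unfold fixedSizeStep keyBase
  simp only [hh, hE, evict_congr ℓ hh hU hR]

theorem fixedSizeRun_congr (k : ℕ) (ℓ : ℝ) (key : ℕ → X) (wt : ℕ → ℝ) {t t' : Draw X → ℝ}
    (hh : ∀ z, t (.hash z) = t' (.hash z)) (i : ℕ)
    (hE : ∀ j < i, t (.entry j) = t' (.entry j))
    (hU : ∀ j < i, ∀ z, t (.evictU j z) = t' (.evictU j z))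
    (hR : ∀ j < i, ∀ z, t (.evictR j z) = t' (.evictR j z)) :
    fixedSizeRun k ℓ key wt t i = fixedSizeRun k ℓ key wt t' i := by
  induction i with
  | zero => rfl
  | succ i ih =>
    rw [fixedSizeRun, fixedSizeRun, ih (fun j hj => hE j (by omega)) (fun j hj => hU j (by omega))
      (fun j hj => hR j (by omega)), fixedSizeStep_congr k ℓ hh (hE i (by omega))
      (hU i (by omega)) (hR i (by omega))]

theorem measurableState_fixedSizeRun (k : ℕ) (ℓ : ℝ) (key : ℕ → X) (wt : ℕ → ℝ) (i : ℕ) :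
    MeasurableState fun t : Draw X → ℝ => visible (fixedSizeRun k ℓ key wt t i) := by
  induction i with
  | zero =>
    exact measurableState_mk (τ := fun _ => ⊤) (c := fun _ => Counters.empty.count)
      measurable_const measurable_const ∅
  | succ i ih =>
    simp only [fixedSizeRun, visible_step]
    exact measurableState_stepState k ℓ (key i) (wt i) ih
      (measurable_pi_lambda _ fun z => measurable_pi_apply _)
      (measurable_freshDraws i).fst (measurable_freshDraws i).snd

theorem keyWeight_zero (key : ℕ → X) (wt : ℕ → ℝ) : keyWeight key wt 0 = 0 := by
  ext z; simp [keyWeight]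

theorem keyWeight_succ (key : ℕ → X) (wt : ℕ → ℝ) (i : ℕ) :
    keyWeight key wt (i + 1) =
      Function.update (keyWeight key wt i) (key i) (keyWeight key wt i (key i) + wt i) := by
  ext z
  unfold keyWeight
  rw [Finset.range_add_one, Finset.filter_insert]
  by_cases h : key i = z
  · subst h
    rw [if_pos rfl, Finset.sum_insert (by simp), Function.update_self, add_comm]
  · rw [if_neg h, Function.update_of_ne (Ne.symm h)]

theorem keyWeight_nonneg (key : ℕ → X) {wt : ℕ → ℝ} (hwt : ∀ i, 0 < wt i) (n : ℕ) (z : X) :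
    0 ≤ keyWeight key wt n z := Finset.sum_nonneg fun i _ => (hwt i).le

/-- The law of the state of the fixed-size algorithm is the law of the bottom-`k` sample. -/
theorem lintegral_fixedSizeRun {k : ℕ} (hk : 1 ≤ k) {ℓ : ℝ} (hℓ : 0 < ℓ) (key : ℕ → X) {wt : ℕ → ℝ}
    (hwt : ∀ i, 0 < wt i) {K : Finset X} (i : ℕ) (hK : ∀ j < i, key j ∈ K)
    {g : Finset X → ℝ≥0∞ × (X → ℝ) × (X → ℝ) → ℝ≥0∞} (hg : ∀ S, Measurable (g S)) :
    ∫⁻ t, evalTest g (visible (fixedSizeRun k ℓ key wt t i)) (fun z => t (.hash z)) ∂(tapeLaw X) =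
      ∫⁻ ξ, evalTest g (idealState k ℓ K (keyWeight key wt i) ξ) (fun z => (ξ z).1)
        ∂(arrivalLaw X) := by
  induction i generalizing g with
  | zero =>
    have h0 : Measurable fun h : X → ℝ => g ∅ (⊤, 0, h) :=
      (hg ∅).comp (measurable_const.prodMk (measurable_const.prodMk measurable_id))
    have h1 : ∀ t : Draw X → ℝ, evalTest g (visible (fixedSizeRun k ℓ key wt t 0))
        (fun z => t (.hash z)) = g ∅ (⊤, 0, fun z => t (.hash z)) := fun t => by
      have : (Counters.empty : Counters X).count = 0 := by
        ext z; simp [Counters.count, Counters.empty]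
      simp only [evalTest, fixedSizeRun, visible, this]
      rfl
    have h2 : ∀ᵐ ξ ∂(arrivalLaw X), evalTest g (idealState k ℓ K (keyWeight key wt 0) ξ)
        (fun z => (ξ z).1) = g ∅ (⊤, 0, fun z => (ξ z).1) := by
      -- With all weights zero every seed is `⊤`: the sample is empty, its threshold is `⊤`, and
      -- only the hashes remain.
      filter_upwards [ae_arrivalLaw_mem K] with ξ hξ
      have hs : ∀ z ∈ K, idealSeed ℓ (0 : X → ℝ) ξ z = ⊤ := fun z hz => by
        rw [idealSeed, seedOf_eq_top_iff, Pi.zero_apply, arrival_zero (hξ z hz).2.2]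
      have hf : K.filter (fun z => idealSeed ℓ (0 : X → ℝ) ξ z < ⊤) = ∅ := by
        apply Finset.filter_eq_empty_iff.2
        intro z hz
        rw [hs z hz]; exact lt_irrefl _
      have hkth : kthSmallest (k + 1) K (idealSeed ℓ (0 : X → ℝ) ξ) = ⊤ :=
        kthSmallest_eq (by rw [hf]; simp) (Or.inl rfl)
      have hst : (idealState k ℓ K (0 : X → ℝ) ξ).2.1 = ∅ := by
        change K.filter (fun z => _ < kthSmallest (k + 1) K _) = ∅
        rw [hkth]; exact hf
      rw [keyWeight_zero, idealState_eq_of_keys hkth hst]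
      simp only [evalTest, Finset.notMem_empty, if_false]
      rfl
    have hm1 : Measurable fun (t : Draw X → ℝ) (z : X) => t (.hash z) :=
      measurable_pi_lambda _ fun z => measurable_pi_apply _
    have hm2 : Measurable fun (ξ : X → ℝ × ℝ) (z : X) => (ξ z).1 :=
      measurable_pi_lambda _ fun z => (measurable_pi_apply z).fst
    rw [lintegral_congr h1, lintegral_congr_ae h2,
      ← lintegral_map (f := fun h : X → ℝ => g ∅ (⊤, 0, h)) h0 hm1,
      ← lintegral_map (f := fun h : X → ℝ => g ∅ (⊤, 0, h)) h0 hm2, tapeLaw_map_hash,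
      arrivalLaw_map_hash]
  | succ i ih =>
    set y := key i with hy
    set w := wt i with hw
    have hmh : Measurable fun (t : Draw X → ℝ) (z : X) => t (.hash z) :=
      measurable_pi_lambda _ fun z => measurable_pi_apply _
    -- The fresh draws of element `i` are integrated out, which gives a test function of the state
    -- and hashes before it. The induction hypothesis is applied to this function, hence the
    -- generalization over `g`.
    set g' : Finset X → ℝ≥0∞ × (X → ℝ) × (X → ℝ) → ℝ≥0∞ := fun S a =>
      ∫⁻ b, evalTest g (stepState k ℓ y w (a.1, S, a.2.1) a.2.2 b.1 b.2) a.2.2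
        ∂(stdExp.prod (arrivalLaw X)) with hg'
    have hg'm : ∀ S, Measurable (g' S) := fun S => by
      have h1 : MeasurableState fun p : (ℝ≥0∞ × (X → ℝ) × (X → ℝ)) × ℝ × (X → ℝ × ℝ) =>
          stepState k ℓ y w (p.1.1, S, p.1.2.1) p.1.2.2 p.2.1 p.2.2 :=
        measurableState_stepState k ℓ y w (measurableState_mk measurable_fst.fst
          measurable_fst.snd.fst S) measurable_fst.snd.snd measurable_snd.fst measurable_snd.snd
      exact (h1.evalTest measurable_fst.snd.snd hg).lintegral_prod_right'
        (ν := stdExp.prod (arrivalLaw X))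
    have hrun : MeasurableState fun p : (Draw X → ℝ) × ℝ × (X → ℝ × ℝ) =>
        stepState k ℓ y w (visible (fixedSizeRun k ℓ key wt p.1 i)) (fun z => p.1 (.hash z)) p.2.1
          p.2.2 :=
      measurableState_stepState k ℓ y w ((measurableState_fixedSizeRun k ℓ key wt i).comp
        measurable_fst) (hmh.comp measurable_fst) measurable_snd.fst measurable_snd.snd
    have hQ : Measurable fun p : (Draw X → ℝ) × ℝ × (X → ℝ × ℝ) => evalTest g
        (stepState k ℓ y w (visible (fixedSizeRun k ℓ key wt p.1 i)) (fun z => p.1 (.hash z)) p.2.1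
          p.2.2) (fun z => p.1 (.hash z)) := hrun.evalTest (hmh.comp measurable_fst) hg
    -- The draws made at element `i`. The earlier run and the hashes use no coordinate in this set,
    -- so they are independent of the fresh draws.
    set s : Set (Draw X) := {d | d = .entry i ∨ (∃ z, d = .evictU i z) ∨ ∃ z, d = .evictR i z}
      with hs
    have hsE : Draw.entry i ∈ s := Or.inl rfl
    have hsU : ∀ z, Draw.evictU i z ∈ s := fun z => Or.inr (Or.inl ⟨z, rfl⟩)
    have hsR : ∀ z, Draw.evictR i z ∈ s := fun z => Or.inr (Or.inr ⟨z, rfl⟩)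
    have hnH : ∀ z, Draw.hash z ∉ s := fun z h => by
      rcases h with h | ⟨a, h⟩ | ⟨a, h⟩ <;> simp at h
    have hnE : ∀ j < i, Draw.entry j ∉ s := fun j hj h => by
      rcases h with h | ⟨a, h⟩ | ⟨a, h⟩ <;> simp at h
      omega
    have hnU : ∀ j < i, ∀ z, Draw.evictU j z ∉ s := fun j hj z h => by
      rcases h with h | ⟨a, h⟩ | ⟨a, h⟩ <;> simp at h
      omega
    have hnR : ∀ j < i, ∀ z, Draw.evictR j z ∉ s := fun j hj z h => by
      rcases h with h | ⟨a, h⟩ | ⟨a, h⟩ <;> simp at h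
      omega
    have key1 := lintegral_infinitePi_blocks (fun _ : Draw X => unifLaw) s
      (measurable_freshDraws i)
      (fun t t' h => by
        unfold freshDraws
        simp only [h _ hsE, h _ (hsU _), h _ (hsR _)])
      (Q := fun t b => evalTest g (stepState k ℓ y w (visible (fixedSizeRun k ℓ key wt t i))
        (fun z => t (.hash z)) b.1 b.2) (fun z => t (.hash z))) hQ
      (fun t t' b h => by
        rw [fixedSizeRun_congr k ℓ key wt (fun z => h _ (hnH z)) i (fun j hj => h _ (hnE j hj))
          (fun j hj z => h _ (hnU j hj z)) (fun j hj z => h _ (hnR j hj z))]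
        simp only [h _ (hnH _)])
    have hfresh := tapeLaw_map_freshDraws (X := X) i
    unfold tapeLaw at hfresh
    rw [hfresh] at key1
    have hih := ih (fun j hj => hK j (by omega)) hg'm
    have hT := lintegral_stepState_eq_idealState hk hℓ (keyWeight_nonneg key hwt i)
      (hK i (by omega)) (hwt i) hg
    have hmT := measurable_stepTest k ℓ K (keyWeight key wt i) y w hg
    have hT2 : ∫⁻ p, evalTest g (stepState k ℓ y w (idealState k ℓ K (keyWeight key wt i) p.1)
        (fun z => (p.1 z).1) p.2.1 p.2.2) (fun z => (p.1 z).1) ∂(stepLaw X) =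
        ∫⁻ ξ, evalTest g' (idealState k ℓ K (keyWeight key wt i) ξ) (fun z => (ξ z).1)
          ∂(arrivalLaw X) := lintegral_prod _ hmT.aemeasurable
    rw [keyWeight_succ, ← hT, hT2, ← hih]
    refine Eq.trans ?_ (key1.trans ?_)
    · refine lintegral_congr fun t => ?_
      rw [fixedSizeRun, visible_step]; rfl
    · rfl

end Algorithm

/-! ### Minima of the element variables versus arrival values -/

section ScoreLaw

variable {X : Type*}

/-- The law of the draw `d` behind the scores. -/
noncomputable def scoreDrawLaw (wt : ℕ → ℝ) : ScoreDraw X → Measure ℝ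
  | .hash _ => unifLaw
  | .exp i => expMeasure (wt i)

theorem isProbabilityMeasure_scoreDrawLaw {wt : ℕ → ℝ} (hwt : ∀ i, 0 < wt i) (d : ScoreDraw X) :
    IsProbabilityMeasure (scoreDrawLaw wt d) := by
  cases d with
  | hash z => exact inferInstanceAs (IsProbabilityMeasure unifLaw)
  | exp i => exact isProbabilityMeasure_expMeasure (hwt i)

/-- The hashes and the arrival variables of the keys that have weights `W`. -/
noncomputable def arrivals (W : X → ℝ) (ξ : X → ℝ × ℝ) (z : X) : ℝ × ℝ≥0∞ :=
  ((ξ z).1, arrival (W z) (ξ z).2)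

theorem measurable_arrivals (W : X → ℝ) : Measurable (arrivals W) :=
  measurable_pi_lambda _ fun z => (measurable_pi_apply z).fst.prodMk
    ((measurable_arrival (W z)).comp (measurable_pi_apply z).snd)

variable [DecidableEq X]

/-- The hashes of the keys and the minima of the exponential variables of their elements. -/
noncomputable def minima (key : ℕ → X) (n : ℕ) (t : ScoreDraw X → ℝ) (z : X) : ℝ × ℝ≥0∞ :=
  (t (.hash z), ((Finset.range n).filter (fun i => key i = z)).inf
    fun i => ENNReal.ofReal (t (.exp i)))

theorem minima_succ (key : ℕ → X) (n : ℕ) (t : ScoreDraw X → ℝ) :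
    minima key (n + 1) t = Function.update (minima key n t) (key n)
      (t (.hash (key n)), min (minima key n t (key n)).2 (ENNReal.ofReal (t (.exp n)))) := by
  ext z : 1
  unfold minima
  rw [Finset.range_add_one, Finset.filter_insert]
  by_cases h : key n = z
  · subst h
    rw [if_pos rfl, Finset.inf_insert, Function.update_self, inf_comm]
  · rw [if_neg h, Function.update_of_ne (Ne.symm h)]

theorem measurable_minima (key : ℕ → X) (n : ℕ) : Measurable (minima key n) := by
  induction n with
  | zero =>
    refine measurable_pi_lambda _ fun z => ?_
    simp only [minima, Finset.range_zero, Finset.filter_empty, Finset.inf_empty]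
    exact (measurable_pi_apply _).prodMk measurable_const
  | succ n ih =>
    have h : (fun t => minima key (n + 1) t) = fun t => _ := funext fun t => minima_succ key n t
    rw [show minima key (n + 1) = _ from h]
    refine (measurable_update_pair (key n)).comp (ih.prodMk ((measurable_pi_apply _).prodMk ?_))
    exact ((measurable_pi_apply (key n)).comp ih).snd.min (measurable_pi_apply _).ennreal_ofReal

/-- Only the coordinate `y` changes, and there `map_min_arrival` merges the old weight with the new
one. This is the induction step of `lintegral_minima`. -/
theorem lintegral_arrivals_update {W : X → ℝ} {y : X} (hW : 0 ≤ W y) {w : ℝ} (hw : 0 < w)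
    {f : (X → ℝ × ℝ≥0∞) → ℝ≥0∞} (hf : Measurable f) :
    ∫⁻ ξ, ∫⁻ e₀, f (Function.update (arrivals W ξ) y
      ((ξ y).1, min (arrivals W ξ y).2 (arrival w e₀))) ∂stdExp ∂(arrivalLaw X) =
    ∫⁻ ξ, f (arrivals (Function.update W y (W y + w)) ξ) ∂(arrivalLaw X) := by
  have hm1 : Measurable fun p : (X → ℝ × ℝ) × ℝ => f (Function.update (arrivals W p.1) y
      ((p.1 y).1, min (arrivals W p.1 y).2 (arrival w p.2))) := by
    have ha := (measurable_arrivals W).comp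
      (measurable_fst : Measurable (Prod.fst : (X → ℝ × ℝ) × ℝ → _))
    exact hf.comp ((measurable_update_pair y).comp (ha.prodMk
      (((measurable_pi_apply y).comp measurable_fst).fst.prodMk
        (((measurable_pi_apply y).comp ha).snd.min ((measurable_arrival w).comp measurable_snd)))))
  have hm1' : Measurable fun ξ : X → ℝ × ℝ => ∫⁻ e₀, f (Function.update (arrivals W ξ) y
      ((ξ y).1, min (arrivals W ξ y).2 (arrival w e₀))) ∂stdExp := hm1.lintegral_prod_right'
  have hm2 : Measurable fun ξ : X → ℝ × ℝ => f (arrivals (Function.update W y (W y + w)) ξ) :=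
    hf.comp (measurable_arrivals _)
  unfold arrivalLaw
  rw [lintegral_infinitePi_update _ y hm1', lintegral_infinitePi_update _ y hm2]
  refine lintegral_congr fun ξ => ?_
  have e1 : ∀ a e₀, Function.update (arrivals W (Function.update ξ y a)) y
      ((Function.update ξ y a y).1, min (arrivals W (Function.update ξ y a) y).2 (arrival w e₀)) =
      Function.update (arrivals W ξ) y (a.1, min (arrival (W y) a.2) (arrival w e₀)) := by
    intro a e₀
    ext z : 1
    by_cases hz : z = y
    · subst hz; simp [arrivals]
    · simp [arrivals, hz]
  have e2 : ∀ a, arrivals (Function.update W y (W y + w)) (Function.update ξ y a) =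
      Function.update (arrivals W ξ) y (a.1, arrival (W y + w) a.2) := by
    intro a
    ext z : 1
    by_cases hz : z = y
    · subst hz; simp [arrivals]
    · simp [arrivals, hz]
  set F : ℝ → ℝ≥0∞ → ℝ≥0∞ := fun h m => f (Function.update (arrivals W ξ) y (h, m)) with hF
  have hFm : Measurable fun p : ℝ × ℝ≥0∞ => F p.1 p.2 := hf.comp (measurable_update _)
  have hF1 : ∀ h, Measurable (F h) := fun h => hFm.comp measurable_prodMk_left
  simp only [e1, e2]
  change ∫⁻ a, ∫⁻ e₀, F a.1 (min (arrival (W y) a.2) (arrival w e₀)) ∂stdExp ∂pairLaw =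
    ∫⁻ a, F a.1 (arrival (W y + w) a.2) ∂pairLaw
  have hmA : Measurable fun a : ℝ × ℝ => ∫⁻ e₀, F a.1 (min (arrival (W y) a.2) (arrival w e₀))
      ∂stdExp := by
    have : Measurable fun p : (ℝ × ℝ) × ℝ => F p.1.1 (min (arrival (W y) p.1.2) (arrival w p.2)) :=
      hFm.comp (measurable_fst.fst.prodMk (((measurable_arrival (W y)).comp measurable_fst.snd).min
        ((measurable_arrival w).comp measurable_snd)))
    exact this.lintegral_prod_right'
  have hmB : Measurable fun a : ℝ × ℝ => F a.1 (arrival (W y + w) a.2) :=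
    hFm.comp (measurable_fst.prodMk ((measurable_arrival _).comp measurable_snd))
  unfold pairLaw
  rw [lintegral_prod _ hmA.aemeasurable, lintegral_prod _ hmB.aemeasurable]
  refine lintegral_congr fun h => ?_
  have hmin : Measurable fun p : ℝ × ℝ => min (arrival (W y) p.1) (arrival w p.2) :=
    ((measurable_arrival (W y)).comp measurable_fst).min
      ((measurable_arrival w).comp measurable_snd)
  have hc : Measurable fun p : ℝ × ℝ => F h (min (arrival (W y) p.1) (arrival w p.2)) :=
    (hF1 h).comp hmin
  have h3 := lintegral_map (μ := stdExp.prod stdExp) (hF1 h) hmin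
  rw [map_min_arrival hW hw, lintegral_map (hF1 h) (measurable_arrival _),
    lintegral_prod _ hc.aemeasurable] at h3
  exact h3.symm

/-- The minima of exponential variables have the law of the arrival variables. -/
theorem lintegral_minima (key : ℕ → X) {wt : ℕ → ℝ} (hwt : ∀ i, 0 < wt i) (n : ℕ)
    {f : (X → ℝ × ℝ≥0∞) → ℝ≥0∞} (hf : Measurable f) :
    ∫⁻ t, f (minima key n t) ∂(Measure.infinitePi (scoreDrawLaw wt)) =
      ∫⁻ ξ, f (arrivals (keyWeight key wt n) ξ) ∂(arrivalLaw X) := by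
  have hprob := isProbabilityMeasure_scoreDrawLaw (X := X) hwt
  induction n generalizing f with
  | zero =>
    have hh : Measurable fun u : ℝ => (u, (⊤ : ℝ≥0∞)) := by fun_prop
    have h1 : (Measure.infinitePi (scoreDrawLaw wt)).map (minima key 0) =
        Measure.infinitePi fun _ : X => unifLaw.map fun u => (u, (⊤ : ℝ≥0∞)) := by
      have e1 := Measure.map_infinitePi_infinitePi_of_inj (P := scoreDrawLaw wt)
        (f := (ScoreDraw.hash : X → ScoreDraw X)) fun a b h => by injection h
      have e2 := Measure.infinitePi_map_pi (fun _ : X => unifLaw)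
        (f := fun _ u => (u, (⊤ : ℝ≥0∞))) fun _ => hh
      have e3 : Measure.infinitePi (fun z : X => scoreDrawLaw wt (.hash z)) =
        Measure.infinitePi fun _ : X => unifLaw := rfl
      have hA : Measurable fun (a : X → ℝ) (z : X) => (a z, (⊤ : ℝ≥0∞)) :=
        measurable_pi_lambda _ fun z => hh.comp (measurable_pi_apply z)
      have hB : Measurable fun (t : ScoreDraw X → ℝ) (z : X) => t (.hash z) :=
        measurable_pi_lambda _ fun z => measurable_pi_apply _
      have e4 := Measure.map_map (μ := Measure.infinitePi (scoreDrawLaw wt)) hA hB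
      rw [e1] at e4
      refine Eq.trans ?_ (e4.symm.trans e2)
      congr 1
    have h2 : (arrivalLaw X).map (arrivals (keyWeight key wt 0)) =
        Measure.infinitePi fun _ : X => unifLaw.map fun u => (u, (⊤ : ℝ≥0∞)) := by
      have e1 := Measure.infinitePi_map_pi (fun _ : X => pairLaw)
        (f := fun _ a => (a.1, arrival 0 a.2)) fun _ =>
          measurable_fst.prodMk ((measurable_arrival 0).comp measurable_snd)
      rw [keyWeight_zero]
      refine e1.trans ?_
      congr 1
      ext z : 1
      have e2 : pairLaw.map (fun a => (a.1, arrival 0 a.2)) =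
          pairLaw.map (fun a => (a.1, (⊤ : ℝ≥0∞))) := by
        apply Measure.map_congr
        filter_upwards [ae_pairLaw] with a ha
        rw [arrival_zero ha.2.2]
      have e3 : pairLaw.map Prod.fst = unifLaw := by
        unfold pairLaw; rw [Measure.map_fst_prod]; simp
      rw [e2, ← e3, Measure.map_map hh measurable_fst]
      rfl
    rw [← lintegral_map hf (measurable_minima key 0), ← lintegral_map hf (measurable_arrivals _),
      h1, h2]
  | succ n ih =>
    set y := key n with hy
    set w := wt n with hw
    have hupd : Measurable fun p : (X → ℝ × ℝ≥0∞) × ℝ => f (Function.update p.1 y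
        ((p.1 y).1, min (p.1 y).2 (ENNReal.ofReal p.2))) := by
      have h1 := (measurable_pi_apply y).comp
        (measurable_fst : Measurable (Prod.fst : (X → ℝ × ℝ≥0∞) × ℝ → _))
      exact hf.comp ((measurable_update_pair y).comp (measurable_fst.prodMk
        (h1.fst.prodMk (h1.snd.min measurable_snd.ennreal_ofReal))))
    have key1 := lintegral_infinitePi_blocks (scoreDrawLaw wt) {(.exp n : ScoreDraw X)}
      (measurable_pi_apply (.exp n)) (fun t t' h => h _ rfl)
      (Q := fun t b => f (Function.update (minima key n t) y
        ((minima key n t y).1, min (minima key n t y).2 (ENNReal.ofReal b))))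
      (hupd.comp (((measurable_minima key n).comp measurable_fst).prodMk measurable_snd))
      (fun t t' b h => by
        have : minima key n t = minima key n t' := by
          ext z : 1
          unfold minima
          rw [h (.hash z) (by simp)]
          congr 1
          apply Finset.inf_congr rfl
          intro i hi
          rw [h (.exp i)]
          have := Finset.mem_range.1 (Finset.mem_filter.1 hi).1
          simp; omega
        rw [this])
    have key2 := ih (f := fun ψ => ∫⁻ b, f (Function.update ψ y
        ((ψ y).1, min (ψ y).2 (ENNReal.ofReal b))) ∂(expMeasure w))
      (by
        have := isProbabilityMeasure_expMeasure (hwt n)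
        exact hupd.lintegral_prod_right')
    have key3 := lintegral_arrivals_update (keyWeight_nonneg key hwt n y) (hwt n) hf
    rw [keyWeight_succ, ← key3]
    rw [Measure.infinitePi_map_eval] at key1
    refine Eq.trans ?_ (key1.trans (key2.trans ?_))
    · exact lintegral_congr fun t => by rw [minima_succ]; rfl
    · refine lintegral_congr fun ξ => ?_
      rw [← map_stdExp_div (hwt n), lintegral_map]
      · refine lintegral_congr fun e => ?_
        rw [arrival_of_pos (hwt n)]; rfl
      · exact hupd.comp measurable_prodMk_left
      · fun_prop

end ScoreLaw

/-! ### The randomization of the keys other than `x` -/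

section OtherKeys

variable {X : Type*} [DecidableEq X]

/-- The hashes and minima of the keys other than `x`. -/
noncomputable def minimaOff (key : ℕ → X) (n : ℕ) (x : X) (t : ScoreDraw X → ℝ) :
    X → ℝ × ℝ≥0∞ := Function.update (minima key n t) x (0, ⊤)

theorem measurable_minimaOff (key : ℕ → X) (n : ℕ) (x : X) : Measurable (minimaOff key n x) :=
  (measurable_update_pair x).comp ((measurable_minima key n).prodMk measurable_const)

theorem minimaOff_congr {key : ℕ → X} {n : ℕ} {x : X} {t t' : ScoreDraw X → ℝ}
    (h : ∀ d : ScoreDraw X, d.owner key ≠ x → t d = t' d) :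
    minimaOff key n x t = minimaOff key n x t' := by
  ext z : 1
  unfold minimaOff
  by_cases hz : z = x
  · subst hz; simp
  · rw [Function.update_of_ne hz, Function.update_of_ne hz]
    unfold minima
    rw [h (.hash z) hz]
    congr 1
    refine Finset.inf_congr rfl fun i hi => ?_
    rw [h (.exp i) ?_]
    have := (Finset.mem_filter.1 hi).2
    exact fun h => hz (this.symm.trans h)

/-- The family of draws that agrees with `u` on the draws of the keys other than `x`. -/
def extendDraws (key : ℕ → X) (x : X) (u : {d : ScoreDraw X // d.owner key ≠ x} → ℝ)
    (d : ScoreDraw X) : ℝ :=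
  if h : d.owner key ≠ x then u ⟨d, h⟩ else 0

theorem measurable_extendDraws (key : ℕ → X) (x : X) : Measurable (extendDraws key x) := by
  refine measurable_pi_lambda _ fun d => ?_
  unfold extendDraws
  split_ifs with h
  · exact measurable_pi_apply _
  · exact measurable_const

variable {Ω' : Type*} [MeasurableSpace Ω'] {P' : Measure Ω'}
  {x : X} {key : ℕ → X} {wt : ℕ → ℝ} {s : ScoreDraw X → Ω' → ℝ}

theorem minimaOff_extendDraws (n : ℕ) (t : ScoreDraw X → ℝ) :
    minimaOff key n x (extendDraws key x fun d => t d) = minimaOff key n x t :=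
  minimaOff_congr fun d hd => by rw [extendDraws, dif_pos hd]

theorem IsScoreRandomizationOff.measurable_minimaOff (hs : IsScoreRandomizationOff x key wt s P')
    (n : ℕ) : Measurable fun ω' => minimaOff key n x fun d => s d ω' := by
  have h : Measurable fun ω' (d : {d : ScoreDraw X // d.owner key ≠ x}) => s d ω' :=
    measurable_pi_lambda _ fun d => hs.measurable d d.2
  have h2 := (_root_.measurable_minimaOff key n x).comp ((measurable_extendDraws key x).comp h)
  refine (congrArg Measurable (funext fun ω' => ?_)).mp h2
  exact minimaOff_extendDraws n fun d => s d ω'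

/-- The variables `s` are specified only on the draws of the other keys. Padding the draws of `x`,
which `minimaOff` ignores, reduces the claim to the full product law of `lintegral_minima`. -/
theorem IsScoreRandomizationOff.lintegral_minimaOff (hs : IsScoreRandomizationOff x key wt s P')
    (hwt : ∀ i, 0 < wt i) (n : ℕ) {f : (X → ℝ × ℝ≥0∞) → ℝ≥0∞} (hf : Measurable f) :
    ∫⁻ ω', f (minimaOff key n x fun d => s d ω') ∂P' =
      ∫⁻ ξ, f (Function.update (arrivals (keyWeight key wt n) ξ) x (0, ⊤)) ∂(arrivalLaw X) := by
  have hprob := isProbabilityMeasure_scoreDrawLaw (X := X) hwt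
  have hm : Measurable fun u => f (minimaOff key n x (extendDraws key x u)) :=
    hf.comp ((_root_.measurable_minimaOff key n x).comp (measurable_extendDraws key x))
  have h : Measurable fun ω' (d : {d : ScoreDraw X // d.owner key ≠ x}) => s d ω' :=
    measurable_pi_lambda _ fun d => hs.measurable d d.2
  have h' : Measurable fun (t : ScoreDraw X → ℝ) (d : {d : ScoreDraw X // d.owner key ≠ x}) =>
      t d := measurable_pi_lambda _ fun d => measurable_pi_apply _
  have hlaw : P'.map (fun ω' (d : {d : ScoreDraw X // d.owner key ≠ x}) => s d ω') =
      (Measure.infinitePi (scoreDrawLaw wt)).map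
        fun (t : ScoreDraw X → ℝ) (d : {d : ScoreDraw X // d.owner key ≠ x}) => t d := by
    have e1 := hs.indep.map_fun_eq_infinitePi_map (P := P')
      fun d : {d : ScoreDraw X // d.owner key ≠ x} => hs.measurable d d.2
    have e2 := Measure.map_infinitePi_infinitePi_of_inj (P := scoreDrawLaw (X := X) wt)
      (f := (Subtype.val : {d : ScoreDraw X // d.owner key ≠ x} → ScoreDraw X))
      Subtype.val_injective
    refine e1.trans (Eq.trans ?_ e2.symm)
    congr 1
    ext d : 1
    obtain ⟨d, hd⟩ := d
    cases d with
    | hash z => exact hs.law_hash z hd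
    | exp i => exact hs.law_exp i hd
  have hu : Measurable fun ψ : X → ℝ × ℝ≥0∞ => f (Function.update ψ x (0, ⊤)) :=
    hf.comp ((measurable_update_pair x).comp (measurable_id.prodMk measurable_const))
  calc ∫⁻ ω', f (minimaOff key n x fun d => s d ω') ∂P'
      = ∫⁻ ω', f (minimaOff key n x (extendDraws key x fun d => s d ω')) ∂P' :=
        lintegral_congr fun ω' => by rw [minimaOff_extendDraws n fun d => s d ω']
    _ = ∫⁻ t : ScoreDraw X → ℝ, f (minimaOff key n x (extendDraws key x fun d => t d))
          ∂(Measure.infinitePi (scoreDrawLaw wt)) := by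
        rw [← lintegral_map (f := fun u => f (minimaOff key n x (extendDraws key x u))) hm h,
          hlaw, lintegral_map hm h']
    _ = ∫⁻ t, f (minimaOff key n x t) ∂(Measure.infinitePi (scoreDrawLaw wt)) :=
        lintegral_congr fun t => by rw [minimaOff_extendDraws n t]
    _ = _ := lintegral_minima key hwt n hu

/-- For a hash at most `1` the map `m ↦ seedOf ℓ m h` is monotone, so it commutes with the minimum
over the elements. All elements of a key share the base hash. -/
theorem seed_eq_seedOf {ℓ : ℝ} (hℓ : 0 < ℓ) (key : ℕ → X) (n : ℕ) {t : ScoreDraw X → ℝ} {z : X}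
    (h1 : t (.hash z) ≤ 1) :
    seed ℓ key n t z = seedOf ℓ (minima key n t z).2 (t (.hash z)) := by
  have hmono : Monotone fun m => seedOf ℓ m (t (.hash z)) := fun _ _ h => seedOf_mono hℓ h1 h
  unfold seed minima
  have := Finset.apply_inf_eq_inf_comp_of_linearOrder (fun m => seedOf ℓ m (t (.hash z))) hmono
    (seedOf_eq_top_iff.2 rfl) (s := (Finset.range n).filter fun i => key i = z)
    (f := fun i => ENNReal.ofReal (t (.exp i)))
  refine Eq.trans ?_ this.symm
  refine Finset.inf_congr rfl fun i hi => ?_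
  have hi : key i = z := (Finset.mem_filter.1 hi).2
  simp only [Function.comp_def]
  unfold elementScore seedOf
  simp only [ENNReal.ofReal_le_ofReal_iff (one_div_pos.2 hℓ).le, hi]
  split_ifs <;> rfl

theorem seed_eq_top {ℓ : ℝ} {n : ℕ} {t : ScoreDraw X → ℝ} {z : X}
    (hz : z ∉ (Finset.range n).image key) : seed ℓ key n t z = ⊤ := by
  unfold seed
  rw [Finset.filter_eq_empty_iff.2, Finset.inf_empty]
  intro i hi h
  exact hz (Finset.mem_image.2 ⟨i, hi, h⟩)

end OtherKeys

/-! ### The law of the loss -/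

section LossLaw

/-- The hash test succeeds with probability `min{1, τ ℓ}`. Either this equals `τ ℓ` and the rate is
`1/ℓ`, or it equals `1` and the rate is `τ`. The product is the prefactor of the density of the
loss. -/
theorem unifLaw_div_lt_mul {ℓ : ℝ} (hℓ : 0 < ℓ) {τ : ℝ} (hτ : 0 ≤ τ) :
    unifLaw {h | h / ℓ < τ} * ENNReal.ofReal (max (1 / ℓ) τ) = ENNReal.ofReal τ := by
  have e : {h : ℝ | h / ℓ < τ} = Set.Iio (τ * ℓ) := by
    ext h; exact div_lt_iff₀ hℓ
  rw [e]
  rcases le_total τ (1 / ℓ) with h | h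
  · have h1 : τ * ℓ ≤ 1 := (le_div_iff₀ hℓ).1 h
    rw [unifLaw_Iio h1, max_eq_left h, ← ENNReal.ofReal_mul (by positivity)]
    congr 1; field_simp
  · have h1 : 1 ≤ τ * ℓ := (div_le_iff₀ hℓ).1 h
    have h2 : unifLaw (Set.Iio (τ * ℓ)) = 1 := by
      refine (prob_compl_eq_zero_iff measurableSet_Iio).1 ?_
      refine measure_mono_null (t := {h | ¬ (0 < h ∧ h < 1)}) ?_ (ae_iff.1 ae_unifLaw_mem)
      intro a ha
      have : τ * ℓ ≤ a := not_lt.1 ha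
      exact fun h => by linarith [h.2]
    rw [h2, max_eq_right h, one_mul]

theorem exists_isLossLaw {ℓ : ℝ} (hℓ : 0 < ℓ) {τ : ℝ} (hτ : 0 ≤ τ) {W : ℝ} (hW : 0 ≤ W) :
    ∃ ν : Measure ℝ, IsLossLaw ℓ (ENNReal.ofReal τ) W ν ∧
      pairLaw.map (fun a => if a.1 / ℓ < τ ∧ a.2 / max (1 / ℓ) τ < W then
        W - a.2 / max (1 / ℓ) τ else 0) = ν.map fun y => max 0 (W - y) := by
  set r := max (1 / ℓ) τ with hr
  have hr0 : 0 < r := lt_of_lt_of_le (by positivity) (le_max_left _ _)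
  have hmE : MeasurableSet {h : ℝ | h / ℓ < τ} := measurableSet_lt (by fun_prop) (by fun_prop)
  have hmp : MeasurableSet {a : ℝ × ℝ | a.1 / ℓ < τ} :=
    measurableSet_lt (by fun_prop) (by fun_prop)
  have hm : Measurable fun a : ℝ × ℝ => if a.1 / ℓ < τ then a.2 / r else W + 1 :=
    Measurable.ite hmp (by fun_prop) (by fun_prop)
  -- The loss is `e / r` if the hash test succeeds; otherwise any value beyond `W` serves, here `W +
  -- 1`.
  refine ⟨pairLaw.map fun a => if a.1 / ℓ < τ then a.2 / r else W + 1, ?_, ?_⟩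
  · rw [IsLossLaw, if_neg ENNReal.ofReal_ne_top, ENNReal.toReal_ofReal hτ, ← hr]
    refine ⟨Measure.isProbabilityMeasure_map hm.aemeasurable, ?_, ?_⟩
    · rw [Measure.map_apply hm measurableSet_Iio]
      refine measure_mono_null (t := {a | ¬ (0 < a.1 ∧ a.1 < 1 ∧ 0 < a.2)}) ?_
        (ae_iff.1 ae_pairLaw)
      intro a ha h
      have ha : (if a.1 / ℓ < τ then a.2 / r else W + 1) < 0 := ha
      have := div_pos h.2.2 hr0
      split_ifs at ha <;> linarith
    · ext A hA
      have hA' : MeasurableSet (A ∩ Set.Icc 0 W) := hA.inter measurableSet_Icc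
      rw [Measure.restrict_apply hA, withDensity_apply _ hA, Measure.restrict_restrict hA,
        Measure.map_apply hm hA']
      have e1 : (fun a : ℝ × ℝ => if a.1 / ℓ < τ then a.2 / r else W + 1) ⁻¹' (A ∩ Set.Icc 0 W) =
          {h : ℝ | h / ℓ < τ} ×ˢ ((fun e => e / r) ⁻¹' (A ∩ Set.Icc 0 W)) := by
        ext a
        simp only [Set.mem_preimage, Set.mem_prod, Set.mem_ofPred_eq]
        split_ifs with h
        · simp [h]
        · simp [h]
      have e2 : stdExp ((fun e => e / r) ⁻¹' (A ∩ Set.Icc 0 W)) =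
          ∫⁻ y in A ∩ Set.Icc 0 W, ENNReal.ofReal (r * Real.exp (-(r * y))) := by
        rw [← Measure.map_apply (by fun_prop) hA', map_stdExp_div hr0]
        change (volume.withDensity (exponentialPDF r)) _ = _
        rw [withDensity_apply _ hA']
        refine setLIntegral_congr_fun hA' fun y hy => ?_
        rw [exponentialPDF_eq, if_pos hy.2.1]
      rw [e1, pairLaw, Measure.prod_prod, e2, ← lintegral_const_mul _ (by fun_prop)]
      refine lintegral_congr fun y => ?_
      rw [ENNReal.ofReal_mul hr0.le, ← mul_assoc, unifLaw_div_lt_mul hℓ hτ,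
        ← ENNReal.ofReal_mul hτ, neg_mul, mul_comm y]
  · rw [Measure.map_map (by fun_prop) hm]
    congr 1
    ext a
    simp only [Function.comp_def]
    by_cases h : a.1 / ℓ < τ
    · simp only [h, true_and, if_true]
      split_ifs with h2
      · rw [max_eq_right (by linarith)]
      · rw [max_eq_left (by linarith)]
    · simp [h]

/-- Up to a null set, a seed below a finite `τ` means that the hash test succeeds and `e / r < W`.
For `τ = ⊤` the counter is `W` without loss. -/
theorem exists_isLossLaw_of_seedOf_lt {ℓ : ℝ} (hℓ : 0 < ℓ) (τ : ℝ≥0∞) {W : ℝ} (hW : 0 ≤ W) :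
    ∃ ν : Measure ℝ, IsLossLaw ℓ τ W ν ∧
      pairLaw.map (fun a => if seedOf ℓ (arrival W a.2) a.1 < τ then
        W - a.2 * invRate ℓ τ else 0) = ν.map fun y => max 0 (W - y) := by
  by_cases hτ : τ = ⊤
  · subst hτ
    refine ⟨Measure.dirac 0, by rw [IsLossLaw, if_pos rfl], ?_⟩
    have hd : Measurable fun y : ℝ => max 0 (W - y) := by fun_prop
    rw [Measure.map_dirac' hd]
    have h1 : (fun a : ℝ × ℝ => if seedOf ℓ (arrival W a.2) a.1 < ⊤ then
        W - a.2 * invRate ℓ ⊤ else 0) =ᵐ[pairLaw] fun _ => max 0 (W - 0) := by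
      filter_upwards [ae_pairLaw] with a ha
      rw [invRate_top, mul_zero, sub_zero, max_eq_right hW]
      rcases eq_or_lt_of_le hW with h | h
      · simp [← h]
      · rw [if_pos]
        exact lt_top_iff_ne_top.2 fun h2 => arrival_ne_top h a.2 (seedOf_eq_top_iff.1 h2)
    rw [Measure.map_congr h1, Measure.map_const]
    simp
  · obtain ⟨ν, h1, h2⟩ := exists_isLossLaw hℓ (τ := τ.toReal) ENNReal.toReal_nonneg hW
    rw [ENNReal.ofReal_toReal hτ] at h1
    refine ⟨ν, h1, Eq.trans (Measure.map_congr ?_) h2⟩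
    have h3 := Measure.quasiMeasurePreserving_snd (μ := unifLaw) (ν := stdExp) |>.ae
      (ae_arrival_ne hW (ENNReal.ofReal (1 / ℓ)) fun _ => ENNReal.ofReal_ne_top)
    have hq : invRate ℓ τ = (max (1 / ℓ) τ.toReal)⁻¹ := by
      rw [invRate, rate, ENNReal.toReal_inv, ENNReal.toReal_max ENNReal.ofReal_ne_top hτ,
        ENNReal.toReal_ofReal (by positivity)]
    filter_upwards [ae_pairLaw, h3] with a ha h3
    have h4 : (seedOf ℓ (arrival W a.2) a.1 < τ) =
        (a.1 / ℓ < τ.toReal ∧ a.2 / max (1 / ℓ) τ.toReal < W) := by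
      rw [seedOf_lt_iff hℓ ha.2.1.le h3, arrival_lt_rate_iff hℓ hW ha.2.2, hq, ← div_eq_mul_inv,
        ENNReal.ofReal_lt_iff_lt_toReal (div_pos ha.1 hℓ).le hτ]
    simp only [h4, hq, ← div_eq_mul_inv]

end LossLaw

/-! ### The conditional law given the other keys -/

section Conditional

variable {X : Type*} [DecidableEq X]

/-- The seeds when the key `x`, of weight `W`, has hash and arrival variable `a`. -/
noncomputable def seedWith (ℓ W : ℝ) (x : X) (ψ : X → ℝ × ℝ≥0∞) (a : ℝ × ℝ) (z : X) : ℝ≥0∞ :=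
  if z = x then seedOf ℓ (arrival W a.2) a.1 else seedOf ℓ (ψ z).2 (ψ z).1

/-- The bottom-`k` sample, given the hashes and minima `ψ` of the keys other than `x` and the hash
and arrival variable `a` of `x`. -/
noncomputable def outputWith (k : ℕ) (ℓ : ℝ) (K : Finset X) (W : ℝ) (x : X)
    (ψ : X → ℝ × ℝ≥0∞) (a : ℝ × ℝ) : ℝ≥0∞ × Set X × ℝ :=
  (kthSmallest (k + 1) K (seedWith ℓ W x ψ a),
    {z | z ∈ K ∧ seedWith ℓ W x ψ a z < kthSmallest (k + 1) K (seedWith ℓ W x ψ a)},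
    if seedWith ℓ W x ψ a x < kthSmallest (k + 1) K (seedWith ℓ W x ψ a) then
      W - a.2 * invRate ℓ (kthSmallest (k + 1) K (seedWith ℓ W x ψ a)) else 0)

theorem measurable_seedWith (ℓ W : ℝ) (x z : X) :
    Measurable fun p : (X → ℝ × ℝ≥0∞) × ℝ × ℝ => seedWith ℓ W x p.1 p.2 z := by
  unfold seedWith
  split_ifs
  · exact (measurable_seedOf ℓ).comp (((measurable_arrival W).comp measurable_snd.snd).prodMk
      measurable_snd.fst)
  · have h := (measurable_pi_apply z).comp
      (measurable_fst : Measurable (Prod.fst : (X → ℝ × ℝ≥0∞) × ℝ × ℝ → _))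
    exact (measurable_seedOf ℓ).comp (h.snd.prodMk h.fst)

theorem measurable_outputWith (k : ℕ) (ℓ : ℝ) (K : Finset X) (W : ℝ) (x : X) :
    Measurable fun p : (X → ℝ × ℝ≥0∞) × ℝ × ℝ => outputWith k ℓ K W x p.1 p.2 := by
  have hσ := measurable_seedWith (X := X) ℓ W x
  have hT := measurable_kthSmallest (by omega : 1 ≤ k + 1) K fun z _ => hσ z
  have hlt := fun z => measurableSet_lt (hσ z) hT
  unfold outputWith
  refine hT.prodMk (Measurable.prodMk ?_ (Measurable.ite (hlt x) ?_ measurable_const))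
  · refine measurable_set_iff.2 fun z => ?_
    by_cases hz : z ∈ K
    · simp only [Set.mem_ofPred_eq, hz, true_and]
      exact measurableSet_setOfPred.1 (hlt z)
    · simp only [Set.mem_ofPred_eq, hz, false_and]
      exact measurable_const
  · exact measurable_const.sub (measurable_snd.snd.mul ((measurable_invRate ℓ).comp hT))

theorem measurable_outputWith_right (k : ℕ) (ℓ : ℝ) (K : Finset X) (W : ℝ) (x : X)
    (ψ : X → ℝ × ℝ≥0∞) : Measurable (outputWith k ℓ K W x ψ) :=
  Measurable.of_uncurry_left (f := outputWith k ℓ K W x) (measurable_outputWith k ℓ K W x)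

/-- The law of the bottom-`k` sample, given the hashes and minima `Ψ` of the keys other than `x`. -/
noncomputable def outputKernel (k : ℕ) (ℓ : ℝ) (K : Finset X) (W : ℝ) (x : X) {Ω' : Type*}
    [MeasurableSpace Ω'] {Ψ : Ω' → X → ℝ × ℝ≥0∞} (hΨ : Measurable Ψ) :
    Kernel Ω' (ℝ≥0∞ × Set X × ℝ) :=
  (Kernel.deterministic Ψ hΨ ×ₖ Kernel.const Ω' pairLaw).map fun p => outputWith k ℓ K W x p.1 p.2

theorem isMarkovKernel_outputKernel (k : ℕ) (ℓ : ℝ) (K : Finset X) (W : ℝ) (x : X) {Ω' : Type*}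
    [MeasurableSpace Ω'] {Ψ : Ω' → X → ℝ × ℝ≥0∞} (hΨ : Measurable Ψ) :
    IsMarkovKernel (outputKernel k ℓ K W x hΨ) :=
  Kernel.IsMarkovKernel.map _ (measurable_outputWith k ℓ K W x)

theorem outputKernel_apply (k : ℕ) (ℓ : ℝ) (K : Finset X) (W : ℝ) (x : X) {Ω' : Type*}
    [MeasurableSpace Ω'] {Ψ : Ω' → X → ℝ × ℝ≥0∞} (hΨ : Measurable Ψ) (ω' : Ω') :
    outputKernel k ℓ K W x hΨ ω' = pairLaw.map (outputWith k ℓ K W x (Ψ ω')) := by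
  rw [outputKernel, Kernel.map_apply _ (measurable_outputWith k ℓ K W x), Kernel.prod_apply,
    Kernel.deterministic_apply, Kernel.const_apply, Measure.dirac_prod,
    Measure.map_map (measurable_outputWith k ℓ K W x) measurable_prodMk_left]
  rfl

/-- The part of a state that concerns `x`. -/
def outputOf (x : X) (s : ℝ≥0∞ × Finset X × (X → ℝ)) : ℝ≥0∞ × Set X × ℝ :=
  (s.1, {z | z ∈ s.2.1}, s.2.2 x)

/-- The entry of the family at `x` is never read, so the placeholder `b` is harmless. -/
theorem outputWith_update_arrivals (k : ℕ) (ℓ : ℝ) {K : Finset X} (W : X → ℝ) {x : X} (hx : x ∈ K)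
    (ξ : X → ℝ × ℝ) (b : ℝ × ℝ≥0∞) (a : ℝ × ℝ) :
    outputWith k ℓ K (W x) x (Function.update (arrivals W ξ) x b) a =
      outputOf x (idealState k ℓ K W (Function.update ξ x a)) := by
  have h : seedWith ℓ (W x) x (Function.update (arrivals W ξ) x b) a =
      idealSeed ℓ W (Function.update ξ x a) := by
    ext z
    unfold seedWith idealSeed
    split_ifs with hz
    · subst hz; simp
    · simp [hz, arrivals]
  unfold outputWith outputOf idealState bottomSample
  rw [h]
  simp only [Finset.mem_filter, hx, true_and, Function.update_self]

theorem measurable_fixedSizeOutput (k : ℕ) (ℓ : ℝ) (key : ℕ → X) (wt : ℕ → ℝ) (n : ℕ) (x : X) :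
    Measurable (fixedSizeOutput k ℓ key wt n x) := by
  have h := (measurableState_fixedSizeRun k ℓ key wt n).measurable_test
    (h := fun _ _ => 0) measurable_const
    (g := fun S a => (a.1, {z | z ∈ S}, a.2.1 x)) fun S =>
      measurable_fst.prodMk (measurable_const.prodMk ((measurable_pi_apply x).comp
        measurable_snd.fst))
  exact h

theorem lintegral_fixedSizeOutput {k : ℕ} (hk : 1 ≤ k) {ℓ : ℝ} (hℓ : 0 < ℓ) (key : ℕ → X)
    {wt : ℕ → ℝ} (hwt : ∀ i, 0 < wt i) (n : ℕ) (x : X) {f : ℝ≥0∞ × Set X × ℝ → ℝ≥0∞}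
    (hf : Measurable f) :
    ∫⁻ t, f (fixedSizeOutput k ℓ key wt n x t) ∂(tapeLaw X) =
      ∫⁻ ξ, ∫⁻ a, f (outputWith k ℓ (insert x ((Finset.range n).image key))
        (keyWeight key wt n x) x (Function.update (arrivals (keyWeight key wt n) ξ) x (0, ⊤)) a)
        ∂pairLaw ∂(arrivalLaw X) := by
  have hg : ∀ S : Finset X, Measurable fun a : ℝ≥0∞ × (X → ℝ) × (X → ℝ) =>
      f (a.1, {z | z ∈ S}, a.2.1 x) := fun S =>
    hf.comp (measurable_fst.prodMk (measurable_const.prodMk ((measurable_pi_apply x).comp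
      measurable_snd.fst)))
  have h1 := lintegral_fixedSizeRun hk hℓ key hwt (K := insert x ((Finset.range n).image key)) n
    (fun j hj => Finset.mem_insert_of_mem (Finset.mem_image_of_mem key (Finset.mem_range.2 hj))) hg
  refine h1.trans ?_
  have hm : Measurable fun ξ : X → ℝ × ℝ => f (outputOf x
      (idealState k ℓ (insert x ((Finset.range n).image key)) (keyWeight key wt n) ξ)) :=
    (measurableState_idealState k ℓ (insert x ((Finset.range n).image key))
      (keyWeight key wt n)).evalTest (h := fun _ _ => 0) measurable_const hg
  refine (lintegral_infinitePi_update (fun _ : X => pairLaw) x hm).trans ?_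
  refine lintegral_congr fun ξ => lintegral_congr fun a => ?_
  rw [outputWith_update_arrivals k ℓ _ (Finset.mem_insert_self _ _)]

theorem seedWith_of_ne {ℓ : ℝ} (hℓ : 0 < ℓ) (W : ℝ) {key : ℕ → X} {n : ℕ} {x z : X} (hz : z ≠ x)
    {t : ScoreDraw X → ℝ} (h1 : t (.hash z) ≤ 1) (a : ℝ × ℝ) :
    seedWith ℓ W x (minimaOff key n x t) a z = seed ℓ key n t z := by
  rw [seedWith, if_neg hz, minimaOff, Function.update_of_ne hz, seed_eq_seedOf hℓ key n h1]
  rfl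

theorem thresholdOff_eq {k : ℕ} {ℓ : ℝ} (hℓ : 0 < ℓ) (W : ℝ) {key : ℕ → X} {n : ℕ} {x : X}
    {t : ScoreDraw X → ℝ} (h1 : ∀ z ∈ (Finset.range n).image key, z ≠ x → t (.hash z) ≤ 1)
    (a : ℝ × ℝ) :
    thresholdOff k ℓ key n x t = kthSmallest k ((insert x ((Finset.range n).image key)).erase x)
      (seedWith ℓ W x (minimaOff key n x t) a) := by
  rw [Finset.erase_insert_eq_erase]
  refine (kthSmallest_congr fun z hz => ?_).symm
  exact seedWith_of_ne hℓ W (Finset.ne_of_mem_erase hz)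
    (h1 z (Finset.mem_of_mem_erase hz) (Finset.ne_of_mem_erase hz)) a

omit [DecidableEq X] in
theorem measurable_mem_snd (z : X) : Measurable fun o : ℝ≥0∞ × Set X × ℝ => z ∈ o.2.1 :=
  (measurable_set_mem z).comp measurable_snd.fst

omit [DecidableEq X] in
theorem IsUniformTape.map_eq_tapeLaw {Ω : Type*} [MeasurableSpace Ω] {P : Measure Ω}
    [IsProbabilityMeasure P] {rnd : Draw X → Ω → ℝ} (hrnd : IsUniformTape rnd P) :
    P.map (fun ω d => rnd d ω) = tapeLaw X := by
  rw [hrnd.indep.map_fun_eq_infinitePi_map hrnd.measurable]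
  unfold tapeLaw unifLaw
  congr 1
  ext d : 1
  exact hrnd.law d

/-- The minima of the other keys have the law of arrival values. Completing them with a fresh
independent pair for `x` gives the ideal sample, which has the law of the output. -/
theorem bind_outputWith {k : ℕ} (hk : 1 ≤ k) {ℓ : ℝ} (hℓ : 0 < ℓ) {key : ℕ → X}
    {wt : ℕ → ℝ} (hwt : ∀ i, 0 < wt i) (n : ℕ) (x : X)
    {Ω : Type*} [MeasurableSpace Ω] {P : Measure Ω} [IsProbabilityMeasure P]
    {rnd : Draw X → Ω → ℝ} (hrnd : IsUniformTape rnd P)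
    {Ω' : Type*} [MeasurableSpace Ω'] {P' : Measure Ω'}
    {s : ScoreDraw X → Ω' → ℝ} (hs : IsScoreRandomizationOff x key wt s P')
    {R : Kernel Ω' (ℝ≥0∞ × Set X × ℝ)}
    (hR : ∀ ω', R ω' = pairLaw.map (outputWith k ℓ (insert x ((Finset.range n).image key))
      (keyWeight key wt n x) x (minimaOff key n x fun d => s d ω'))) :
    P'.bind R = P.map (fun ω => fixedSizeOutput k ℓ key wt n x (fun d => rnd d ω)) := by
  have hout := measurable_outputWith k ℓ (insert x ((Finset.range n).image key))
    (keyWeight key wt n x) x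
  refine Measure.ext_of_lintegral _ fun f hf => ?_
  have hmt : Measurable fun ω d => rnd d ω := measurable_pi_lambda _ hrnd.measurable
  have hmo := measurable_fixedSizeOutput k ℓ key wt n x
  have hfo : Measurable fun t => f (fixedSizeOutput k ℓ key wt n x t) := hf.comp hmo
  have hfin : Measurable fun p : (X → ℝ × ℝ≥0∞) × ℝ × ℝ => f (outputWith k ℓ
      (insert x ((Finset.range n).image key)) (keyWeight key wt n x) x p.1 p.2) := hf.comp hout
  have hL : ∫⁻ o, f o ∂(P'.bind R) = ∫⁻ ω', ∫⁻ a, f (outputWith k ℓ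
      (insert x ((Finset.range n).image key)) (keyWeight key wt n x) x
      (minimaOff key n x fun d => s d ω') a) ∂pairLaw ∂P' := by
    rw [Measure.lintegral_bind R.aemeasurable hf.aemeasurable]
    refine lintegral_congr fun ω' => ?_
    rw [hR, lintegral_map hf (measurable_outputWith_right k ℓ _ _ x _)]
  rw [hL, hs.lintegral_minimaOff hwt n hfin.lintegral_prod_right',
    ← lintegral_fixedSizeOutput hk hℓ key hwt n x hf, ← hrnd.map_eq_tapeLaw, lintegral_map hfo hmt]
  exact (lintegral_map hf (hmo.comp hmt)).symm

theorem ae_hash_le_one {Ω' : Type*} [MeasurableSpace Ω'] {P' : Measure Ω'} {x : X} {key : ℕ → X}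
    {wt : ℕ → ℝ} {s : ScoreDraw X → Ω' → ℝ} (hs : IsScoreRandomizationOff x key wt s P')
    (K : Finset X) : ∀ᵐ ω' ∂P', ∀ z ∈ K, z ≠ x → s (.hash z) ω' ≤ 1 := by
  rw [Filter.eventually_all_finset]
  intro z _
  by_cases hz : z = x
  · exact ae_of_all _ fun _ h => absurd hz h
  · have h1 : ∀ᵐ u ∂(P'.map (s (.hash z))), u ≤ 1 := by
      rw [hs.law_hash z hz]
      exact ae_unifLaw_mem.mono fun u hu => hu.2.le
    filter_upwards [ae_of_ae_map (hs.measurable (.hash z) hz).aemeasurable h1] with ω' h _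
    exact h

/-- A sampled `x` lies below the `(k+1)`-st smallest of all seeds, so erasing it leaves the same
level as the `k`-th smallest. -/
theorem outputWith_threshold {k : ℕ} {ℓ : ℝ} (hℓ : 0 < ℓ) (W : ℝ) {key : ℕ → X} {n : ℕ} {x : X}
    {t : ScoreDraw X → ℝ} (h1 : ∀ z ∈ (Finset.range n).image key, z ≠ x → t (.hash z) ≤ 1)
    {a : ℝ × ℝ} (ha : x ∈ (outputWith k ℓ (insert x ((Finset.range n).image key)) W x
      (minimaOff key n x t) a).2.1) :
    (outputWith k ℓ (insert x ((Finset.range n).image key)) W x (minimaOff key n x t) a).1 =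
      thresholdOff k ℓ key n x t := by
  rw [thresholdOff_eq hℓ W h1 a]
  exact kthSmallest_erase_of_lt (Finset.mem_insert_self _ _) ha.2

theorem mem_outputWith_iff {k : ℕ} {ℓ : ℝ} (hℓ : 0 < ℓ) (W : ℝ) {key : ℕ → X} {n : ℕ} {x z : X}
    (hz : z ≠ x) {t : ScoreDraw X → ℝ}
    (h1 : ∀ z ∈ (Finset.range n).image key, z ≠ x → t (.hash z) ≤ 1)
    {a : ℝ × ℝ} (ha : x ∈ (outputWith k ℓ (insert x ((Finset.range n).image key)) W x
      (minimaOff key n x t) a).2.1) :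
    z ∈ (outputWith k ℓ (insert x ((Finset.range n).image key)) W x (minimaOff key n x t) a).2.1 ↔
      seed ℓ key n t z < thresholdOff k ℓ key n x t := by
  rw [← outputWith_threshold hℓ W h1 ha]
  change (z ∈ _ ∧ seedWith ℓ W x (minimaOff key n x t) a z < _) ↔ _
  -- A key that does not occur has seed `⊤`, so neither side can hold.
  by_cases hzK : z ∈ (Finset.range n).image key
  · rw [seedWith_of_ne hℓ W hz (h1 z hzK hz) a]
    exact and_iff_right (Finset.mem_insert_of_mem hzK)
  · rw [seed_eq_top hzK]
    have : z ∉ insert x ((Finset.range n).image key) := fun h =>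
      (Finset.mem_insert.1 h).elim hz hzK
    simp [this]

/-- Whether `x` is sampled may be tested against the threshold of the others (`lt_kthSmallest_iff`),
and in that case the two thresholds agree. The count is thus a function of the pair of `x` at a
threshold that does not depend on this pair. -/
theorem outputWith_count {k : ℕ} (hk : 1 ≤ k) {ℓ : ℝ} (hℓ : 0 < ℓ) (W : ℝ) {key : ℕ → X} {n : ℕ}
    {x : X} {t : ScoreDraw X → ℝ}
    (h1 : ∀ z ∈ (Finset.range n).image key, z ≠ x → t (.hash z) ≤ 1) (a : ℝ × ℝ) :
    (outputWith k ℓ (insert x ((Finset.range n).image key)) W x (minimaOff key n x t) a).2.2 =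
      if seedOf ℓ (arrival W a.2) a.1 < thresholdOff k ℓ key n x t then
        W - a.2 * invRate ℓ (thresholdOff k ℓ key n x t) else 0 := by
  have h2 : seedWith ℓ W x (minimaOff key n x t) a x = seedOf ℓ (arrival W a.2) a.1 := if_pos rfl
  have h3 := lt_kthSmallest_iff (σ := seedWith ℓ W x (minimaOff key n x t) a) hk
    (Finset.mem_insert_self x ((Finset.range n).image key))
  rw [← thresholdOff_eq hℓ W h1 a, h2] at h3
  unfold outputWith
  dsimp only
  rw [h2]
  by_cases h4 : seedOf ℓ (arrival W a.2) a.1 < thresholdOff k ℓ key n x t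
  · rw [if_pos h4, if_pos (h3.2 h4)]
    have h5 := outputWith_threshold (k := k) hℓ W h1 (a := a)
      ⟨Finset.mem_insert_self _ _, h2.symm ▸ h3.2 h4⟩
    rw [← h5]
    rfl
  · rw [if_neg h4, if_neg (fun h => h4 (h3.1 h))]

theorem exists_conditional_law {k : ℕ} (hk : 1 ≤ k) {ℓ : ℝ} (hℓ : 0 < ℓ) {key : ℕ → X}
    {wt : ℕ → ℝ} (hwt : ∀ i, 0 < wt i) (n : ℕ) (x : X)
    {Ω : Type*} [MeasurableSpace Ω] {P : Measure Ω} [IsProbabilityMeasure P]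
    {rnd : Draw X → Ω → ℝ} (hrnd : IsUniformTape rnd P)
    {Ω' : Type*} [MeasurableSpace Ω'] {P' : Measure Ω'}
    {s : ScoreDraw X → Ω' → ℝ} (hs : IsScoreRandomizationOff x key wt s P') :
    ∃ R : Kernel Ω' (ℝ≥0∞ × Set X × ℝ), IsMarkovKernel R ∧
      P'.bind R = P.map (fun ω => fixedSizeOutput k ℓ key wt n x (fun d => rnd d ω)) ∧
      ∀ᵐ ω' ∂P',
        (∀ᵐ o ∂(R ω'), x ∈ o.2.1 → o.1 = thresholdOff k ℓ key n x (fun d => s d ω')) ∧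
        (∀ z, z ≠ x → ∀ᵐ o ∂(R ω'), x ∈ o.2.1 →
          (z ∈ o.2.1 ↔ seed ℓ key n (fun d => s d ω') z <
            thresholdOff k ℓ key n x (fun d => s d ω'))) ∧
        ∃ ν : Measure ℝ,
          IsLossLaw ℓ (thresholdOff k ℓ key n x (fun d => s d ω')) (keyWeight key wt n x) ν ∧
          (R ω').map (fun o => o.2.2) =
            ν.map (fun y => max 0 (keyWeight key wt n x - y)) := by
  have hR := outputKernel_apply k ℓ (insert x ((Finset.range n).image key)) (keyWeight key wt n x) x
    (hs.measurable_minimaOff n)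
  refine ⟨_, isMarkovKernel_outputKernel k ℓ (insert x ((Finset.range n).image key))
    (keyWeight key wt n x) x (hs.measurable_minimaOff n), bind_outputWith hk hℓ hwt n x hrnd hs hR,
    ?_⟩
  filter_upwards [ae_hash_le_one hs ((Finset.range n).image key)] with ω' hω
  have hm := measurable_outputWith_right k ℓ (insert x ((Finset.range n).image key))
    (keyWeight key wt n x) x (minimaOff key n x fun d => s d ω')
  rw [hR]
  refine ⟨?_, fun z hz => ?_, ?_⟩
  · rw [ae_map_iff hm.aemeasurable]
    · exact ae_of_all _ fun a ha => outputWith_threshold hℓ _ hω ha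
    · exact ((measurable_mem_snd x).imp (measurableSet_setOfPred.1
        (measurableSet_eq_fun measurable_fst measurable_const))).setOf
  · rw [ae_map_iff hm.aemeasurable]
    · exact ae_of_all _ fun a ha => mem_outputWith_iff hℓ _ hz hω ha
    · exact ((measurable_mem_snd x).imp ((measurable_mem_snd z).iff measurable_const)).setOf
  · obtain ⟨ν, h1, h2⟩ := exists_isLossLaw_of_seedOf_lt hℓ
      (thresholdOff k ℓ key n x fun d => s d ω') (keyWeight_nonneg key hwt n x)
    refine ⟨ν, h1, Eq.trans ?_ h2⟩
    rw [Measure.map_map measurable_snd.snd hm]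
    congr 1
    ext a
    exact outputWith_count hk hℓ _ hω a

end Conditional

/-! ### The fixed-threshold algorithm -/

section FixedTau

variable {X : Type*} [DecidableEq X]

theorem mem_fixedTauStep_of_ne {ℓ τ : ℝ} {t : Draw X → ℝ} {i : ℕ} {x y : X} (h : x ≠ y) {w : ℝ}
    {C : Counters X} : (x ∈ (fixedTauStep ℓ τ t i y w C).keys ↔ x ∈ C.keys) ∧
      (fixedTauStep ℓ τ t i y w C).count x = C.count x := by
  have h1 : ∀ v, (x ∈ (C.set y v).keys ↔ x ∈ C.keys) ∧ (C.set y v).count x = C.count x := fun v =>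
    ⟨by simp [Counters.set, h], by rw [count_set, Function.update_of_ne h]⟩
  unfold fixedTauStep
  dsimp only
  split_ifs
  · exact h1 _
  · exact h1 _
  · exact ⟨Iff.rfl, rfl⟩

theorem mem_fixedTauStep_self {ℓ τ : ℝ} {t : Draw X → ℝ} {i : ℕ} {x : X} {w : ℝ}
    {C : Counters X} : x ∈ (fixedTauStep ℓ τ t i x w C).keys ↔
      x ∈ C.keys ∨ (t (.hash x) / ℓ < min τ (1 / ℓ) ∧ expOf (t (.entry i)) / max τ (1 / ℓ) < w) := by
  unfold fixedTauStep keyBase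
  dsimp only
  split_ifs with h1 h2
  · simp [Counters.set, h1]
  · exact ⟨fun _ => Or.inr h2, fun _ => by simp [Counters.set]⟩
  · simp only [h1, h2, or_self]

theorem count_fixedTauStep_self {ℓ τ : ℝ} {t : Draw X → ℝ} {i : ℕ} {x : X} {w : ℝ}
    {C : Counters X} : (fixedTauStep ℓ τ t i x w C).count x =
      if x ∈ C.keys then C.count x + w else
        if t (.hash x) / ℓ < min τ (1 / ℓ) ∧ expOf (t (.entry i)) / max τ (1 / ℓ) < w then
          w - expOf (t (.entry i)) / max τ (1 / ℓ) else 0 := by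
  unfold fixedTauStep keyBase
  dsimp only
  split_ifs with h1 h2
  · rw [count_set, Function.update_self, Counters.count, if_pos h1]
  · rw [count_set, Function.update_self]
  · rw [Counters.count, if_neg h1]

theorem measurable_fixedTauRun (ℓ τ : ℝ) (key : ℕ → X) (wt : ℕ → ℝ) (x : X) (i : ℕ) :
    MeasurableSet {t : Draw X → ℝ | x ∈ (fixedTauRun ℓ τ key wt t i).keys} ∧
      Measurable fun t : Draw X → ℝ => (fixedTauRun ℓ τ key wt t i).count x := by
  induction i with
  | zero => exact ⟨.const _, measurable_const⟩
  | succ i ih =>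
    simp only [fixedTauRun]
    by_cases hx : x = key i
    · subst hx
      simp only [mem_fixedTauStep_self, count_fixedTauStep_self]
      have he : Measurable fun t : Draw X → ℝ => expOf (t (.entry i)) / max τ (1 / ℓ) :=
        (measurable_expOf.comp (measurable_pi_apply _)).div_const _
      have hh : Measurable fun t : Draw X → ℝ => t (.hash (key i)) / ℓ :=
        (measurable_pi_apply _).div_const _
      have hs := measurableSet_and (measurableSet_lt hh (measurable_const (a := min τ (1 / ℓ))))
        (measurableSet_lt he (measurable_const (a := wt i)))
      exact ⟨ih.1.union hs, Measurable.ite ih.1 (ih.2.add_const _)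
        (Measurable.ite hs (measurable_const.sub he) measurable_const)⟩
    · simpa only [mem_fixedTauStep_of_ne hx] using ih

theorem fixedTauRun_congr (ℓ τ : ℝ) (key : ℕ → X) (wt : ℕ → ℝ) {t t' : Draw X → ℝ} (i : ℕ)
    (hh : ∀ z, t (.hash z) = t' (.hash z)) (hE : ∀ j < i, t (.entry j) = t' (.entry j)) :
    fixedTauRun ℓ τ key wt t i = fixedTauRun ℓ τ key wt t' i := by
  induction i with
  | zero => rfl
  | succ i ih =>
    rw [fixedTauRun, fixedTauRun, ih fun j hj => hE j (by omega)]
    unfold fixedTauStep keyBase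
    rw [hh, hE i (by omega)]

/-- A key of weight `W` that has passed the test on its hash is sampled if an exponential variable
is less than `W`, where this variable is memoryless. -/
theorem lintegral_memoryless {r W w : ℝ} (hr : 0 < r) (hW : 0 ≤ W) (hw : 0 ≤ w) {f : ℝ → ℝ≥0∞}
    (hf : Measurable f) (b : ℝ≥0∞) :
    ∫⁻ e, (if e / r < W then f (W - e / r + w) else
      ∫⁻ e₀, (if e₀ / r < w then f (w - e₀ / r) else b) ∂stdExp) ∂stdExp =
    ∫⁻ e, (if e / r < W + w then f (W + w - e / r) else b) ∂stdExp := by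
  have hG : Measurable fun e : ℝ => if e / r < W + w then f (W + w - e / r) else b :=
    Measurable.ite (measurableSet_lt (by fun_prop) (by fun_prop)) (hf.comp (by fun_prop))
      measurable_const
  have hM : Measurable fun p : ℝ × ℝ => if p.1 < W * r then p.1 else W * r + p.2 :=
    Measurable.ite (measurableSet_lt (by fun_prop) (by fun_prop)) (by fun_prop) (by fun_prop)
  have hGM : Measurable fun p : ℝ × ℝ =>
      if (if p.1 < W * r then p.1 else W * r + p.2) / r < W + w then
        f (W + w - (if p.1 < W * r then p.1 else W * r + p.2) / r) else b := hG.comp hM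
  -- The exponential for weight `W + w` is split at `W r`, where the old elements end; after that
  -- both sides agree for each `e`.
  conv_rhs => rw [← map_memoryless (mul_nonneg hW hr.le), lintegral_map hG hM]
  rw [lintegral_prod _ hGM.aemeasurable]
  refine lintegral_congr fun e => ?_
  by_cases h : e < W * r
  · have h1 : e / r < W := (div_lt_iff₀ hr).2 h
    simp only [h, h1, if_true]
    rw [if_pos (by linarith), lintegral_const, measure_univ, mul_one]
    congr 1; ring
  · have h1 : ¬ e / r < W := fun h1 => h ((div_lt_iff₀ hr).1 h1)
    simp only [h, h1, if_false]
    refine lintegral_congr fun e₀ => ?_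
    have h2 : (W * r + e₀) / r = W + e₀ / r := by field_simp
    rw [h2, add_sub_add_left_eq_sub]
    simp only [add_lt_add_iff_left]

/-- The hash test has the same outcome for every element of `x`. Given success, the waiting time to
the first sampled unit of weight is exponential across element boundaries by memorylessness. The
hash is carried along since later elements read it again. -/
theorem lintegral_fixedTauRun {ℓ τ : ℝ} (hℓ : 0 < ℓ) (key : ℕ → X) {wt : ℕ → ℝ}
    (hwt : ∀ i, 0 < wt i) (x : X) (i : ℕ) {f : ℝ × ℝ → ℝ≥0∞} (hf : Measurable f) {g : ℝ → ℝ≥0∞}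
    (hg : Measurable g) :
    ∫⁻ t, (if x ∈ (fixedTauRun ℓ τ key wt t i).keys then
      f (t (.hash x), (fixedTauRun ℓ τ key wt t i).count x) else g (t (.hash x))) ∂(tapeLaw X) =
    ∫⁻ a, (if a.1 / ℓ < min τ (1 / ℓ) ∧ a.2 / max τ (1 / ℓ) < keyWeight key wt i x then
      f (a.1, keyWeight key wt i x - a.2 / max τ (1 / ℓ)) else g a.1) ∂pairLaw := by
  have hr : 0 < max τ (1 / ℓ) := lt_of_lt_of_le (one_div_pos.2 hℓ) (le_max_right _ _)
  induction i generalizing f g with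
  | zero =>
    have h1 : ∀ᵐ a ∂pairLaw, (if a.1 / ℓ < min τ (1 / ℓ) ∧ a.2 / max τ (1 / ℓ) <
        keyWeight key wt 0 x then f (a.1, keyWeight key wt 0 x - a.2 / max τ (1 / ℓ)) else g a.1) =
        g a.1 := by
      filter_upwards [ae_pairLaw] with a ha
      rw [keyWeight_zero, if_neg]
      exact fun h => absurd h.2 (not_lt.2 (div_pos ha.2.2 hr).le)
    have h2 : pairLaw.map Prod.fst = (tapeLaw X).map fun t => t (.hash x) := by
      unfold pairLaw tapeLaw
      rw [Measure.map_fst_prod, Measure.infinitePi_map_eval]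
      simp
    rw [lintegral_congr_ae h1, ← lintegral_map hg measurable_fst, h2,
      lintegral_map hg (measurable_pi_apply _)]
    exact lintegral_congr fun t => if_neg (Finset.notMem_empty x)
  | succ i ih =>
    by_cases hx : x = key i
    · have hW := keyWeight_nonneg key hwt i x
      rw [keyWeight_succ, ← hx, Function.update_self]
      set W := keyWeight key wt i x
      set w := wt i
      set r := max τ (1 / ℓ)
      set b := min τ (1 / ℓ)
      have hf1 : Measurable fun p : ℝ × ℝ => f (p.1, p.2 + w) := hf.comp (by fun_prop)
      have hg1 : Measurable fun p : ℝ × ℝ =>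
          if p.1 / ℓ < b ∧ p.2 / r < w then f (p.1, w - p.2 / r) else g p.1 :=
        Measurable.ite (measurableSet_and (measurableSet_lt (by fun_prop) (by fun_prop))
          (measurableSet_lt (by fun_prop) (by fun_prop))) (hf.comp (by fun_prop))
          (hg.comp measurable_fst)
      have hmE : Measurable fun t : Draw X → ℝ => expOf (t (.entry i)) :=
        measurable_expOf.comp (measurable_pi_apply _)
      obtain ⟨hm1, hm2⟩ := measurable_fixedTauRun ℓ τ key wt x i
      have hmh : Measurable fun p : (Draw X → ℝ) × ℝ => p.1 (.hash x) :=
        (measurable_pi_apply _).comp measurable_fst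
      have hQ : Measurable fun p : (Draw X → ℝ) × ℝ =>
          if x ∈ (fixedTauRun ℓ τ key wt p.1 i).keys then
            f (p.1 (.hash x), (fixedTauRun ℓ τ key wt p.1 i).count x + w) else
          if p.1 (.hash x) / ℓ < b ∧ p.2 / r < w then f (p.1 (.hash x), w - p.2 / r)
            else g (p.1 (.hash x)) :=
        Measurable.ite (measurable_fst hm1) (hf1.comp (hmh.prodMk (hm2.comp measurable_fst)))
          (hg1.comp (hmh.prodMk measurable_snd))
      have key1 := lintegral_infinitePi_blocks (fun _ : Draw X => unifLaw) {Draw.entry i} hmE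
        (fun t t' h => by rw [h _ rfl])
        (Q := fun t e => if x ∈ (fixedTauRun ℓ τ key wt t i).keys then
            f (t (.hash x), (fixedTauRun ℓ τ key wt t i).count x + w) else
          if t (.hash x) / ℓ < b ∧ e / r < w then f (t (.hash x), w - e / r)
            else g (t (.hash x))) hQ
        (fun t t' e h => by
          rw [fixedTauRun_congr ℓ τ key wt i (fun z => h _ (by simp)) fun j hj =>
            h _ (by simp; omega), h (.hash x) (by simp)])
      have hE : (Measure.infinitePi fun _ : Draw X => unifLaw).map
          (fun t => expOf (t (.entry i))) = stdExp := by
        have h := Measure.map_map (μ := Measure.infinitePi fun _ : Draw X => unifLaw)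
          measurable_expOf (measurable_pi_apply (Draw.entry i : Draw X))
        rw [Measure.infinitePi_map_eval, map_expOf] at h
        exact h.symm
      rw [hE] at key1
      -- The induction hypothesis is used with both branches shifted by one element: a cached key
      -- gains `w`, and an uncached one faces the entry test, with its exponential integrated out.
      have key2 := ih hf1 (hg1.lintegral_prod_right' (ν := stdExp))
      have e1 : ∀ t : Draw X → ℝ, (if x ∈ (fixedTauRun ℓ τ key wt t (i + 1)).keys then
          f (t (.hash x), (fixedTauRun ℓ τ key wt t (i + 1)).count x) else g (t (.hash x))) =
          if x ∈ (fixedTauRun ℓ τ key wt t i).keys then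
            f (t (.hash x), (fixedTauRun ℓ τ key wt t i).count x + w) else
          if t (.hash x) / ℓ < b ∧ expOf (t (.entry i)) / r < w then
            f (t (.hash x), w - expOf (t (.entry i)) / r) else g (t (.hash x)) := fun t => by
        simp only [fixedTauRun, ← hx, mem_fixedTauStep_self, count_fixedTauStep_self]
        by_cases h1 : x ∈ (fixedTauRun ℓ τ key wt t i).keys
        · simp only [h1, true_or, if_true]; rfl
        · simp only [h1, false_or, if_false]
          by_cases h2 : t (.hash x) / ℓ < b ∧ expOf (t (.entry i)) / r < w
          · rw [if_pos h2, if_pos h2, if_pos h2]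
          · rw [if_neg h2, if_neg h2]
      rw [lintegral_congr e1]
      refine key1.trans (Eq.trans ?_ (key2.trans ?_))
      · refine lintegral_congr fun t => ?_
        by_cases h1 : x ∈ (fixedTauRun ℓ τ key wt t i).keys
        · simp only [h1, if_true]
          rw [lintegral_const, measure_univ, mul_one]
        · simp only [h1, if_false]
      · have hmL : Measurable fun a : ℝ × ℝ => if a.1 / ℓ < b ∧ a.2 / r < W then
            f (a.1, W - a.2 / r + w) else ∫⁻ e, (if a.1 / ℓ < b ∧ e / r < w then
              f (a.1, w - e / r) else g a.1) ∂stdExp :=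
          Measurable.ite (measurableSet_and (measurableSet_lt (by fun_prop) (by fun_prop))
            (measurableSet_lt (by fun_prop) (by fun_prop))) (hf.comp (by fun_prop))
            ((hg1.lintegral_prod_right' (ν := stdExp)).comp measurable_fst)
        have hmR : Measurable fun a : ℝ × ℝ => if a.1 / ℓ < b ∧ a.2 / r < W + w then
            f (a.1, W + w - a.2 / r) else g a.1 :=
          Measurable.ite (measurableSet_and (measurableSet_lt (by fun_prop) (by fun_prop))
            (measurableSet_lt (by fun_prop) (by fun_prop))) (hf.comp (by fun_prop))
            (hg.comp measurable_fst)
        unfold pairLaw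
        refine (lintegral_prod _ hmL.aemeasurable).trans
          (Eq.trans ?_ (lintegral_prod _ hmR.aemeasurable).symm)
        refine lintegral_congr fun h => ?_
        by_cases hb : h / ℓ < b
        · simp only [hb, true_and]
          exact lintegral_memoryless hr hW (hwt i).le (hf.comp measurable_prodMk_left) (g h)
        · simp only [hb, false_and, if_false, lintegral_const, measure_univ, mul_one]
    · rw [keyWeight_succ, Function.update_of_ne hx, ← ih hf hg]
      simp only [fixedTauRun, mem_fixedTauStep_of_ne hx]

theorem exists_fixedTau_law {ℓ : ℝ} (hℓ : 0 < ℓ) {τ : ℝ} (hτ : 0 ≤ τ) (key : ℕ → X) {wt : ℕ → ℝ}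
    (hwt : ∀ i, 0 < wt i) (n : ℕ) (x : X) {Ω : Type*} [MeasurableSpace Ω] {P : Measure Ω}
    [IsProbabilityMeasure P] {rnd : Draw X → Ω → ℝ} (hrnd : IsUniformTape rnd P) :
    ∃ ν : Measure ℝ, IsLossLaw ℓ (ENNReal.ofReal τ) (keyWeight key wt n x) ν ∧
      P.map (fun ω => (fixedTauRun ℓ τ key wt (fun d => rnd d ω) n).count x) =
        ν.map (fun y => max 0 (keyWeight key wt n x - y)) := by
  obtain ⟨ν, h1, h2⟩ := exists_isLossLaw hℓ hτ (keyWeight_nonneg key hwt n x)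
  refine ⟨ν, h1, Eq.trans ?_ h2⟩
  set W := keyWeight key wt n x
  have hmt : Measurable fun ω d => rnd d ω := measurable_pi_lambda _ hrnd.measurable
  obtain ⟨hm1, hm2⟩ := measurable_fixedTauRun ℓ τ key wt x n
  have hmc : Measurable fun a : ℝ × ℝ => if a.1 / ℓ < τ ∧ a.2 / max (1 / ℓ) τ < W then
      W - a.2 / max (1 / ℓ) τ else 0 :=
    Measurable.ite (measurableSet_and (measurableSet_lt (by fun_prop) (by fun_prop))
      (measurableSet_lt (by fun_prop) (by fun_prop))) (by fun_prop) measurable_const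
  refine Measure.ext_of_lintegral _ fun f hf => ?_
  rw [lintegral_map hf hmc]
  refine (lintegral_map hf (hm2.comp hmt)).trans ?_
  refine (lintegral_map (hf.comp hm2) hmt).symm.trans ?_
  rw [hrnd.map_eq_tapeLaw]
  refine Eq.trans (lintegral_congr fun t => ?_) ((lintegral_fixedTauRun (τ := τ) hℓ key hwt x n
    (f := fun p => f p.2) (hf.comp measurable_snd) (g := fun _ => f 0) measurable_const).trans
      (lintegral_congr_ae ?_))
  · rw [Function.comp_apply]
    split_ifs with h
    · rfl
    · rw [Counters.count, if_neg h]
  · filter_upwards [ae_pairLaw] with a ha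
    -- The base hash is below `1/ℓ` almost surely, so comparing it with `min τ (1/ℓ)` is the same as
    -- comparing it with `τ`.
    have h3 : a.1 / ℓ < 1 / ℓ := by have := ha.2.1; gcongr
    simp only [lt_min_iff, h3, and_true, max_comm τ]
    exact (apply_ite f _ _ _).symm

end FixedTau
theorem mainTheorem6 {X : Type*} [DecidableEq X]
    (ℓ : ℝ) (hℓ : 0 < ℓ)
    (key : ℕ → X) (wt : ℕ → ℝ) (hwt : ∀ i, 0 < wt i) (n : ℕ) (x : X)
    {Ω : Type*} [MeasurableSpace Ω] (P : Measure Ω) [IsProbabilityMeasure P]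
    (rnd : Draw X → Ω → ℝ) (hrnd : IsUniformTape rnd P)
    {Ω' : Type*} [MeasurableSpace Ω'] (P' : Measure Ω') [IsProbabilityMeasure P']
    (s : ScoreDraw X → Ω' → ℝ) (hs : IsScoreRandomizationOff x key wt s P') :
    -- fixed threshold
    (∀ τ : ℝ, 0 < τ →
      ∃ ν : Measure ℝ, IsLossLaw ℓ (ENNReal.ofReal τ) (keyWeight key wt n x) ν ∧
        P.map (fun ω => (fixedTauRun ℓ τ key wt (fun d => rnd d ω) n).count x) =
          ν.map (fun y => max 0 (keyWeight key wt n x - y))) ∧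
    -- fixed size: `R ω'` is the conditional law of the output (threshold, set of cached keys,
    -- count of `x`), given the randomization `ω'` of the other keys
    (∀ k : ℕ, 1 ≤ k →
      ∃ R : Kernel Ω' (ℝ≥0∞ × Set X × ℝ), IsMarkovKernel R ∧
        P'.bind R = P.map (fun ω => fixedSizeOutput k ℓ key wt n x (fun d => rnd d ω)) ∧
        ∀ᵐ ω' ∂P',
          (∀ᵐ o ∂(R ω'), x ∈ o.2.1 → o.1 = thresholdOff k ℓ key n x (fun d => s d ω')) ∧
          (∀ z, z ≠ x → ∀ᵐ o ∂(R ω'), x ∈ o.2.1 →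
            (z ∈ o.2.1 ↔ seed ℓ key n (fun d => s d ω') z <
              thresholdOff k ℓ key n x (fun d => s d ω'))) ∧
          ∃ ν : Measure ℝ,
            IsLossLaw ℓ (thresholdOff k ℓ key n x (fun d => s d ω')) (keyWeight key wt n x) ν ∧
            (R ω').map (fun o => o.2.2) =
              ν.map (fun y => max 0 (keyWeight key wt n x - y))) := by
  exact ⟨fun τ hτ => exists_fixedTau_law hℓ hτ.le key hwt n x hrnd,
    fun k hk => exists_conditional_law hk hℓ hwt n x hrnd hs⟩
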